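/- **Setting.** Let $d\ge 1$, $\Theta=\{\eta\in\mathbb R^d: |\eta|=1,\ \eta_1\ge 0\}$, $\theta_0\in\Theta$ and $m_0:\mathbb R\to\mathbb R$. Let $(X_i,\epsilon_i)$, $i\ge1$, be i.i.d. copies of $(X,\epsilon)\in\mathbb R^d\times\mathbb R$, and $Y_i=m_0(\theta_0^\top X_i)+\epsilon_i$ with $\mathbb E(\epsilon|X)=0$ a.s. Let $P_X$ be the law of $X$, $\chi$ its support, $\|g\|^2=\int g^2\,dP_X$, and $(g\circ\theta)(x)=g(\theta^\top x)$. For $\theta\in\Theta$ put $D_\theta=\{\theta^\top x:x\in\chi\}$, $D_0=D_{\theta_0}$, $D=\bigcup_{\theta\in\Theta}D_\theta$, and for $r>0$ put $D^{(r)}=\bigcup\{D_\theta:\theta\in\Theta,\ |\theta-\theta_0|\le r\}$. For an interval $I$ let $\mathcal R(I)$ be the class of convex functions on $I$ with an absolutely continuous first derivative (one-sided at end points), and $J_I^2(m)=\int_I m''(t)^2\,dt$. **Estimator.** Let $\hat\lambda_n>0$ be random variables (possibly depending on the data). For each $n\ge1$ let $(\hat m_n,\hat\theta_n)$ almost surely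 minimize $$\frac1n\sum_{i=1}^n\{Y_i-m(\theta^\top X_i)\}^2+\hat\lambda_n^2J_D^2(m)\qquad\text{over }(m,\theta)\in\mathcal R(D)\times\Theta .$$ **Assumptions.** - (A0) $\theta_{0,1}>0$. For some $d_1\in\{1,\dots,d\}$ the vector $(X_1,\dots,X_{d_1})$ has a continuous distribution (a joint Lebesgue density) and $X_{d_1+1},\dots,X_d$ are discrete. There are $c_0,\dots,c_{d-d_1}\in\mathbb R^{d-d_1}$ with $c_l-c_0$ ($1\le l\le d-d_1$) linearly independent, and a nonempty open interval contained in $\bigcap_{l}\{\theta_0^\top x:x\in\chi,\ (x_{d_1+1},\dots,x_d)=c_l\}$. - (A1) $\chi$ is compact. - (A2) There is $K_1>0$ with $K_1\,\mathbb E[\exp(\epsilon^2/K_1)-1\mid X]\le 1$ a.s. - (A3) $\mathbb E[XX^\top\{m_0'(\theta_0^\top X)\}^2]$ is nonsingular. - (A4) $\mathrm{Var}(X)$ is positive definite. - (A5) There is $r>0$ such that for all $\theta\in\Theta$ with $|\theta-\theta_0|\le r$: $\theta^\top X$ has a Lebesgue density that is bounded away from zero on $D_\theta$ and bounded above by a finite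 constant independent of $\theta$, and $D_\theta\subsetneq D^{(r)}$. The true index set $D_0$ is an interval. - (ND) The conditional distribution of $X$ given $\theta_0^\top X$ is nondegenerate: for every $v\in\mathbb R^d$ that is not a multiple of $\theta_0$, the conditional distribution of $v^\top X$ given $\theta_0^\top X$ is almost surely not a point mass. - (P1) With $r$ as in (A5), $m_0$ is bounded on $D^{(r)}$, $m_0\in\mathcal R(D^{(r)})$, and $J_{D^{(r)}}(m_0)<\infty$. - (P2) $\hat\lambda_n^{-1}=O_p(n^{2/5})$ and $\hat\lambda_n=o_p(n^{-1/4})$. **Theorem.** Under these assumptions, $$\|\hat m_n'\circ\theta_0-m_0'\circ\theta_0\|=O_p(\hat\lambda_n^{1/2}),$$ that is, for every $\varepsilon>0$ there is $M<\infty$ such that $\mathbb P\big(\|\hat m_n'\circ\theta_0-m_0'\circ\theta_0\|>M\hat\lambda_n^{1/2}\big)\le\varepsilon$ for all sufficiently large $n$. -/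

import Mathlib

open MeasureTheory ProbabilityTheory Filter Topology Set
open scoped ENNReal NNReal

noncomputable section

namespace ConvexSIM

/-- `ℝ^d` with the Euclidean norm. -/
abbrev Vec (d : ℕ) : Type := EuclideanSpace ℝ (Fin d)

/-- The parameter space `Θ`: unit vectors with nonnegative first coordinate. -/
def ParamSpace (d : ℕ) [NeZero d] : Set (Vec d) := {η | ‖η‖ = 1 ∧ 0 ≤ η 0}

/-- `D_θ = {θᵀx : x ∈ χ}`. -/
def indexSet {d : ℕ} (χ : Set (Vec d)) (θ : Vec d) : Set ℝ :=
  {t | ∃ x ∈ χ, t = inner ℝ θ x}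

/-- `D = {θᵀx : x ∈ χ, θ ∈ Θ}`, the common domain of the candidate link functions. -/
def fullIndexSet {d : ℕ} [NeZero d] (χ : Set (Vec d)) : Set ℝ :=
  {t | ∃ θ ∈ ParamSpace d, t ∈ indexSet χ θ}

/-- `D^(r)`, the union of the sets `D_θ` over the `θ ∈ Θ` with `|θ - θ₀| ≤ r`. -/
def localIndexSet {d : ℕ} [NeZero d] (χ : Set (Vec d)) (θ₀ : Vec d) (r : ℝ) : Set ℝ :=
  {t | ∃ θ ∈ ParamSpace d, ‖θ - θ₀‖ ≤ r ∧ t ∈ indexSet χ θ}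

/-- The first derivative of `m` on `D` (one-sided at the end points). -/
def linkDeriv (D : Set ℝ) (m : ℝ → ℝ) : ℝ → ℝ := derivWithin m D

/-- The class `𝓡` of convex functions on `D` with an absolutely continuous first derivative.
Only the values of `m` on `D` matter. -/
structure IsConvexLink (D : Set ℝ) (m : ℝ → ℝ) : Prop where
  convexOn : ConvexOn ℝ D m
  differentiableOn : DifferentiableOn ℝ m D
  absolutelyContinuous_deriv : ∀ a b : ℝ, a ≤ b → Icc a b ⊆ D →
    AbsolutelyContinuousOnInterval (linkDeriv D m) a b

/-- The roughness penalty `J²(m) = ∫_D m''(t)² dt`, with the value `∞` allowed. -/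
def roughness (D : Set ℝ) (m : ℝ → ℝ) : ℝ≥0∞ :=
  ∫⁻ t in D, ENNReal.ofReal ((derivWithin (linkDeriv D m) D t) ^ 2)

/-- The penalized loss `n⁻¹ ∑ (yᵢ - m(θᵀxᵢ))² + lam² J²(m)`. -/
def penalizedLoss {d n : ℕ} (D : Set ℝ) (x : Fin n → Vec d) (y : Fin n → ℝ) (lam : ℝ)
    (m : ℝ → ℝ) (θ : Vec d) : ℝ≥0∞ :=
  ENNReal.ofReal ((1 / (n : ℝ)) * ∑ i, (y i - m (inner ℝ θ (x i))) ^ 2)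
    + ENNReal.ofReal (lam ^ 2) * roughness D m

/-- `(m, θ)` is a penalized least squares estimate: it minimizes the penalized loss
over `𝓡 × Θ`. -/
def IsPLSE {d n : ℕ} [NeZero d] (D : Set ℝ) (x : Fin n → Vec d) (y : Fin n → ℝ) (lam : ℝ)
    (m : ℝ → ℝ) (θ : Vec d) : Prop :=
  IsConvexLink D m ∧ θ ∈ ParamSpace d ∧
    ∀ (m' : ℝ → ℝ) (θ' : Vec d), IsConvexLink D m' → θ' ∈ ParamSpace d →
      penalizedLoss D x y lam m θ ≤ penalizedLoss D x y lam m' θ'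

section Assumptions

variable {Ω : Type*} [MeasurableSpace Ω]

/-- `A_n = O_p(B_n)` for nonnegative random quantities. -/
def IsBigOp (μ : Measure Ω) (A B : ℕ → Ω → ℝ≥0∞) : Prop :=
  ∀ ε : ℝ≥0∞, 0 < ε → ∃ M : ℝ≥0, ∀ᶠ n in atTop, μ {ω | (M : ℝ≥0∞) * B n ω < A n ω} ≤ ε

/-- `A_n = o_p(B_n)` for nonnegative random quantities. -/
def IsLittleOp (μ : Measure Ω) (A B : ℕ → Ω → ℝ≥0∞) : Prop :=
  ∀ δ : ℝ≥0, 0 < δ → Tendsto (fun n => μ {ω | (δ : ℝ≥0∞) * B n ω < A n ω}) atTop (𝓝 0)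

/-- The single index model `Y = m₀(θ₀ᵀX) + ξ`, sampled independently: `(X i, ξ i)` are
i.i.d. and `Y i = m₀(θ₀ᵀ X i) + ξ i`. -/
structure IsSingleIndexSample {d : ℕ} (μ : Measure Ω) (X : ℕ → Ω → Vec d) (ξ Y : ℕ → Ω → ℝ)
    (m₀ : ℝ → ℝ) (θ₀ : Vec d) : Prop where
  measurable_X : ∀ i, Measurable (X i)
  measurable_ξ : ∀ i, Measurable (ξ i)
  indep : iIndepFun (fun i ω => (X i ω, ξ i ω)) μ
  identDistrib : ∀ i, IdentDistrib (fun ω => (X i ω, ξ i ω)) (fun ω => (X 0 ω, ξ 0 ω)) μ μ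
  model : ∀ i, ∀ᵐ ω ∂μ, Y i ω = m₀ (inner ℝ θ₀ (X i ω)) + ξ i ω

/-- Mixed continuous/discrete design: for some `1 ≤ d₁ ≤ d` the first `d₁` coordinates of `X`
have a (joint) continuous distribution, the other coordinates are discrete, and there are
`c_0, …, c_{d-d₁} ∈ ℝ^{d-d₁}` with `c_l - c_0` (`l ≥ 1`) linearly independent and a nonempty
open interval contained in each `{θ₀ᵀx : x ∈ χ, (x_{d₁+1}, …, x_d) = c_l}`. -/
def MixedDesign {d : ℕ} (μ : Measure Ω) (X : Ω → Vec d) (θ₀ : Vec d) : Prop :=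
  ∃ d₁ : ℕ, 1 ≤ d₁ ∧ d₁ ≤ d ∧
    (μ.map (fun ω (j : {j : Fin d // (j : ℕ) < d₁}) => X ω j) ≪ volume) ∧
    (∀ j : Fin d, d₁ ≤ (j : ℕ) → ∃ S : Set ℝ, S.Countable ∧ ∀ᵐ ω ∂μ, X ω j ∈ S) ∧
    ∃ (a b : ℝ) (c : Fin (d - d₁ + 1) → ({j : Fin d // d₁ ≤ (j : ℕ)} → ℝ)), a < b ∧
      LinearIndependent ℝ (fun l : Fin (d - d₁) => c l.succ - c 0) ∧
      ∀ l, Ioo a b ⊆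
        indexSet {x | x ∈ (μ.map X).support ∧ ∀ j : {j : Fin d // d₁ ≤ (j : ℕ)}, x j = c l j} θ₀

/-- Conditionally centered, uniformly sub-Gaussian errors. -/
def SubGaussianErrors {d : ℕ} (μ : Measure Ω) (X : Ω → Vec d) (ξ : Ω → ℝ) : Prop :=
  (∃ K : ℝ, 0 < K ∧ Integrable (fun ω => Real.exp (ξ ω ^ 2 / K)) μ ∧
    ∀ᵐ ω ∂μ, K * (μ[fun ω' => Real.exp (ξ ω' ^ 2 / K) - 1 |
      MeasurableSpace.comap X inferInstance]) ω ≤ 1) ∧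
  μ[ξ | MeasurableSpace.comap X inferInstance] =ᵐ[μ] 0

/-- The matrix `E[X Xᵀ g(θ₀ᵀX)²]`. -/
def weightedGram {d : ℕ} (μ : Measure Ω) (X : Ω → Vec d) (θ₀ : Vec d) (g : ℝ → ℝ) :
    Matrix (Fin d) (Fin d) ℝ :=
  Matrix.of fun i j => ∫ ω, X ω i * X ω j * (g (inner ℝ θ₀ (X ω))) ^ 2 ∂μ

/-- The covariance matrix of `X`. -/
def covMatrix {d : ℕ} (μ : Measure Ω) (X : Ω → Vec d) : Matrix (Fin d) (Fin d) ℝ :=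
  Matrix.of fun i j => covariance (fun ω => X ω i) (fun ω => X ω j) μ

/-- The conditional distribution of `X` given `θ₀ᵀX` is nondegenerate: for every direction `v`
that is not a multiple of `θ₀`, the conditional distribution of `vᵀX` given `θ₀ᵀX` is almost
surely not a point mass. -/
def NondegenerateGivenIndex {d : ℕ} (μ : Measure Ω) [IsFiniteMeasure μ] (X : Ω → Vec d)
    (θ₀ : Vec d) : Prop :=
  ∀ v : Vec d, v ∉ Submodule.span ℝ {θ₀} →
    ∀ᵐ u ∂(μ.map fun ω => inner ℝ θ₀ (X ω)), ∀ c : ℝ,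
      condDistrib (fun ω => inner ℝ v (X ω)) (fun ω => inner ℝ θ₀ (X ω)) μ u ≠ Measure.dirac c

/-- For every `θ ∈ Θ` with `|θ - θ₀| ≤ r`, the index `θᵀX` has a Lebesgue density that is bounded
away from zero on `D_θ` and bounded above by a constant independent of `θ`, and `D_θ` is a
proper subset of `D^(r)`. -/
def RegularIndexDensity {d : ℕ} [NeZero d] (μ : Measure Ω) (X : Ω → Vec d) (θ₀ : Vec d)
    (r : ℝ) : Prop :=
  (∃ C : ℝ, ∀ θ ∈ ParamSpace d, ‖θ - θ₀‖ ≤ r →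
    ∃ (f : ℝ → ℝ) (c : ℝ), 0 < c ∧ Measurable f ∧
      μ.map (fun ω => inner ℝ θ (X ω)) = volume.withDensity (fun t => ENNReal.ofReal (f t)) ∧
      (∀ t ∈ indexSet (μ.map X).support θ, c ≤ f t) ∧ ∀ t, f t ≤ C) ∧
  ∀ θ ∈ ParamSpace d, ‖θ - θ₀‖ ≤ r →
    indexSet (μ.map X).support θ ⊂ localIndexSet (μ.map X).support θ₀ r

/-- The true link is convex and bounded on `D`, with an absolutely continuous first derivative
and finite roughness. -/
structure SmoothTrueLink (D : Set ℝ) (m₀ : ℝ → ℝ) : Prop where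
  isConvexLink : IsConvexLink D m₀
  bounded : ∃ M : ℝ, ∀ t ∈ D, |m₀ t| ≤ M
  roughness_lt_top : roughness D m₀ < ∞

/-- Random positive tuning parameters with `lam_n⁻¹ = O_p(n^{2/5})`, `lam_n = o_p(n^{-1/4})`. -/
structure TuningRate (μ : Measure Ω) (lam : ℕ → Ω → ℝ) : Prop where
  measurable : ∀ n, Measurable (lam n)
  pos : ∀ n, ∀ᵐ ω ∂μ, 0 < lam n ω
  inv_rate : IsBigOp μ (fun n ω => ENNReal.ofReal (lam n ω)⁻¹)
    (fun n _ => ENNReal.ofReal ((n : ℝ) ^ (2 / 5 : ℝ)))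
  rate : IsLittleOp μ (fun n ω => ENNReal.ofReal (lam n ω))
    (fun n _ => ENNReal.ofReal ((n : ℝ) ^ (-(1 / 4) : ℝ)))

end Assumptions

end ConvexSIM

end

/-!
The estimator is compared with the truth by the basic inequality of penalized least squares
(`IsPLSE.basic_inequality`): the squared empirical distance of `m̂(θ̂ᵀx)` and `m₀(θ₀ᵀx)` plus
`λ²J²(m̂)` is at most twice the empirical inner product of the errors with the difference, plus
`λ²J²(m₀)`. The inner product is bounded for all links and directions at once. For a fixed
direction, links are approximated by piecewise linear functions on `2ᵏ N` cells
(`exists_piecewise_linear_approx`); the projection of a sub-Gaussian vector to a space of dimension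
`p` has length of order `√p` (`IsSubGaussianVec.measure_subspace_le`); and summation over `k`
(`chaining_bound`) with `N` of order `n^{1/5}` gives the bound up to probability `exp(-n^{1/5})`,
which allows a union bound over a grid of directions (`tendsto_measure_not_noiseBound`). The result
is the empirical rate `λ` and a bounded roughness (`exists_rate_bound`,
`exists_withHighProb_empirical_rate`). The values and the derivative of `m̂` are then bounded as
well, because a link of bounded roughness is nearly affine and an affine function of an index is
controlled by its empirical norm when the covariance matrix is positive definite.

Consistency follows by compactness. Convex links with bounded value, bounded derivative and bounded
roughness form a compact class, so that a uniform law of large numbers holds, and the truth is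
identified (`eq_direction_of_ae_eq`): if `m(θᵀX) = m₀(θ₀ᵀX)` almost surely, then differentiating in
the first coordinate, which is continuously distributed, gives a second relation between `θᵀX` and
`θ₀ᵀX`. Since `m` is convex, the two relations make `θᵀX` a function of `θ₀ᵀX` wherever `m₀' ≠ 0`,
which nondegeneracy excludes unless `θ = θ₀`.

Near the truth, `m̂(θ̂ᵀx) - m₀(θ₀ᵀx)` is to first order `(m̂ - m₀)(θ₀ᵀx) + (θ̂ - θ₀)ᵀx m₀'(θ₀ᵀx)`.
On `n^{2/5}` cells the first summand is a step function of the index up to an error `O(n^{-2/5})`.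
By nondegeneracy the two summands cannot cancel (`exists_angle_bound`), and concentration of Gram
matrices transfers this from the population to the sample
(`tendsto_measure_not_stepPlusLinear_bound`). Hence `‖(m̂ - m₀) ∘ θ₀‖ = O_p(λ)`
(`exists_integral_sq_sub_le_of_close`), where `n^{-2/5} = O_p(λ)` is used. Interpolation between a
function, its derivative and its roughness at the scale `√λ` (`IsEnergyLink.integral_sq_deriv_le`)
turns the rate `λ` for the link into the rate `√λ` for its derivative; the bounds on the density of
the index pass between Lebesgue measure and its law.
-/

/-! ### Links of finite energy and linear extension -/

namespace ConvexSIM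

/-- A continuously differentiable link `m` on the line with derivative `p`, together with a finite
measure `ν` that controls the increments of `p` the way `ν = (m'')² dt` does. Recording the energy
as a measure makes it additive over disjoint intervals and spares all second derivatives. -/
structure IsEnergyLink (m p : ℝ → ℝ) (ν : Measure ℝ) : Prop where
  finite : IsFiniteMeasure ν
  hasDerivAt : ∀ t, HasDerivAt m (p t) t
  sq_sub_le : ∀ s t, s ≤ t → (p t - p s) ^ 2 ≤ (t - s) * ν.real (Ioc s t)

/-- The Cauchy–Schwarz inequality for an interval integral. -/
theorem sq_intervalIntegral_le {f : ℝ → ℝ} {s t : ℝ} (hst : s ≤ t)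
    (hf : IntervalIntegrable f volume s t)
    (hf2 : IntervalIntegrable (fun u => f u ^ 2) volume s t) :
    (∫ u in s..t, f u) ^ 2 ≤ (t - s) * ∫ u in s..t, f u ^ 2 := by
  rcases hst.eq_or_lt with rfl | hlt
  · simp
  set c := (∫ u in s..t, f u) / (t - s) with hc
  have hpos : 0 < t - s := by linarith
  have h0 : 0 ≤ ∫ u in s..t, (f u - c) ^ 2 :=
    intervalIntegral.integral_nonneg hst fun u _ => sq_nonneg _
  have h1 : ∫ u in s..t, (f u - c) ^ 2
      = (∫ u in s..t, f u ^ 2) - 2 * c * (∫ u in s..t, f u) + c ^ 2 * (t - s) := by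
    have : ∀ u, (f u - c) ^ 2 = (f u ^ 2 - 2 * c * f u) + c ^ 2 := fun u => by ring
    simp_rw [this]
    rw [intervalIntegral.integral_add (hf2.sub (hf.const_mul _)) (by simp),
      intervalIntegral.integral_sub hf2 (hf.const_mul _)]
    simp
    ring
  have h2 : (∫ u in s..t, f u) = c * (t - s) := by rw [hc]; field_simp
  rw [h1, h2] at h0
  rw [h2]
  nlinarith

theorem derivWithin_Icc_eq_deriv {a b t : ℝ} (q : ℝ → ℝ) (ht : t ∈ Ioo a b) :
    derivWithin q (Icc a b) t = deriv q t :=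
  derivWithin_of_mem_nhds (Icc_mem_nhds ht.1 ht.2)

theorem roughness_Icc (a b : ℝ) (m : ℝ → ℝ) :
    roughness (Icc a b) m
      = ∫⁻ t in Ioo a b, ENNReal.ofReal ((deriv (linkDeriv (Icc a b) m) t) ^ 2) := by
  unfold roughness
  rw [Measure.restrict_congr_set (Ioo_ae_eq_Icc (μ := volume) (a := a) (b := b)).symm]
  refine setLIntegral_congr_fun measurableSet_Ioo fun t ht => ?_
  simp only [derivWithin_Icc_eq_deriv _ ht]

/-- A convex link of finite roughness on a compact interval extends linearly to the whole line. -/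
theorem IsConvexLink.exists_extension {a b : ℝ} (hab : a < b) {m : ℝ → ℝ}
    (hm : IsConvexLink (Icc a b) m) (hJ : roughness (Icc a b) m < ∞) :
    ∃ (mt p : ℝ → ℝ) (ν : Measure ℝ), IsEnergyLink mt p ν ∧ Monotone p ∧
      (∀ t ∈ Icc a b, mt t = m t) ∧
      (∀ t, p t = linkDeriv (Icc a b) m (max a (min b t))) ∧
      ν univ = roughness (Icc a b) m := by
  set q := linkDeriv (Icc a b) m with hq
  have hAC : AbsolutelyContinuousOnInterval q a b :=
    hm.absolutelyContinuous_deriv a b hab.le subset_rfl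
  have hqc : ContinuousOn q (Icc a b) := by
    simpa [uIcc_of_le hab.le] using hAC.continuousOn
  have hqm : MonotoneOn q (Icc a b) := hm.convexOn.monotoneOn_derivWithin hm.differentiableOn
  have hclamp : ∀ t, max a (min b t) ∈ Icc a b := fun t =>
    ⟨le_max_left _ _, max_le hab.le (min_le_left _ _)⟩
  set p : ℝ → ℝ := fun t => q (max a (min b t)) with hp
  have hpc : Continuous p := hqc.comp_continuous (by fun_prop) hclamp
  have hpq : ∀ t ∈ Icc a b, p t = q t := fun t ht => by
    simp [hp, min_eq_right ht.2, max_eq_right ht.1]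
  set F : ℝ → ℝ≥0∞ := fun t => ENNReal.ofReal ((deriv q t) ^ 2) with hF
  have hFm : Measurable F := (measurable_deriv q).pow_const 2 |>.ennreal_ofReal
  -- the energy measure has density `(q')²` on the open interval and no mass elsewhere
  set ν : Measure ℝ := (volume.restrict (Ioo a b)).withDensity F with hν
  have hνu : ν univ = roughness (Icc a b) m := by
    rw [roughness_Icc, hν, withDensity_apply _ MeasurableSet.univ]; simp [hF, hq]
  have hfin : IsFiniteMeasure ν := ⟨by rw [hνu]; exact hJ⟩
  have hkey : ∀ s t, a ≤ s → s ≤ t → t ≤ b → (q t - q s) ^ 2 ≤ (t - s) * ν.real (Ioc s t) := by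
    intro s t has hst htb
    have hACst : AbsolutelyContinuousOnInterval q s t :=
      hAC.mono (by rw [uIcc_of_le hst, uIcc_of_le hab.le]; exact Icc_subset_Icc has htb)
    have hν2 : ν (Ioc s t) = ∫⁻ u in Ioc s t, F u := by
      rw [hν, withDensity_apply _ measurableSet_Ioc, Measure.restrict_restrict measurableSet_Ioc]
      refine setLIntegral_congr ?_
      have h1 : (Ioc s t ∩ Ioo a b : Set ℝ) =ᵐ[volume] (Ioc s t ∩ Ioc a b : Set ℝ) :=
        (ae_eq_refl _).inter Ioo_ae_eq_Ioc
      refine h1.trans (Eq.eventuallyEq ?_)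
      exact inter_eq_left.2 (Ioc_subset_Ioc has htb)
    have hint2 : IntervalIntegrable (fun u => deriv q u ^ 2) volume s t := by
      rw [intervalIntegrable_iff_integrableOn_Ioc_of_le hst]
      refine ⟨((measurable_deriv q).pow_const 2).aestronglyMeasurable, ?_⟩
      rw [hasFiniteIntegral_iff_ofReal (Eventually.of_forall fun u => sq_nonneg _)]
      have : ∫⁻ u in Ioc s t, F u < ∞ := by rw [← hν2]; exact measure_lt_top _ _
      exact this
    have h := sq_intervalIntegral_le hst hACst.intervalIntegrable_deriv hint2
    rw [hACst.integral_deriv_eq_sub] at h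
    refine h.trans (mul_le_mul_of_nonneg_left (le_of_eq ?_) (by linarith))
    rw [intervalIntegral.integral_of_le hst, Measure.real, hν2,
      integral_eq_lintegral_of_nonneg_ae (Eventually.of_forall fun u => sq_nonneg _)
        ((measurable_deriv q).pow_const 2).aestronglyMeasurable]
  refine ⟨fun t => m a + ∫ u in a..t, p u, p, ν, ⟨hfin, ?_, ?_⟩, ?_, ?_, fun t => rfl, hνu⟩
  · intro t
    exact (intervalIntegral.integral_hasDerivAt_right (hpc.intervalIntegrable _ _)
      (hpc.stronglyMeasurableAtFilter _ _) hpc.continuousAt).const_add _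
  · intro s t hst
    -- clamping to `[a, b]` is a contraction, and what it maps outside `(s, t]` carries no energy
    have h := hkey (max a (min b s)) (max a (min b t)) (hclamp s).1
      (max_le_max le_rfl (min_le_min le_rfl hst)) (hclamp t).2
    refine h.trans (mul_le_mul ?_ ?_ measureReal_nonneg (by linarith))
    · rcases le_total b s with h1 | h1 <;> rcases le_total b t with h2 | h2 <;>
      rcases le_total a s with h3 | h3 <;> rcases le_total a t with h4 | h4 <;>
      simp [h1, h2, h3, h4, hab.le] <;> linarith
    · have hsub : Ioc (max a (min b s)) (max a (min b t)) ⊆ Ioc s t ∪ (Ioo a b)ᶜ := by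
        rintro u ⟨hu1, hu2⟩
        by_cases hu : u ∈ Ioo a b
        · left
          simp only [max_lt_iff, min_lt_iff, le_max_iff, le_min_iff] at hu1 hu2
          obtain ⟨hu3, hu4⟩ := hu
          constructor
          · rcases hu1.2 with h | h
            · linarith
            · exact h
          · rcases hu2 with h | h
            · linarith
            · exact h.2
        · right; exact hu
      have hz : ν (Ioo a b)ᶜ = 0 := by
        rw [hν, withDensity_apply _ measurableSet_Ioo.compl,
          Measure.restrict_restrict measurableSet_Ioo.compl]
        simp
      have hz' : ν.real (Ioo a b)ᶜ = 0 := by simp [Measure.real, hz]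
      calc ν.real (Ioc (max a (min b s)) (max a (min b t)))
          ≤ ν.real (Ioc s t ∪ (Ioo a b)ᶜ) := measureReal_mono hsub
        _ ≤ ν.real (Ioc s t) + ν.real (Ioo a b)ᶜ := measureReal_union_le _ _
        _ = ν.real (Ioc s t) := by rw [hz', add_zero]
  · intro s t hst
    exact hqm (hclamp s) (hclamp t) (max_le_max le_rfl (min_le_min le_rfl hst))
  · intro t ht
    have hmc : ContinuousOn m (Icc a b) := hm.differentiableOn.continuousOn
    have h := intervalIntegral.integral_eq_sub_of_hasDerivAt_of_le (f := m) (f' := p)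
      (a := a) (b := t) ht.1 (hmc.mono (Icc_subset_Icc le_rfl ht.2)) ?_
      (hpc.intervalIntegrable _ _)
    · simp only [h]; ring
    · intro u hu
      have hu' : u ∈ Ioo a b := ⟨hu.1, hu.2.trans_le ht.2⟩
      rw [hpq u ⟨hu'.1.le, hu'.2.le⟩, hq, linkDeriv]
      exact ((hm.differentiableOn u ⟨hu'.1.le, hu'.2.le⟩).hasDerivWithinAt).hasDerivAt
        (Icc_mem_nhds hu'.1 hu'.2)

theorem linkDeriv_of_hasDerivAt {a b : ℝ} (hab : a < b) {m p : ℝ → ℝ}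
    (h : ∀ t, HasDerivAt m (p t) t) {t : ℝ} (ht : t ∈ Icc a b) : linkDeriv (Icc a b) m t = p t :=
  (h t).hasDerivWithinAt.derivWithin (uniqueDiffOn_Icc hab t ht)

/-- The linear extension of a convex link from a compact interval is admissible on a larger one,
and is no rougher. -/
theorem IsConvexLink.extension_admissible {a b a' b' : ℝ} (hab : a < b)
    (hsub : Icc a b ⊆ Icc a' b') {m mt p : ℝ → ℝ} (hm : IsConvexLink (Icc a b) m)
    (hd : ∀ t, HasDerivAt mt (p t) t) (hpm : Monotone p)
    (hp : ∀ t, p t = linkDeriv (Icc a b) m (max a (min b t))) :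
    IsConvexLink (Icc a' b') mt ∧ roughness (Icc a' b') mt ≤ roughness (Icc a b) m := by
  have hab' : a' < b' := by
    have h1 := (hsub (left_mem_Icc.2 hab.le)).1
    have h2 := (hsub (right_mem_Icc.2 hab.le)).2
    linarith
  set q := linkDeriv (Icc a b) m with hq
  have hAC : AbsolutelyContinuousOnInterval q a b :=
    hm.absolutelyContinuous_deriv a b hab.le subset_rfl
  have hlink : ∀ t ∈ Icc a' b', linkDeriv (Icc a' b') mt t = p t := fun t ht =>
    linkDeriv_of_hasDerivAt hab' hd ht
  -- the derivative of the extension is absolutely continuous, being the integral of `f`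
  set f : ℝ → ℝ := (Ioc a b).indicator (deriv q) with hf
  have hqi : IntegrableOn (deriv q) (Ioc a b) := by
    have := hAC.intervalIntegrable_deriv
    rwa [intervalIntegrable_iff_integrableOn_Ioc_of_le hab.le] at this
  have hfi : Integrable f := (integrable_indicator_iff measurableSet_Ioc).2 hqi
  have hpint : ∀ t, p t = q a + ∫ u in a..t, f u := by
    intro t
    have hACt : AbsolutelyContinuousOnInterval q a (max a (min b t)) :=
      hAC.mono (by
        rw [uIcc_of_le (le_max_left _ _), uIcc_of_le hab.le]
        exact Icc_subset_Icc le_rfl (max_le hab.le (min_le_left _ _)))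
    rw [hp t, ← sub_eq_iff_eq_add', ← hACt.integral_deriv_eq_sub,
      intervalIntegral.integral_of_le (le_max_left _ _)]
    rcases le_total a t with hat | hat
    · rw [intervalIntegral.integral_of_le hat, hf, setIntegral_indicator measurableSet_Ioc,
        Ioc_inter_Ioc, max_self, max_eq_right (le_min hab.le hat), min_comm]
    · rw [intervalIntegral.integral_of_ge hat, hf, setIntegral_indicator measurableSet_Ioc,
        Ioc_inter_Ioc, max_eq_right hat, min_eq_left hab.le,
        max_eq_left ((min_le_right b t).trans hat)]
      simp
  refine ⟨⟨?_, fun t _ => (hd t).differentiableAt.differentiableWithinAt, ?_⟩, ?_⟩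
  · have : ConvexOn ℝ univ mt := by
      refine MonotoneOn.convexOn_of_deriv convex_univ ?_ ?_ ?_
      · exact fun t _ => (hd t).continuousAt.continuousWithinAt
      · exact fun t _ => (hd t).differentiableAt.differentiableWithinAt
      · intro s _ t _ hst
        rw [(hd s).deriv, (hd t).deriv]
        exact hpm hst
    exact this.subset (subset_univ _) (convex_Icc _ _)
  · intro s t hst hsubst
    have h1 : AbsolutelyContinuousOnInterval (fun x => ∫ u in s..x, f u) s t :=
      hfi.intervalIntegrable.absolutelyContinuousOnInterval_intervalIntegral (by simp)
    have h2 : AbsolutelyContinuousOnInterval (fun _ : ℝ => p s) s t :=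
      (LipschitzWith.const (p s)).lipschitzOnWith.absolutelyContinuousOnInterval
    have h3 := h2.add h1
    rw [absolutelyContinuousOnInterval_iff] at h3 ⊢
    intro ε hε
    obtain ⟨δ, hδ, h⟩ := h3 ε hε
    refine ⟨δ, hδ, fun E hE hE' => ?_⟩
    refine lt_of_eq_of_lt (Finset.sum_congr rfl fun i hi => ?_) (h E hE hE')
    have hmem := hE.1 i hi
    rw [uIcc_of_le hst] at hmem
    have hval : ∀ x ∈ Icc s t, linkDeriv (Icc a' b') mt x
        = ((fun _ : ℝ => p s) + fun x => ∫ u in s..x, f u) x := by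
      intro x hx
      rw [hlink x (hsubst hx), Pi.add_apply, hpint x, hpint s, add_assoc,
        intervalIntegral.integral_add_adjacent_intervals hfi.intervalIntegrable
          hfi.intervalIntegrable]
    rw [hval _ hmem.1, hval _ hmem.2]
  · rw [roughness_Icc, roughness_Icc, ← hq]
    have hder : ∀ t ∈ Ioo a' b', deriv (linkDeriv (Icc a' b') mt) t = deriv p t := by
      intro t ht
      refine Filter.EventuallyEq.deriv_eq ?_
      filter_upwards [Icc_mem_nhds ht.1 ht.2] with u hu using hlink u hu
    rw [setLIntegral_congr_fun (g := fun t => ENNReal.ofReal ((deriv p t) ^ 2)) measurableSet_Ioo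
      (fun t ht => by simp only [hder t ht])]
    have hins : ∀ t ∈ Ioo a b, deriv p t = deriv q t := by
      intro t ht
      refine Filter.EventuallyEq.deriv_eq ?_
      filter_upwards [Ioo_mem_nhds ht.1 ht.2] with u hu
      rw [hp u, min_eq_right hu.2.le, max_eq_right hu.1.le]
    have hout : ∀ t ∉ Icc a b, deriv p t = 0 := by
      intro t ht
      rw [mem_Icc, not_and_or, not_le, not_le] at ht
      rcases ht with ht | ht
      · have : p =ᶠ[𝓝 t] fun _ => q a := by
          filter_upwards [Iio_mem_nhds ht] with u hu
          rw [hp u, max_eq_left ((min_le_right b u).trans (le_of_lt hu))]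
        rw [this.deriv_eq]; simp
      · have : p =ᶠ[𝓝 t] fun _ => q b := by
          filter_upwards [Ioi_mem_nhds ht] with u hu
          rw [hp u, min_eq_left (le_of_lt hu), max_eq_right hab.le]
        rw [this.deriv_eq]; simp
    calc ∫⁻ t in Ioo a' b', ENNReal.ofReal ((deriv p t) ^ 2)
        ≤ ∫⁻ t, ENNReal.ofReal ((deriv p t) ^ 2) := setLIntegral_le_lintegral _ _
      _ = ∫⁻ t in Icc a b, ENNReal.ofReal ((deriv p t) ^ 2) := by
          rw [← lintegral_indicator measurableSet_Icc]
          congr 1; ext t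
          by_cases ht : t ∈ Icc a b
          · simp [ht]
          · simp [ht, hout t ht]
      _ = ∫⁻ t in Ioo a b, ENNReal.ofReal ((deriv p t) ^ 2) :=
          setLIntegral_congr Ioo_ae_eq_Icc.symm
      _ = ∫⁻ t in Ioo a b, ENNReal.ofReal ((deriv q t) ^ 2) :=
          setLIntegral_congr_fun measurableSet_Ioo fun t ht => by simp only [hins t ht]
      _ ≤ _ := le_rfl

end ConvexSIM

/-! ### Piecewise linear approximation and chaining -/

namespace ConvexSIM

/-- The error of the tangent at the left end of an interval is controlled by the energy on the
interval. -/
theorem IsEnergyLink.abs_sub_tangent_le {m p : ℝ → ℝ} {ν : Measure ℝ} (h : IsEnergyLink m p ν)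
    {a t : ℝ} (hat : a ≤ t) :
    (m t - (m a + p a * (t - a))) ^ 2 ≤ (t - a) ^ 3 * ν.real (Ioc a t) := by
  have := h.finite
  set C := Real.sqrt ((t - a) * ν.real (Ioc a t)) with hC
  have hC0 : 0 ≤ (t - a) * ν.real (Ioc a t) := mul_nonneg (by linarith) measureReal_nonneg
  have hb : ∀ u ∈ Icc a t, ‖p u - p a‖ ≤ C := by
    intro u hu
    rw [Real.norm_eq_abs]
    apply Real.abs_le_sqrt
    refine (h.sq_sub_le a u hu.1).trans ?_
    exact mul_le_mul (by linarith [hu.2]) (measureReal_mono (Ioc_subset_Ioc_right hu.2))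
      measureReal_nonneg (by linarith)
  have hd : ∀ u ∈ Icc a t, HasDerivWithinAt (fun x => m x - p a * x) (p u - p a) (Icc a t) u := by
    intro u _
    have := ((h.hasDerivAt u).sub ((hasDerivAt_id u).const_mul (p a))).hasDerivWithinAt (s := Icc a t)
    rw [mul_one] at this
    exact this
  have h1 := (convex_Icc a t).norm_image_sub_le_of_norm_hasDerivWithin_le hd hb
    (left_mem_Icc.2 hat) (right_mem_Icc.2 hat)
  have h2 : m t - (m a + p a * (t - a)) = (m t - p a * t) - (m a - p a * a) := by ring
  rw [h2, ← sq_abs]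
  have h3 : |m t - p a * t - (m a - p a * a)| ≤ C * (t - a) := by
    have := h1
    simp only [Real.norm_eq_abs] at this
    rwa [abs_of_nonneg (show 0 ≤ t - a by linarith)] at this
  calc _ ≤ (C * (t - a)) ^ 2 := by gcongr
    _ = C ^ 2 * (t - a) ^ 2 := by ring
    _ = _ := by rw [hC, Real.sq_sqrt hC0]; ring

/-- Simultaneous piecewise linear approximation at the points of an arbitrary design. The pieces
come from the common refinement of `N` intervals of equal length and `N` blocks of equally many
design points, so that no assumption on the spacing of the design is needed. -/
theorem exists_piecewise_linear_approx {n : ℕ} (t : Fin n → ℝ) {A l : ℝ} (hl : 0 < l)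
    (ht : ∀ i, t i ∈ Icc A (A + l)) {N : ℕ} (hN : 1 ≤ N) :
    ∃ W : Submodule ℝ (EuclideanSpace ℝ (Fin n)), Module.finrank ℝ W ≤ 4 * N ∧
      ∀ (m p : ℝ → ℝ) (ν : Measure ℝ), IsEnergyLink m p ν →
        ∃ w ∈ W, ‖WithLp.toLp 2 (fun i => m (t i)) - w‖ ^ 2
            ≤ 2 * n * l ^ 3 / N ^ 4 * ν.real univ ∧
          (n ≤ N → WithLp.toLp 2 (fun i => m (t i)) = w) := by
  -- with at least as many pieces as design points the whole space is affordable
  by_cases hnN : n ≤ N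
  · refine ⟨⊤, ?_, fun m p ν h => ⟨_, Submodule.mem_top, ?_, fun _ => rfl⟩⟩
    · rw [finrank_top, finrank_euclideanSpace, Fintype.card_fin]; omega
    · have : 0 ≤ ν.real univ := measureReal_nonneg
      have : 0 ≤ 2 * n * l ^ 3 / N ^ 4 * ν.real univ := by positivity
      simpa using this
  push Not at hnN
  have hn : 0 < n := by omega
  have hNr : (0 : ℝ) < N := by exact_mod_cast hN
  have hnr : (0 : ℝ) < n := by exact_mod_cast hn
  set σ := Tuple.sort t with hσ
  have hmono : Monotone (t ∘ σ) := Tuple.monotone_sort t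
  -- `r i` is the rank of the `i`-th design point, `P i` the interval that contains it and `Q i` the
  -- block of ranks to which it belongs
  set r : Fin n → ℕ := fun i => (σ.symm i : ℕ) with hr
  have hrlt : ∀ i, r i < n := fun i => (σ.symm i).2
  have hrt : ∀ i j, r i ≤ r j → t i ≤ t j := by
    intro i j hij
    have : (t ∘ σ) (σ.symm i) ≤ (t ∘ σ) (σ.symm j) := hmono (Fin.le_def.2 hij)
    simpa using this
  have hrinj : Function.Injective r := fun i j hij => σ.symm.injective (Fin.ext hij)
  set P : Fin n → ℕ := fun i => ⌊(t i - A) * N / l⌋₊ with hP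
  set Q : Fin n → ℕ := fun i => r i * N / n with hQ
  have hPm : ∀ i j, r i ≤ r j → P i ≤ P j := by
    intro i j hij
    apply Nat.floor_mono
    have := hrt i j hij
    gcongr
  have hQm : ∀ i j, r i ≤ r j → Q i ≤ Q j := by
    intro i j hij
    exact Nat.div_le_div_right (Nat.mul_le_mul_right _ hij)
  -- `P` and `Q` both increase with the rank, so that their sum determines both of them: the labels
  -- number the cells of the common refinement
  set lab : Fin n → ℕ := fun i => P i + Q i with hlab
  have hlablt : ∀ i, lab i < 2 * N := by
    intro i
    have h1 : P i ≤ N := by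
      apply Nat.floor_le_of_le
      rw [div_le_iff₀ hl]
      nlinarith [(ht i).2]
    have h2 : Q i < N := by
      rw [hQ]
      rw [Nat.div_lt_iff_lt_mul hn, mul_comm]
      exact Nat.mul_lt_mul_of_pos_left (hrlt i) (by omega)
    simp only [hlab]; omega
  have hlabeq : ∀ i j, lab i = lab j → P i = P j ∧ Q i = Q j := by
    intro i j hij
    simp only [hlab] at hij
    rcases le_total (r i) (r j) with h | h
    · have := hPm _ _ h; have := hQm _ _ h; omega
    · have := hPm _ _ h; have := hQm _ _ h; omega
  have hlablt' : ∀ i j, lab i < lab j → t i ≤ t j := by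
    intro i j hij
    apply hrt
    by_contra hcon
    push Not at hcon
    have := hPm _ _ hcon.le; have := hQm _ _ hcon.le
    simp only [hlab] at hij; omega
  -- a cell has length at most `l / N`, and it has at most `2 n / N` points
  have hdist : ∀ i j, lab i = lab j → t i - t j ≤ l / N := by
    intro i j hij
    have h1 := (hlabeq i j hij).1
    have h2 : (t i - A) * N / l < P i + 1 := Nat.lt_floor_add_one _
    have h3 : (P j : ℝ) ≤ (t j - A) * N / l :=
      Nat.floor_le (div_nonneg (mul_nonneg (by linarith [(ht j).1]) hNr.le) hl.le)
    rw [h1] at h2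
    have h4 : (t i - A) * N / l - (t j - A) * N / l ≤ 1 := by linarith
    rw [le_div_iff₀ hNr]
    rw [← sub_div, div_le_iff₀ hl] at h4
    linarith
  have hcard : ∀ c, ((Finset.univ.filter fun i => lab i = c).card : ℝ) ≤ 2 * n / N := by
    intro c
    rcases (Finset.univ.filter fun i => lab i = c).eq_empty_or_nonempty with he | hne
    · rw [he]; simp; positivity
    obtain ⟨i0, hi0, hmin⟩ := Finset.exists_min_image _ r hne
    have hi0c : lab i0 = c := (Finset.mem_filter.1 hi0).2
    have h1 : (Finset.univ.filter fun i => lab i = c).card ≤ n / N + 1 := by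
      rw [← Finset.card_range (n / N + 1)]
      refine Finset.card_le_card_of_injOn (fun i => r i - r i0) ?_ ?_
      · intro i hi
        have hi' := (Finset.mem_filter.1 hi).2
        have hQe : Q i = Q i0 := (hlabeq i i0 (hi'.trans hi0c.symm)).2
        simp only [Finset.coe_range, mem_Iio]
        rw [Nat.lt_add_one_iff, Nat.le_div_iff_mul_le (by omega)]
        have h2 : r i * N < (Q i + 1) * n := by
          rw [mul_comm (Q i + 1)]; exact Nat.lt_mul_div_succ _ hn
        have h3 : Q i0 * n ≤ r i0 * N := Nat.div_mul_le_self _ _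
        rw [hQe] at h2
        rw [Nat.sub_mul]
        have : (Q i0 + 1) * n = Q i0 * n + n := by ring
        omega
      · intro i hi j hj hij
        have h2 := hmin i hi
        have h3 := hmin j hj
        simp only at hij
        exact hrinj (by omega)
    have h2 : ((n / N : ℕ) : ℝ) ≤ n / N := Nat.cast_div_le
    have h3 : (1 : ℝ) ≤ n / N := by
      rw [le_div_iff₀ hNr, one_mul]; exact_mod_cast hnN.le
    calc ((Finset.univ.filter fun i => lab i = c).card : ℝ) ≤ ((n / N + 1 : ℕ) : ℝ) := by
          exact_mod_cast h1
      _ ≤ n / N + n / N := by push_cast; linarith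
      _ = 2 * n / N := by ring
  have hends : ∀ c, ∃ a b : ℝ, (∀ i, lab i = c → t i ∈ Icc a b) ∧
      ((∃ i j, lab i = c ∧ lab j = c ∧ a = t i ∧ b = t j) ∨ b ≤ a) := by
    intro c
    rcases (Finset.univ.filter fun i => lab i = c).eq_empty_or_nonempty with he | hne
    · refine ⟨0, 0, fun i hi => ?_, Or.inr le_rfl⟩
      have : i ∈ Finset.univ.filter fun i => lab i = c := by simp [hi]
      rw [he] at this; simp at this
    · obtain ⟨i, hi, hmin⟩ := Finset.exists_min_image _ t hne
      obtain ⟨j, hj, hmax⟩ := Finset.exists_max_image _ t hne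
      exact ⟨t i, t j, fun k hk => ⟨hmin k (by simp [hk]), hmax k (by simp [hk])⟩,
        Or.inl ⟨i, j, (Finset.mem_filter.1 hi).2, (Finset.mem_filter.1 hj).2, rfl, rfl⟩⟩
  choose a b hab hab' using hends
  -- constants and the identity on each cell span the approximating space
  set B : Fin (2 * N) × Fin 2 → EuclideanSpace ℝ (Fin n) := fun z =>
    WithLp.toLp 2 (fun i => if lab i = (z.1 : ℕ) then (if z.2 = 0 then 1 else t i) else 0) with hB
  refine ⟨Submodule.span ℝ (Set.range B), ?_, ?_⟩
  · have := finrank_range_le_card (R := ℝ) B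
    simp only [Fintype.card_prod, Fintype.card_fin] at this
    unfold Set.finrank at this
    omega
  intro m p ν h
  have := h.finite
  -- on each cell the link is replaced by its tangent at the leftmost design point of the cell
  refine ⟨WithLp.toLp 2 (fun i => m (a (lab i)) + p (a (lab i)) * (t i - a (lab i))), ?_, ?_,
    fun h => absurd h (by omega)⟩
  · have : WithLp.toLp 2 (fun i => m (a (lab i)) + p (a (lab i)) * (t i - a (lab i)))
        = ∑ c : Fin (2 * N), ((m (a c) - p (a c) * a c) • B (c, 0) + p (a c) • B (c, 1)) := by
      ext i
      simp only [hB, WithLp.ofLp_sum, WithLp.ofLp_add, WithLp.ofLp_smul, Finset.sum_apply,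
        Pi.add_apply, Pi.smul_apply, smul_eq_mul]
      rw [Finset.sum_eq_single (⟨lab i, hlablt i⟩ : Fin (2 * N))]
      · simp; ring
      · intro c _ hc
        have : lab i ≠ c := fun h => hc (Fin.ext h.symm)
        simp [this]
      · simp
    rw [this]
    refine Submodule.sum_mem _ fun c _ => Submodule.add_mem _ ?_ ?_ <;>
      exact Submodule.smul_mem _ _ (Submodule.subset_span ⟨_, rfl⟩)
  · rw [EuclideanSpace.norm_sq_eq]
    have h1 : ∀ i, (m (t i) - (m (a (lab i)) + p (a (lab i)) * (t i - a (lab i)))) ^ 2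
        ≤ (l / N) ^ 3 * ν.real (Ioc (a (lab i)) (b (lab i))) := by
      intro i
      have hi := hab (lab i) i rfl
      refine (h.abs_sub_tangent_le hi.1).trans ?_
      have h2 : t i - a (lab i) ≤ l / N := by
        rcases hab' (lab i) with ⟨j, _, hj, _, haj, _⟩ | hle
        · rw [haj]; exact hdist i j hj.symm
        · have := hi.1; have := hi.2
          have : 0 ≤ l / N := by positivity
          linarith
      have h3 : 0 ≤ t i - a (lab i) := by linarith [hi.1]
      refine mul_le_mul (pow_le_pow_left₀ h3 h2 3) (measureReal_mono (Ioc_subset_Ioc_right hi.2))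
        measureReal_nonneg (by positivity)
    -- the cells are disjoint, so that their energies add up to at most the total energy
    have hdisj : ((Finset.range (2 * N) : Finset ℕ) : Set ℕ).PairwiseDisjoint
        (fun c => Ioc (a c) (b c)) := by
      have key : ∀ c c', c < c' → Disjoint (Ioc (a c) (b c)) (Ioc (a c') (b c')) := by
        intro c c' hcc
        rw [Set.disjoint_left]
        rintro u ⟨hu1, hu2⟩ ⟨hu3, hu4⟩
        rcases hab' c with ⟨i, j, hi, hj, hai, hbj⟩ | hle
        · rcases hab' c' with ⟨i', j', hi', hj', hai', hbj'⟩ | hle'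
          · have := hlablt' j i' (by omega)
            linarith
          · linarith
        · linarith
      intro c _ c' _ hne
      rcases lt_or_gt_of_ne hne with h | h
      · exact key c c' h
      · exact (key c' c h).symm
    have hsum : ∑ c ∈ Finset.range (2 * N), ν.real (Ioc (a c) (b c)) ≤ ν.real univ := by
      rw [← measureReal_biUnion_finset hdisj (fun c _ => measurableSet_Ioc)]
      exact measureReal_mono (subset_univ _)
    calc ∑ i, ‖(WithLp.toLp 2 (fun i => m (t i)) - WithLp.toLp 2 (fun i => m (a (lab i))
            + p (a (lab i)) * (t i - a (lab i))) : EuclideanSpace ℝ (Fin n)) i‖ ^ 2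
        ≤ ∑ i, (l / N) ^ 3 * ν.real (Ioc (a (lab i)) (b (lab i))) := by
          refine Finset.sum_le_sum fun i _ => ?_
          simpa using h1 i
      _ = ∑ c ∈ Finset.range (2 * N), ∑ i ∈ Finset.univ.filter (fun i => lab i = c),
            (l / N) ^ 3 * ν.real (Ioc (a (lab i)) (b (lab i))) :=
          (Finset.sum_fiberwise_of_maps_to (fun i _ => Finset.mem_range.2 (hlablt i)) _).symm
      _ = ∑ c ∈ Finset.range (2 * N), ((Finset.univ.filter fun i => lab i = c).card : ℝ) *
            ((l / N) ^ 3 * ν.real (Ioc (a c) (b c))) := by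
          refine Finset.sum_congr rfl fun c _ => ?_
          rw [Finset.sum_congr rfl (g := fun _ => (l / N) ^ 3 * ν.real (Ioc (a c) (b c)))
            (fun i hi => by rw [(Finset.mem_filter.1 hi).2]), Finset.sum_const, nsmul_eq_mul]
      _ ≤ ∑ c ∈ Finset.range (2 * N), (2 * n / N) * ((l / N) ^ 3 * ν.real (Ioc (a c) (b c))) := by
          refine Finset.sum_le_sum fun c _ => ?_
          exact mul_le_mul_of_nonneg_right (hcard c) (mul_nonneg (by positivity) measureReal_nonneg)
      _ = 2 * n * l ^ 3 / N ^ 4 * ∑ c ∈ Finset.range (2 * N), ν.real (Ioc (a c) (b c)) := by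
          rw [Finset.mul_sum]
          refine Finset.sum_congr rfl fun c _ => ?_
          field_simp
      _ ≤ _ := by gcongr

/-- A chain of spaces of piecewise linear functions on finer and finer pieces turns bounds for the
noise on each space into a bound for the noise on all links of finite energy. The fixed vector `f`
only enters the coarsest space. -/
theorem chaining_bound {n : ℕ} (t : Fin n → ℝ) {l : ℝ} (hl : 0 < l) {N K : ℕ} (hN : 1 ≤ N)
    (hK : n ≤ 2 ^ K * N) (W : ℕ → Submodule ℝ (EuclideanSpace ℝ (Fin n)))
    (hW : ∀ k, ∀ (m p : ℝ → ℝ) (ν : Measure ℝ), IsEnergyLink m p ν →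
        ∃ w ∈ W k, ‖WithLp.toLp 2 (fun i => m (t i)) - w‖ ^ 2
            ≤ 2 * n * l ^ 3 / ((2 ^ k * N : ℕ) : ℝ) ^ 4 * ν.real univ ∧
          (n ≤ 2 ^ k * N → WithLp.toLp 2 (fun i => m (t i)) = w))
    (f ξ : EuclideanSpace ℝ (Fin n)) {B : ℝ} (hB : 0 ≤ B)
    (h0 : ∀ v ∈ W 0 ⊔ Submodule.span ℝ {f}, |inner ℝ ξ v| ≤ B * Real.sqrt N * ‖v‖)
    (h1 : ∀ k < K, ∀ v ∈ W k ⊔ W (k + 1),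
      |inner ℝ ξ v| ≤ B * Real.sqrt ((2 ^ k * N : ℕ) : ℝ) * ‖v‖)
    {m p : ℝ → ℝ} {ν : Measure ℝ} (hm : IsEnergyLink m p ν) :
    |inner ℝ ξ (WithLp.toLp 2 (fun i => m (t i)) - f)|
      ≤ B * Real.sqrt N * ‖WithLp.toLp 2 (fun i => m (t i)) - f‖
        + 5 * B * Real.sqrt (2 * n * l ^ 3 * ν.real univ) * (Real.sqrt N / N ^ 2) := by
  set g : EuclideanSpace ℝ (Fin n) := WithLp.toLp 2 (fun i => m (t i)) with hg
  have hN0 : (0 : ℝ) < N := by exact_mod_cast hN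
  choose w hwW hwe hwK using fun k => hW k m p ν hm
  set S := Real.sqrt (2 * n * l ^ 3 * ν.real univ) with hS
  have hS0 : 0 ≤ S := Real.sqrt_nonneg _
  have hSsq : S ^ 2 = 2 * n * l ^ 3 * ν.real univ :=
    Real.sq_sqrt (mul_nonneg (by positivity) measureReal_nonneg)
  have he : ∀ k, ‖g - w k‖ ≤ S / ((2 ^ k * N : ℕ) : ℝ) ^ 2 := by
    intro k
    refine (sq_le_sq₀ (norm_nonneg _) (by positivity)).1 ?_
    refine (hwe k).trans (le_of_eq ?_)
    rw [div_pow, hSsq]; ring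
  have hgK : g = w K := hwK K hK
  -- the telescoping sum stops at level `K`, where the approximation is exact
  have hdec : g - f = (w 0 - f) + ∑ k ∈ Finset.range K, (w (k + 1) - w k) := by
    rw [Finset.sum_range_sub, hgK]; abel
  -- refining by a factor `2` divides the approximation error by `4` while the noise at most doubles,
  -- so that the contributions of the levels form a geometric series
  have hstep : ∀ k < K, |inner ℝ ξ (w (k + 1) - w k)|
      ≤ 2 * (B * S * (Real.sqrt N / N ^ 2)) * (1 / 2) ^ k := by
    intro k hk
    refine (h1 k hk _ (Submodule.sub_mem _ (Submodule.mem_sup_right (hwW _))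
      (Submodule.mem_sup_left (hwW _)))).trans ?_
    have h2 : ‖w (k + 1) - w k‖ ≤ 2 * (S / ((2 ^ k * N : ℕ) : ℝ) ^ 2) := by
      have h3 : w (k + 1) - w k = (g - w k) - (g - w (k + 1)) := by abel
      rw [h3]
      refine (norm_sub_le _ _).trans ?_
      have h4 : S / ((2 ^ (k + 1) * N : ℕ) : ℝ) ^ 2 ≤ S / ((2 ^ k * N : ℕ) : ℝ) ^ 2 := by
        apply div_le_div_of_nonneg_left hS0 (by positivity)
        have : (2 ^ k * N : ℕ) ≤ 2 ^ (k + 1) * N :=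
          Nat.mul_le_mul_right _ (Nat.pow_le_pow_right (by norm_num) (by omega))
        have : ((2 ^ k * N : ℕ) : ℝ) ≤ ((2 ^ (k + 1) * N : ℕ) : ℝ) := by exact_mod_cast this
        gcongr
      linarith [he k, he (k + 1)]
    have h5 : Real.sqrt ((2 ^ k * N : ℕ) : ℝ) ≤ 2 ^ k * Real.sqrt N := by
      rw [Nat.cast_mul, Real.sqrt_mul (by positivity)]
      gcongr
      push_cast
      rw [Real.sqrt_le_left (by positivity)]
      have : (1 : ℝ) ≤ 2 ^ k := one_le_pow₀ (by norm_num)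
      nlinarith
    calc B * Real.sqrt ((2 ^ k * N : ℕ) : ℝ) * ‖w (k + 1) - w k‖
        ≤ B * (2 ^ k * Real.sqrt N) * (2 * (S / ((2 ^ k * N : ℕ) : ℝ) ^ 2)) := by gcongr
      _ = 2 * (B * S * (Real.sqrt N / N ^ 2)) * (1 / 2) ^ k := by
          push_cast
          field_simp
          ring_nf
          try rw [mul_assoc, ← mul_pow]; norm_num
  have hgeo : ∑ k ∈ Finset.range K, ((1 : ℝ) / 2) ^ k ≤ 2 := sum_geometric_two_le K
  have hX : 0 ≤ B * S * (Real.sqrt N / N ^ 2) := by positivity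
  have hsum : |inner ℝ ξ (∑ k ∈ Finset.range K, (w (k + 1) - w k))|
      ≤ 4 * (B * S * (Real.sqrt N / N ^ 2)) := by
    rw [inner_sum]
    refine (Finset.abs_sum_le_sum_abs _ _).trans ?_
    refine (Finset.sum_le_sum fun k hk => hstep k (Finset.mem_range.1 hk)).trans ?_
    rw [← Finset.mul_sum]
    nlinarith
  have hfirst : |inner ℝ ξ (w 0 - f)|
      ≤ B * Real.sqrt N * ‖g - f‖ + B * S * (Real.sqrt N / N ^ 2) := by
    refine (h0 _ (Submodule.sub_mem _ (Submodule.mem_sup_left (hwW _))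
      (Submodule.mem_sup_right (Submodule.mem_span_singleton_self f)))).trans ?_
    have h2 : ‖w 0 - f‖ ≤ ‖g - f‖ + S / N ^ 2 := by
      have h3 : w 0 - f = (g - f) - (g - w 0) := by abel
      rw [h3]
      refine (norm_sub_le _ _).trans ?_
      have := he 0
      simp only [pow_zero, one_mul] at this
      linarith
    calc _ ≤ B * Real.sqrt N * (‖g - f‖ + S / N ^ 2) := by gcongr
      _ = _ := by ring
  rw [hdec, inner_add_right]
  rw [← hdec]
  refine (abs_add_le _ _).trans ?_
  linarith

end ConvexSIM

/-! ### Sub-Gaussian laws and vectors -/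

namespace ConvexSIM

theorem exp_le_add_exp_sq (y : ℝ) : Real.exp y ≤ y + Real.exp (y ^ 2) := by
  have h1 : 1 + y ^ 2 ≤ Real.exp (y ^ 2) := by linarith [Real.add_one_le_exp (y ^ 2)]
  rcases le_or_gt |y| 1 with h | h
  · have := (abs_le.1 (Real.abs_exp_sub_one_sub_id_le h)).2
    linarith
  · rcases lt_abs.1 h with h | h
    · have : Real.exp y ≤ Real.exp (y ^ 2) := Real.exp_le_exp.2 (by nlinarith)
      linarith
    · have : Real.exp y ≤ 1 := Real.exp_le_one_iff.2 (by linarith)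
      nlinarith

/-- Convexity of the exponential function, on the segment from `0` to `u`. -/
theorem exp_mul_le_of_mem_Icc {θ u : ℝ} (h0 : 0 ≤ θ) (h1 : θ ≤ 1) :
    Real.exp (θ * u) ≤ 1 + θ * (Real.exp u - 1) := by
  have := convexOn_exp.2 (mem_univ 0) (mem_univ u) (sub_nonneg.2 h1) h0 (by ring)
  simp only [smul_eq_mul, mul_zero, zero_add, Real.exp_zero, mul_one] at this
  linarith

/-- A centred law whose square has an exponential moment is sub-Gaussian. -/
theorem lintegral_exp_mul_le (κ : Measure ℝ) [IsProbabilityMeasure κ] {K : ℝ} (hK : 0 < K)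
    (hint : Integrable (fun x => Real.exp (x ^ 2 / K)) κ)
    (hle : K * ((∫ x, Real.exp (x ^ 2 / K) ∂κ) - 1) ≤ 1) (h0 : ∫ x, x ∂κ = 0) (c : ℝ) :
    ∫⁻ x, ENNReal.ofReal (Real.exp (c * x)) ∂κ ≤ ENNReal.ofReal (Real.exp ((K + 1) * c ^ 2)) := by
  set E := ∫ x, Real.exp (x ^ 2 / K) ∂κ with hE
  have hle' : E - 1 ≤ 1 / K := by rw [le_div_iff₀ hK]; linarith
  have hid : Integrable (fun x : ℝ => x) κ := by
    refine Integrable.mono' (hint.const_mul (1 + K)) aestronglyMeasurable_id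
      (Eventually.of_forall fun x => ?_)
    have h1 := Real.add_one_le_exp (x ^ 2 / K)
    have h2 : x ^ 2 ≤ K * Real.exp (x ^ 2 / K) := by
      have : x ^ 2 / K ≤ Real.exp (x ^ 2 / K) := by linarith
      rwa [div_le_iff₀' hK] at this
    have h3 : 1 ≤ Real.exp (x ^ 2 / K) := Real.one_le_exp (by positivity)
    rw [Real.norm_eq_abs]
    nlinarith [sq_abs x, sq_nonneg (|x| - 1)]
  -- by convexity, smaller multiples of the square have exponential moments close to one
  have hmom : ∀ θ : ℝ, 0 ≤ θ → θ ≤ 1 →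
      Integrable (fun x => Real.exp (θ * (x ^ 2 / K))) κ ∧
        ∫ x, Real.exp (θ * (x ^ 2 / K)) ∂κ ≤ 1 + θ / K := by
    intro θ h0 h1
    have hb : Integrable (fun x => 1 + θ * (Real.exp (x ^ 2 / K) - 1)) κ :=
      (integrable_const 1).add ((hint.sub (integrable_const 1)).const_mul θ)
    have hi : Integrable (fun x => Real.exp (θ * (x ^ 2 / K))) κ := by
      refine Integrable.mono' hb (by fun_prop) (Eventually.of_forall fun x => ?_)
      rw [Real.norm_eq_abs, abs_of_pos (Real.exp_pos _)]
      exact exp_mul_le_of_mem_Icc h0 h1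
    refine ⟨hi, ?_⟩
    refine (integral_mono hi hb fun x => exp_mul_le_of_mem_Icc h0 h1).trans ?_
    have hs : Integrable (fun x => Real.exp (x ^ 2 / K) - 1) κ := hint.sub (integrable_const 1)
    rw [integral_add (integrable_const 1) (hs.const_mul θ),
      integral_const_mul, integral_sub hint (integrable_const 1)]
    simp only [integral_const, probReal_univ, smul_eq_mul, mul_one]
    have := mul_le_mul_of_nonneg_left hle' h0
    rw [mul_one_div] at this
    linarith
  -- For small `c` the linear term of `exp y ≤ y + exp (y²)` integrates to zero; for large `c` the
  -- inequality `c x ≤ c² K / 2 + x² / (2 K)` is good enough.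
  rcases le_or_gt (c ^ 2 * K) 1 with hcK | hcK
  · obtain ⟨hi, hm⟩ := hmom (c ^ 2 * K) (by positivity) hcK
    have hb : Integrable (fun x => c * x + Real.exp (c ^ 2 * K * (x ^ 2 / K))) κ :=
      (hid.const_mul c).add hi
    calc ∫⁻ x, ENNReal.ofReal (Real.exp (c * x)) ∂κ
        ≤ ∫⁻ x, ENNReal.ofReal (c * x + Real.exp (c ^ 2 * K * (x ^ 2 / K))) ∂κ := by
          refine lintegral_mono fun x => ENNReal.ofReal_le_ofReal ?_
          have := exp_le_add_exp_sq (c * x)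
          have h2 : c ^ 2 * K * (x ^ 2 / K) = (c * x) ^ 2 := by field_simp
          rwa [h2]
      _ = ENNReal.ofReal (∫ x, c * x + Real.exp (c ^ 2 * K * (x ^ 2 / K)) ∂κ) := by
          rw [ofReal_integral_eq_lintegral_ofReal hb]
          refine Eventually.of_forall fun x => ?_
          have := exp_le_add_exp_sq (c * x)
          have h2 : c ^ 2 * K * (x ^ 2 / K) = (c * x) ^ 2 := by field_simp
          have := Real.exp_pos (c * x)
          simp only [Pi.zero_apply, h2]
          linarith
      _ ≤ _ := by
          refine ENNReal.ofReal_le_ofReal ?_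
          rw [integral_add (hid.const_mul c) hi, integral_const_mul, h0, mul_zero, zero_add]
          refine hm.trans ?_
          rw [mul_div_assoc, div_self hK.ne', mul_one]
          have h3 := Real.add_one_le_exp (c ^ 2)
          have h4 : Real.exp (c ^ 2) ≤ Real.exp ((K + 1) * c ^ 2) :=
            Real.exp_le_exp.2 (by nlinarith [sq_nonneg c])
          linarith
  · obtain ⟨hi, hm⟩ := hmom (1 / 2) (by norm_num) (by norm_num)
    have hpt : ∀ x, Real.exp (c * x)
        ≤ Real.exp (c ^ 2 * K / 2) * Real.exp (1 / 2 * (x ^ 2 / K)) := by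
      intro x
      rw [← Real.exp_add, Real.exp_le_exp]
      have : 0 ≤ (c * K - x) ^ 2 / (2 * K) := by positivity
      have h2 : (c * K - x) ^ 2 / (2 * K) = c ^ 2 * K / 2 + 1 / 2 * (x ^ 2 / K) - c * x := by
        field_simp; ring
      linarith
    calc ∫⁻ x, ENNReal.ofReal (Real.exp (c * x)) ∂κ
        ≤ ∫⁻ x, ENNReal.ofReal (Real.exp (c ^ 2 * K / 2) * Real.exp (1 / 2 * (x ^ 2 / K))) ∂κ :=
          lintegral_mono fun x => ENNReal.ofReal_le_ofReal (hpt x)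
      _ = ENNReal.ofReal (∫ x, Real.exp (c ^ 2 * K / 2) * Real.exp (1 / 2 * (x ^ 2 / K)) ∂κ) := by
          rw [ofReal_integral_eq_lintegral_ofReal (hi.const_mul _)]
          exact Eventually.of_forall fun x => by positivity
      _ ≤ _ := by
          refine ENNReal.ofReal_le_ofReal ?_
          rw [integral_const_mul]
          have h3 := Real.add_one_le_exp (1 / 2 / K)
          have h4 : 1 / 2 / K ≤ c ^ 2 / 2 := by
            rw [div_le_iff₀ hK]; linarith
          calc _ ≤ Real.exp (c ^ 2 * K / 2) * Real.exp (1 / 2 / K) := by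
                gcongr; linarith
            _ = Real.exp (c ^ 2 * K / 2 + 1 / 2 / K) := (Real.exp_add _ _).symm
            _ ≤ _ := by
                rw [Real.exp_le_exp]
                nlinarith [mul_nonneg (sq_nonneg c) hK.le]

/-- A law on `ℝⁿ` with the moment generating function bound of a centred Gaussian law with
covariance matrix `2 σ I`. -/
def IsSubGaussianVec {n : ℕ} (σ : ℝ) (κ : Measure (EuclideanSpace ℝ (Fin n))) : Prop :=
  ∀ c : EuclideanSpace ℝ (Fin n),
    ∫⁻ ξ, ENNReal.ofReal (Real.exp (inner ℝ ξ c)) ∂κ ≤ ENNReal.ofReal (Real.exp (σ * ‖c‖ ^ 2))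

/-- An exponential moment of the square of a standard Gaussian variable, finite because `1/4 < 1/2`.
-/
theorem gaussian_sq_moment :
    Integrable (fun x : ℝ => Real.exp (x ^ 2 / 4)) (gaussianReal 0 1) ∧
      ∫ x, Real.exp (x ^ 2 / 4) ∂(gaussianReal 0 1) = Real.sqrt 2 := by
  have hpdf : ∀ x : ℝ, gaussianPDFReal 0 1 x • Real.exp (x ^ 2 / 4)
      = (Real.sqrt (2 * Real.pi))⁻¹ * Real.exp (-(1 / 4) * x ^ 2) := by
    intro x
    simp only [gaussianPDFReal, smul_eq_mul, NNReal.coe_one, mul_one, sub_zero]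
    rw [mul_assoc, ← Real.exp_add]
    congr 2; ring
  have h : ∫ x, Real.exp (x ^ 2 / 4) ∂(gaussianReal 0 1) = Real.sqrt 2 := by
    rw [integral_gaussianReal_eq_integral_smul one_ne_zero]
    simp_rw [hpdf]
    rw [integral_const_mul, integral_gaussian, ← Real.sqrt_inv, ← Real.sqrt_mul (by positivity)]
    congr 1
    field_simp
    norm_num
  refine ⟨?_, h⟩
  by_contra hcon
  rw [integral_undef hcon] at h
  have : (0 : ℝ) < Real.sqrt 2 := by positivity
  linarith

theorem lintegral_pi_prod_ofReal {k : ℕ} (f : Fin k → ℝ → ℝ) (γ : Measure ℝ)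
    [IsProbabilityMeasure γ] (hf0 : ∀ j x, 0 ≤ f j x) (hf : ∀ j, Integrable (f j) γ) :
    ∫⁻ g : Fin k → ℝ, ENNReal.ofReal (∏ j, f j (g j)) ∂(Measure.pi fun _ => γ)
      = ENNReal.ofReal (∏ j, ∫ x, f j x ∂γ) := by
  rw [← integral_fintype_prod_eq_prod (μ := fun _ : Fin k => γ),
    ofReal_integral_eq_lintegral_ofReal (Integrable.fintype_prod hf)]
  exact Eventually.of_forall fun g => Finset.prod_nonneg fun j _ => hf0 j _

/-- The projection of a sub-Gaussian vector to a space of dimension `p` has squared length of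
order at most `p`, up to exponentially small probability. The square is linearized by integrating
against an independent Gaussian vector. -/
theorem IsSubGaussianVec.measure_subspace_le {n : ℕ} {σ : ℝ} (hσ : 0 < σ)
    {κ : Measure (EuclideanSpace ℝ (Fin n))} [IsProbabilityMeasure κ]
    (hκ : IsSubGaussianVec σ κ) (W : Submodule ℝ (EuclideanSpace ℝ (Fin n))) {p s : ℝ}
    (hp : (Module.finrank ℝ W : ℝ) ≤ p) (hs : 0 ≤ s) :
    κ {ξ | ∃ v ∈ W, Real.sqrt (8 * σ * (p + s)) * ‖v‖ < |inner ℝ ξ v|}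
      ≤ ENNReal.ofReal (Real.exp (-s)) := by
  set k := Module.finrank ℝ W with hk
  set b := stdOrthonormalBasis ℝ W with hb
  set u : Fin k → EuclideanSpace ℝ (Fin n) := fun j => (b j : EuclideanSpace ℝ (Fin n)) with hu
  have hort : Orthonormal ℝ u := b.orthonormal.comp_linearIsometry W.subtypeₗᵢ
  -- `Q ξ` is the squared length of the projection of `ξ` to the subspace; it dominates
  -- `⟪ξ, v⟫² / ‖v‖²` for all `v` in the subspace
  set Q : EuclideanSpace ℝ (Fin n) → ℝ := fun ξ => ∑ j, (inner ℝ ξ (u j)) ^ 2 with hQ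
  have hp0 : 0 ≤ p := le_trans (Nat.cast_nonneg _) hp
  have hsub : {ξ | ∃ v ∈ W, Real.sqrt (8 * σ * (p + s)) * ‖v‖ < |inner ℝ ξ v|}
      ⊆ {ξ | ENNReal.ofReal (Real.exp (p + s))
          ≤ ENNReal.ofReal (Real.exp (1 / (8 * σ) * Q ξ))} := by
    rintro ξ ⟨v, hv, hlt⟩
    refine ENNReal.ofReal_le_ofReal (Real.exp_le_exp.2 ?_)
    have h1 : v = ∑ j, (inner ℝ (u j) v) • u j := by
      have := b.sum_repr ⟨v, hv⟩
      have h2 := congrArg (fun z : W => (z : EuclideanSpace ℝ (Fin n))) this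
      simp only [Submodule.coe_sum, Submodule.coe_smul] at h2
      rw [← h2]
      refine Finset.sum_congr rfl fun j _ => ?_
      rw [h2]
      rw [b.repr_apply_apply]; rfl
    have h3 : inner ℝ ξ v = ∑ j, inner ℝ (u j) v * inner ℝ ξ (u j) := by
      conv_lhs => rw [h1]
      rw [inner_sum]
      simp only [inner_smul_right]
    have h4 : ∑ j, (inner ℝ (u j) v) ^ 2 ≤ ‖v‖ ^ 2 := by
      have := hort.sum_inner_products_le (x := v) (s := Finset.univ)
      simpa using this
    have h5 : (inner ℝ ξ v) ^ 2 ≤ ‖v‖ ^ 2 * Q ξ := by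
      rw [h3]
      refine (Finset.sum_mul_sq_le_sq_mul_sq _ _ _).trans ?_
      exact mul_le_mul_of_nonneg_right h4 (Finset.sum_nonneg fun j _ => sq_nonneg _)
    have h6 : 8 * σ * (p + s) * ‖v‖ ^ 2 < (inner ℝ ξ v) ^ 2 := by
      have := pow_lt_pow_left₀ hlt (by positivity) (two_ne_zero)
      rwa [mul_pow, Real.sq_sqrt (by positivity), sq_abs] at this
    have hv0 : 0 < ‖v‖ ^ 2 := by
      rcases eq_or_ne v 0 with rfl | hv0
      · simp at hlt
      · positivity
    have h7 : 8 * σ * (p + s) < Q ξ := by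
      by_contra hcon
      push Not at hcon
      nlinarith
    rw [one_div, inv_mul_eq_div, le_div_iff₀ (by positivity)]
    linarith
  set γ := gaussianReal 0 1 with hγ
  set a := Real.sqrt (1 / (4 * σ)) with ha
  have ha2 : a ^ 2 = 1 / (4 * σ) := Real.sq_sqrt (by positivity)
  -- `exp (Q ξ / (8 σ))` is the mean of `exp ⟪ξ, G⟫` over a Gaussian vector `G` in the subspace
  have hlin : ∀ ξ, ENNReal.ofReal (Real.exp (1 / (8 * σ) * Q ξ))
      = ∫⁻ g : Fin k → ℝ, ENNReal.ofReal (Real.exp (inner ℝ ξ (∑ j, (a * g j) • u j)))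
          ∂(Measure.pi fun _ => γ) := by
    intro ξ
    have h1 : ∀ g : Fin k → ℝ, Real.exp (inner ℝ ξ (∑ j, (a * g j) • u j))
        = ∏ j, Real.exp (a * inner ℝ ξ (u j) * g j) := by
      intro g
      rw [← Real.exp_sum, inner_sum]
      congr 1
      refine Finset.sum_congr rfl fun j _ => ?_
      rw [inner_smul_right]; ring
    simp_rw [h1]
    rw [lintegral_pi_prod_ofReal (fun j x => Real.exp (a * inner ℝ ξ (u j) * x)) γ
      (fun j x => (Real.exp_pos _).le) (fun j => integrable_exp_mul_gaussianReal _)]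
    congr 1
    have h2 : ∀ j, ∫ x, Real.exp (a * inner ℝ ξ (u j) * x) ∂γ
        = Real.exp (1 / (8 * σ) * (inner ℝ ξ (u j)) ^ 2) := by
      intro j
      have := congrFun (mgf_id_gaussianReal (μ := 0) (v := 1)) (a * inner ℝ ξ (u j))
      simp only [mgf, id] at this
      rw [this]
      congr 1
      simp only [zero_mul, zero_add, NNReal.coe_one, one_mul]
      rw [mul_pow, ha2]
      field_simp
      ring
    simp_rw [h2]
    rw [← Real.exp_sum, hQ, Finset.mul_sum]
  have hmgf : ∫⁻ ξ, ENNReal.ofReal (Real.exp (1 / (8 * σ) * Q ξ)) ∂κ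
      ≤ ENNReal.ofReal (Real.exp p) := by
    simp_rw [hlin]
    rw [lintegral_lintegral_swap]
    · calc ∫⁻ g : Fin k → ℝ, ∫⁻ ξ, ENNReal.ofReal (Real.exp (inner ℝ ξ (∑ j, (a * g j) • u j)))
            ∂κ ∂(Measure.pi fun _ => γ)
          ≤ ∫⁻ g : Fin k → ℝ, ENNReal.ofReal (∏ j, Real.exp (g j ^ 2 / 4))
            ∂(Measure.pi fun _ => γ) := by
            refine lintegral_mono fun g => (hκ _).trans (le_of_eq ?_)
            rw [← Real.exp_sum]
            congr 2
            rw [← real_inner_self_eq_norm_sq, hort.inner_sum, Finset.mul_sum]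
            refine Finset.sum_congr rfl fun j _ => ?_
            have h3 : σ * a ^ 2 = 1 / 4 := by rw [ha2]; field_simp
            simp only [conj_trivial]
            linear_combination g j ^ 2 * h3
        _ = ENNReal.ofReal (∏ j : Fin k, Real.sqrt 2) := by
            rw [lintegral_pi_prod_ofReal (fun _ x => Real.exp (x ^ 2 / 4)) γ
              (fun j x => (Real.exp_pos _).le) (fun j => gaussian_sq_moment.1)]
            simp only [hγ, gaussian_sq_moment.2]
        _ ≤ _ := by
            refine ENNReal.ofReal_le_ofReal ?_
            rw [Finset.prod_const, Finset.card_univ, Fintype.card_fin]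
            have h2 : Real.sqrt 2 ≤ Real.exp 1 := by
              have := Real.add_one_le_exp 1
              have h3 : Real.sqrt 2 ≤ 2 := by
                rw [Real.sqrt_le_left (by norm_num)]; norm_num
              linarith
            calc Real.sqrt 2 ^ k ≤ Real.exp 1 ^ k := by gcongr
              _ = Real.exp k := by rw [← Real.exp_nat_mul, mul_one]
              _ ≤ _ := Real.exp_le_exp.2 hp
    · refine (Measurable.aemeasurable ?_)
      unfold Function.uncurry
      fun_prop
  -- the theorem follows from the exponential moment of `Q` by Markov's inequality
  have hmark := mul_meas_ge_le_lintegral₀ (μ := κ)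
    (f := fun ξ => ENNReal.ofReal (Real.exp (1 / (8 * σ) * Q ξ)))
    (by rw [hQ]; fun_prop) (ENNReal.ofReal (Real.exp (p + s)))
  refine (measure_mono hsub).trans ?_
  set S := {ξ | ENNReal.ofReal (Real.exp (p + s)) ≤ ENNReal.ofReal (Real.exp (1 / (8 * σ) * Q ξ))}
  calc κ S = ENNReal.ofReal (Real.exp (-(p + s))) * (ENNReal.ofReal (Real.exp (p + s)) * κ S) := by
        rw [← mul_assoc, ← ENNReal.ofReal_mul (Real.exp_pos _).le, ← Real.exp_add]
        simp
    _ ≤ ENNReal.ofReal (Real.exp (-(p + s))) * ENNReal.ofReal (Real.exp p) := by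
        gcongr
        exact hmark.trans hmgf
    _ = ENNReal.ofReal (Real.exp (-s)) := by
        rw [← ENNReal.ofReal_mul (Real.exp_pos _).le, ← Real.exp_add]
        congr 2; ring

end ConvexSIM

/-! ### The errors given the covariates -/

namespace ConvexSIM

variable {Ω : Type*} [MeasurableSpace Ω]

/-- The conditional law of one error given its covariate is sub-Gaussian, with a constant that does
not depend on the value of the covariate. -/
theorem ae_condDistrib_subGaussian {d : ℕ} {μ : Measure Ω} [IsProbabilityMeasure μ]
    {X : Ω → Vec d} {ξ : Ω → ℝ} (hX : Measurable X) (hξ : Measurable ξ)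
    (h : SubGaussianErrors μ X ξ) :
    Integrable (fun ω => ξ ω ^ 2) μ ∧ ∃ σ : ℝ, 0 < σ ∧ ∀ᵐ x ∂(μ.map X), ∀ c : ℝ,
      ∫⁻ y, ENNReal.ofReal (Real.exp (c * y)) ∂(condDistrib ξ X μ x)
        ≤ ENNReal.ofReal (Real.exp (σ * c ^ 2)) := by
  obtain ⟨⟨K, hK, hint, hle⟩, h0⟩ := h
  have hsq : Integrable (fun ω => ξ ω ^ 2) μ := by
    refine Integrable.mono' (hint.const_mul K) (hξ.pow_const 2).aestronglyMeasurable
      (Eventually.of_forall fun ω => ?_)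
    have h1 := Real.add_one_le_exp (ξ ω ^ 2 / K)
    have : ξ ω ^ 2 / K ≤ Real.exp (ξ ω ^ 2 / K) := by linarith
    rw [Real.norm_eq_abs, abs_of_nonneg (sq_nonneg _)]
    rwa [div_le_iff₀' hK] at this
  refine ⟨hsq, K + 1, by linarith, ?_⟩
  have hξi : Integrable ξ μ :=
    ((memLp_two_iff_integrable_sq hξ.aestronglyMeasurable).2 hsq).integrable one_le_two
  have e1 : ∀ᵐ x ∂(μ.map X), Integrable (fun y => Real.exp (y ^ 2 / K)) (condDistrib ξ X μ x) := by
    refine Integrable.condDistrib_ae_map (f := fun z : Vec d × ℝ => Real.exp (z.2 ^ 2 / K))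
      hξ.aemeasurable ?_
    rw [integrable_map_measure (by fun_prop) (hX.prodMk hξ).aemeasurable]
    exact hint
  have e2 : ∀ᵐ x ∂(μ.map X), K * (∫ y, (Real.exp (y ^ 2 / K) - 1) ∂(condDistrib ξ X μ x)) ≤ 1 := by
    have hm : StronglyMeasurable fun x =>
        ∫ y, (Real.exp (y ^ 2 / K) - 1) ∂(condDistrib ξ X μ x) :=
      StronglyMeasurable.integral_kernel (f := fun y : ℝ => Real.exp (y ^ 2 / K) - 1)
        (by fun_prop)
    rw [ae_map_iff hX.aemeasurable (measurableSet_le (hm.measurable.const_mul K) measurable_const)]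
    have := condExp_ae_eq_integral_condDistrib (μ := μ) hX hξ.aemeasurable
      (f := fun y : ℝ => Real.exp (y ^ 2 / K) - 1) (by fun_prop)
      (hint.sub (integrable_const 1))
    filter_upwards [hle, this] with ω h1 h2
    rwa [h2] at h1
  have e3 : ∀ᵐ x ∂(μ.map X), ∫ y, y ∂(condDistrib ξ X μ x) = 0 := by
    have hm : StronglyMeasurable fun x => ∫ y, y ∂(condDistrib ξ X μ x) :=
      StronglyMeasurable.integral_kernel (f := fun y : ℝ => y) (by fun_prop)
    rw [ae_map_iff hX.aemeasurable (measurableSet_eq_fun hm.measurable measurable_const)]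
    have := condExp_ae_eq_integral_condDistrib' (μ := μ) hX hξi
    filter_upwards [h0, this] with ω h1 h2
    rw [← h2, h1]; rfl
  filter_upwards [e1, e2, e3] with x h1 h2 h3 c
  refine lintegral_exp_mul_le _ hK h1 ?_ h3 c
  rw [integral_sub h1 (integrable_const 1)] at h2
  simpa using h2

/-- Conditionally on the covariates, independent sub-Gaussian errors stay sub-Gaussian with
coefficients that depend on all covariates. In the induction, the error of the first pair is
integrated out before the other pairs, and its covariate after them. -/
theorem lintegral_pi_exp_le {α : Type*} [MeasurableSpace α] (P : Measure α)
    [IsProbabilityMeasure P] (κ : Kernel α ℝ) [IsMarkovKernel κ] {σ : ℝ}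
    (hκ : ∀ᵐ x ∂P, ∀ c : ℝ, ∫⁻ y, ENNReal.ofReal (Real.exp (c * y)) ∂(κ x)
        ≤ ENNReal.ofReal (Real.exp (σ * c ^ 2))) (n : ℕ) :
    ∀ c : (Fin n → α) → Fin n → ℝ, Measurable c →
      ∫⁻ z : Fin n → α × ℝ, ENNReal.ofReal (Real.exp (∑ i,
          (c (fun j => (z j).1) i * (z i).2 - σ * c (fun j => (z j).1) i ^ 2)))
        ∂(Measure.pi fun _ => P ⊗ₘ κ) ≤ 1 := by
  induction n with
  | zero => intro c _; simp
  | succ n ih =>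
    intro c hc
    set ρ := P ⊗ₘ κ with hρ
    have hmp := (measurePreserving_piFinSuccAbove (fun _ : Fin (n + 1) => ρ) 0).symm
    rw [← hmp.lintegral_comp_emb (MeasurableEquiv.measurableEmbedding _)]
    simp only [MeasurableEquiv.piFinSuccAbove_symm_apply, Fin.insertNthEquiv_zero,
      Fin.consEquiv_apply, Fin.sum_univ_succ]
    have hcons : ∀ (z : α × ℝ) (w : Fin n → α × ℝ),
        (fun j => ((Fin.cons z w : Fin (n + 1) → α × ℝ) j).1)
          = (Fin.cons z.1 (fun j => (w j).1) : Fin (n + 1) → α) := by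
      intro z w
      ext j
      refine Fin.cases ?_ (fun j => ?_) j <;> simp
    simp only [hcons, Fin.cons_zero, Fin.cons_succ]
    have hmcons : Measurable fun q : α × (Fin n → α) => (Fin.cons q.1 q.2 : Fin (n + 1) → α) := by
      refine measurable_pi_lambda _ fun j => ?_
      refine Fin.cases ?_ (fun j => ?_) j
      · simpa using measurable_fst
      · simp only [Fin.cons_succ]
        exact (measurable_pi_apply j).comp measurable_snd
    have hcm : ∀ i, Measurable fun q : α × (Fin n → α) => c (Fin.cons q.1 q.2) i := fun i =>
      (measurable_pi_apply i).comp (hc.comp hmcons)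
    -- the exponent splits into the contributions of the first pair and of the others
    set A : α → ℝ → (Fin n → α × ℝ) → ℝ≥0∞ := fun x y w =>
      ENNReal.ofReal (Real.exp (c (Fin.cons x fun j => (w j).1) 0 * y
        - σ * c (Fin.cons x fun j => (w j).1) 0 ^ 2)) with hA
    set B : α → (Fin n → α × ℝ) → ℝ≥0∞ := fun x w =>
      ENNReal.ofReal (Real.exp (∑ i : Fin n, (c (Fin.cons x fun j => (w j).1) i.succ * (w i).2
        - σ * c (Fin.cons x fun j => (w j).1) i.succ ^ 2))) with hB
    have hproj : Measurable fun q : α × (Fin n → α × ℝ) => (q.1, fun j => (q.2 j).1) := by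
      fun_prop
    have hc' : ∀ i, Measurable fun q : α × (Fin n → α × ℝ) =>
        c (Fin.cons q.1 fun j => (q.2 j).1) i := fun i => (hcm i).comp hproj
    have hAm : Measurable fun q : (α × ℝ) × (Fin n → α × ℝ) => A q.1.1 q.1.2 q.2 := by
      have h0 : Measurable fun q : (α × ℝ) × (Fin n → α × ℝ) =>
          c (Fin.cons q.1.1 fun j => (q.2 j).1) 0 :=
        (hc' 0).comp (f := fun q : (α × ℝ) × (Fin n → α × ℝ) => (q.1.1, q.2)) (by fun_prop)
      exact ((h0.mul (by fun_prop)).sub ((h0.pow_const 2).const_mul σ)).exp.ennreal_ofReal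
    have hBm : Measurable fun q : α × (Fin n → α × ℝ) => B q.1 q.2 := by
      refine (Finset.measurable_sum _ fun i _ => ?_).exp.ennreal_ofReal
      exact ((hc' i.succ).mul (by fun_prop)).sub (((hc' i.succ).pow_const 2).const_mul σ)
    have hsplit : ∀ q : (α × ℝ) × (Fin n → α × ℝ),
        ENNReal.ofReal (Real.exp (c (Fin.cons q.1.1 fun j => (q.2 j).1) 0 * q.1.2
          - σ * c (Fin.cons q.1.1 fun j => (q.2 j).1) 0 ^ 2
          + ∑ i : Fin n, (c (Fin.cons q.1.1 fun j => (q.2 j).1) i.succ * (q.2 i).2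
            - σ * c (Fin.cons q.1.1 fun j => (q.2 j).1) i.succ ^ 2)))
        = A q.1.1 q.1.2 q.2 * B q.1.1 q.2 := by
      intro q
      rw [hA, hB, Real.exp_add, ENNReal.ofReal_mul (Real.exp_pos _).le]
    have hBm' : Measurable fun q : (α × ℝ) × (Fin n → α × ℝ) => B q.1.1 q.2 :=
      hBm.comp (f := fun q : (α × ℝ) × (Fin n → α × ℝ) => (q.1.1, q.2)) (by fun_prop)
    calc ∫⁻ q : (α × ℝ) × (Fin n → α × ℝ), _ ∂(ρ.prod (Measure.pi fun _ => ρ))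
        = ∫⁻ q : (α × ℝ) × (Fin n → α × ℝ), A q.1.1 q.1.2 q.2 * B q.1.1 q.2
            ∂(ρ.prod (Measure.pi fun _ => ρ)) := lintegral_congr hsplit
      _ = ∫⁻ z : α × ℝ, ∫⁻ w, A z.1 z.2 w * B z.1 w ∂(Measure.pi fun _ => ρ) ∂ρ :=
          lintegral_prod _ (hAm.mul hBm').aemeasurable
      _ = ∫⁻ x, ∫⁻ y, ∫⁻ w, A x y w * B x w ∂(Measure.pi fun _ => ρ) ∂(κ x) ∂P := by
          rw [hρ, Measure.lintegral_compProd]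
          exact (hAm.mul hBm').lintegral_prod_right'
      _ = ∫⁻ x, ∫⁻ w, ∫⁻ y, A x y w * B x w ∂(κ x) ∂(Measure.pi fun _ => ρ) ∂P := by
          refine lintegral_congr fun x => ?_
          rw [lintegral_lintegral_swap]
          exact ((hAm.mul hBm').comp
            (f := fun q : ℝ × (Fin n → α × ℝ) => ((x, q.1), q.2)) (by fun_prop)).aemeasurable
      _ ≤ ∫⁻ x, ∫⁻ w, B x w ∂(Measure.pi fun _ => ρ) ∂P := by
          refine lintegral_mono_ae ?_
          filter_upwards [hκ] with x hx
          refine lintegral_mono fun w => ?_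
          have hAx : Measurable fun y => A x y w :=
            hAm.comp (f := fun y : ℝ => ((x, y), w)) (by fun_prop)
          rw [lintegral_mul_const _ hAx]
          refine (mul_le_mul_left (a := B x w) ?_).trans_eq (one_mul _)
          set c0 := c (Fin.cons x fun j => (w j).1) 0
          have h1 : ∀ y, A x y w = ENNReal.ofReal (Real.exp (-(σ * c0 ^ 2)))
              * ENNReal.ofReal (Real.exp (c0 * y)) := by
            intro y
            rw [← ENNReal.ofReal_mul (Real.exp_pos _).le, ← Real.exp_add]
            simp only [hA]
            congr 2; ring
          simp_rw [h1]
          rw [lintegral_const_mul _ (by fun_prop)]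
          refine (mul_le_mul_right (hx c0) _).trans_eq ?_
          rw [← ENNReal.ofReal_mul (Real.exp_pos _).le, ← Real.exp_add]
          simp
      _ ≤ ∫⁻ x, 1 ∂P := by
          refine lintegral_mono fun x => ?_
          exact ih (fun xr i => c (Fin.cons x xr) i.succ) (measurable_pi_lambda _ fun i =>
            (hcm i.succ).comp (f := fun xr : Fin n → α => (x, xr)) (by fun_prop))
      _ = 1 := by simp

/-- The conditional law of the vector of errors given all covariates is sub-Gaussian. -/
theorem ae_condDistrib_isSubGaussianVec {d : ℕ} {μ : Measure Ω} [IsProbabilityMeasure μ]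
    {X : ℕ → Ω → Vec d} {ξ : ℕ → Ω → ℝ} (hX : ∀ i, Measurable (X i)) (hξ : ∀ i, Measurable (ξ i))
    (hindep : iIndepFun (fun i ω => (X i ω, ξ i ω)) μ)
    (hid : ∀ i, IdentDistrib (fun ω => (X i ω, ξ i ω)) (fun ω => (X 0 ω, ξ 0 ω)) μ μ)
    {σ : ℝ} (hσ : ∀ᵐ x ∂(μ.map (X 0)), ∀ c : ℝ,
      ∫⁻ y, ENNReal.ofReal (Real.exp (c * y)) ∂(condDistrib (ξ 0) (X 0) μ x)
        ≤ ENNReal.ofReal (Real.exp (σ * c ^ 2))) (n : ℕ) :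
    ∀ᵐ x ∂(μ.map fun ω (i : Fin n) => X i ω),
      IsSubGaussianVec σ (condDistrib (fun ω => WithLp.toLp 2 fun i : Fin n => ξ i ω)
        (fun ω (i : Fin n) => X i ω) μ x) := by
  set Xn : Ω → Fin n → Vec d := fun ω i => X i ω with hXn
  set ξn : Ω → EuclideanSpace ℝ (Fin n) := fun ω => WithLp.toLp 2 fun i : Fin n => ξ i ω with hξn
  have hXnm : Measurable Xn := measurable_pi_lambda _ fun i => hX i
  have hξnm : Measurable ξn :=
    (WithLp.measurable_toLp 2 (Fin n → ℝ)).comp (measurable_pi_lambda _ fun i => hξ i)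
  have hP : IsProbabilityMeasure (μ.map (X 0)) := Measure.isProbabilityMeasure_map (hX 0).aemeasurable
  have hlaw : μ.map (fun ω (i : Fin n) => (X i ω, ξ i ω))
      = Measure.pi fun _ : Fin n => μ.map (X 0) ⊗ₘ condDistrib (ξ 0) (X 0) μ := by
    have h1 : iIndepFun (fun (i : Fin n) ω => (X i ω, ξ i ω)) μ :=
      hindep.precomp Fin.val_injective
    rw [(iIndepFun_iff_map_fun_eq_pi_map (f := fun (i : Fin n) ω => (X i ω, ξ i ω))
      (fun i => ((hX i).prodMk (hξ i)).aemeasurable)).1 h1]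
    congr 1; ext1 i
    rw [compProd_map_condDistrib (hξ 0).aemeasurable]
    exact (hid i).map_eq
  have hpairm : Measurable fun ω (i : Fin n) => (X i ω, ξ i ω) :=
    measurable_pi_lambda _ fun i => (hX i).prodMk (hξ i)
  -- A conditional bound is a bound after integration over every event in the covariates; the event
  -- enters through coefficients that vanish off it.
  have hmain : ∀ c : EuclideanSpace ℝ (Fin n), ∀ A : Set (Fin n → Vec d), MeasurableSet A →
      ∫⁻ x in A, ∫⁻ y, ENNReal.ofReal (Real.exp (inner ℝ y c)) ∂(condDistrib ξn Xn μ x) ∂(μ.map Xn)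
        ≤ ∫⁻ _ in A, ENNReal.ofReal (Real.exp (σ * ‖c‖ ^ 2)) ∂(μ.map Xn) := by
    intro c A hA
    classical
    set cA : (Fin n → Vec d) → Fin n → ℝ := fun x i => A.indicator (fun _ => c i) x with hcA
    have hcAm : Measurable cA :=
      measurable_pi_lambda _ fun i => measurable_const.indicator hA
    have h1 := lintegral_pi_exp_le (μ.map (X 0)) (condDistrib (ξ 0) (X 0) μ) hσ n cA hcAm
    rw [← hlaw, lintegral_map _ hpairm] at h1
    swap
    · have : Measurable fun z : Fin n → Vec d × ℝ => cA fun j => (z j).1 :=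
        hcAm.comp (by fun_prop)
      have h2 : ∀ i, Measurable fun z : Fin n → Vec d × ℝ => cA (fun j => (z j).1) i :=
        fun i => (measurable_pi_apply i).comp this
      refine (Finset.measurable_sum _ fun i _ => ?_).exp.ennreal_ofReal
      exact ((h2 i).mul (by fun_prop)).sub (((h2 i).pow_const 2).const_mul σ)
    have hsum : ∀ ω, ∑ i : Fin n, (c i * ξ i ω - σ * c i ^ 2)
        = inner ℝ (ξn ω) c - σ * ‖c‖ ^ 2 := by
      intro ω
      rw [Finset.sum_sub_distrib, ← Finset.mul_sum, EuclideanSpace.norm_sq_eq]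
      congr 1
      simp
    set e := ENNReal.ofReal (Real.exp (σ * ‖c‖ ^ 2)) with he
    have he0 : e ≠ 0 := by simp [he, Real.exp_pos]
    have heT : e ≠ ∞ := ENNReal.ofReal_ne_top
    -- off the event, the coefficients vanish and the integrand is one
    have h2 : (∫⁻ ω in Xn ⁻¹' A, ENNReal.ofReal (Real.exp (inner ℝ (ξn ω) c - σ * ‖c‖ ^ 2)) ∂μ)
        + μ (Xn ⁻¹' A)ᶜ ≤ 1 := by
      refine le_trans (le_of_eq ?_) h1
      rw [← lintegral_add_compl (fun ω => ENNReal.ofReal (Real.exp (∑ i : Fin n,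
        (cA (Xn ω) i * ξ i ω - σ * cA (Xn ω) i ^ 2)))) (hXnm hA)]
      congr 1
      · refine setLIntegral_congr_fun (hXnm hA) fun ω hω => ?_
        have : Xn ω ∈ A := hω
        simp only [← hsum]
        simp only [hcA, hXn] at this ⊢
        simp [this]
      · rw [← setLIntegral_one]
        refine setLIntegral_congr_fun (hXnm hA).compl fun ω hω => ?_
        have : Xn ω ∉ A := hω
        simp only [hcA, hXn] at this ⊢
        simp [this]
    have h3 : ∫⁻ ω in Xn ⁻¹' A, ENNReal.ofReal (Real.exp (inner ℝ (ξn ω) c - σ * ‖c‖ ^ 2)) ∂μ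
        ≤ μ (Xn ⁻¹' A) := by
      have h4 : μ (Xn ⁻¹' A) + μ (Xn ⁻¹' A)ᶜ = 1 := prob_add_prob_compl (hXnm hA)
      rw [← h4] at h2
      exact (ENNReal.add_le_add_iff_right (measure_ne_top _ _)).1 h2
    have h5 : ∫⁻ ω in Xn ⁻¹' A, ENNReal.ofReal (Real.exp (inner ℝ (ξn ω) c)) ∂μ
        ≤ e * μ (Xn ⁻¹' A) := by
      calc _ = ∫⁻ ω in Xn ⁻¹' A, e * ENNReal.ofReal (Real.exp (inner ℝ (ξn ω) c - σ * ‖c‖ ^ 2)) ∂μ := by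
            refine lintegral_congr fun ω => ?_
            rw [he, ← ENNReal.ofReal_mul (Real.exp_pos _).le, ← Real.exp_add]
            congr 2; ring
        _ = e * ∫⁻ ω in Xn ⁻¹' A, ENNReal.ofReal (Real.exp (inner ℝ (ξn ω) c - σ * ‖c‖ ^ 2)) ∂μ :=
            lintegral_const_mul' _ _ heT
        _ ≤ _ := by gcongr
    have hF : Measurable fun z : (Fin n → Vec d) × EuclideanSpace ℝ (Fin n) =>
        ENNReal.ofReal (Real.exp (inner ℝ z.2 c)) := by fun_prop
    calc _ = ∫⁻ z in A ×ˢ univ, ENNReal.ofReal (Real.exp (inner ℝ z.2 c))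
          ∂(μ.map Xn ⊗ₘ condDistrib ξn Xn μ) := by
          rw [Measure.setLIntegral_compProd hF hA MeasurableSet.univ]
          simp
      _ = ∫⁻ ω in Xn ⁻¹' A, ENNReal.ofReal (Real.exp (inner ℝ (ξn ω) c)) ∂μ := by
          rw [compProd_map_condDistrib hξnm.aemeasurable,
            setLIntegral_map (hA.prod MeasurableSet.univ) hF (hXnm.prodMk hξnm)]
          congr 2
          ext ω; simp
      _ ≤ e * μ (Xn ⁻¹' A) := h5
      _ = _ := by rw [setLIntegral_const, Measure.map_apply hXnm hA]
  obtain ⟨S, hSc, hSd⟩ := TopologicalSpace.exists_countable_dense (EuclideanSpace ℝ (Fin n))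
  have hae : ∀ᵐ x ∂(μ.map Xn), ∀ c ∈ S,
      ∫⁻ y, ENNReal.ofReal (Real.exp (inner ℝ y c)) ∂(condDistrib ξn Xn μ x)
        ≤ ENNReal.ofReal (Real.exp (σ * ‖c‖ ^ 2)) := by
    rw [ae_ball_iff hSc]
    intro c _
    have : Measurable fun x =>
        ∫⁻ y, ENNReal.ofReal (Real.exp (inner ℝ y c)) ∂(condDistrib ξn Xn μ x) :=
      Measurable.lintegral_kernel (f := fun y : EuclideanSpace ℝ (Fin n) =>
        ENNReal.ofReal (Real.exp (inner ℝ y c))) (by fun_prop)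
    exact ae_le_of_forall_setLIntegral_le_of_sigmaFinite this fun A hA _ => hmain c A hA
  filter_upwards [hae] with x hx c
  -- pass from the countable dense set to all coefficients by Fatou's lemma
  obtain ⟨u, huS, hu⟩ := mem_closure_iff_seq_limit.1 (hSd c)
  have hlim : ∀ y : EuclideanSpace ℝ (Fin n),
      ENNReal.ofReal (Real.exp (inner ℝ y c))
        = liminf (fun k => ENNReal.ofReal (Real.exp (inner ℝ y (u k)))) atTop := by
    intro y
    refine (Tendsto.liminf_eq ?_).symm
    exact (ENNReal.continuous_ofReal.tendsto _).comp ((Real.continuous_exp.tendsto _).comp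
      (tendsto_const_nhds.inner hu))
  have hlim2 : Tendsto (fun k => ENNReal.ofReal (Real.exp (σ * ‖u k‖ ^ 2))) atTop
      (𝓝 (ENNReal.ofReal (Real.exp (σ * ‖c‖ ^ 2)))) :=
    (ENNReal.continuous_ofReal.tendsto _).comp ((Real.continuous_exp.tendsto _).comp
      ((hu.norm.pow 2).const_mul σ))
  simp_rw [hlim]
  refine (lintegral_liminf_le fun k => by fun_prop).trans ?_
  rw [← hlim2.liminf_eq]
  exact liminf_le_liminf (Eventually.of_forall fun k => hx _ (huS k))

end ConvexSIM

/-! ### The noise, uniformly over links and directions -/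

namespace ConvexSIM

/-- The points of the cube `[-1, 1]^d` with coordinates in `n⁻¹ ℤ`. -/
noncomputable def directionGrid (d n : ℕ) : Finset (Vec d) :=
  Finset.univ.image fun z : Fin d → Fin (2 * n + 1) => WithLp.toLp 2 fun k => ((z k : ℝ) - n) / n

theorem card_directionGrid_le (d n : ℕ) : (directionGrid d n).card ≤ (2 * n + 1) ^ d := by
  refine Finset.card_image_le.trans ?_
  simp

/-- The Euclidean norm is at most `d` times the supremum norm. -/
theorem norm_le_card_mul_of_abs_le {d : ℕ} {C : ℝ} (hC : 0 ≤ C) (v : Vec d)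
    (h : ∀ k, |v k| ≤ C) : ‖v‖ ≤ d * C := by
  refine (sq_le_sq₀ (norm_nonneg _) (by positivity)).1 ?_
  rw [EuclideanSpace.norm_sq_eq]
  calc ∑ k, ‖v k‖ ^ 2 ≤ ∑ _k : Fin d, C ^ 2 := by
        refine Finset.sum_le_sum fun k _ => ?_
        have := h k
        rw [Real.norm_eq_abs]
        gcongr
    _ = d * C ^ 2 := by simp
    _ ≤ (d * C) ^ 2 := by
        rw [mul_pow]
        gcongr
        rcases Nat.eq_zero_or_pos d with rfl | hd
        · simp
        · exact_mod_cast Nat.le_self_pow two_ne_zero d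

theorem norm_le_of_mem_directionGrid {d n : ℕ} {η : Vec d} (h : η ∈ directionGrid d n) :
    ‖η‖ ≤ d := by
  obtain ⟨z, -, rfl⟩ := Finset.mem_image.1 h
  have := norm_le_card_mul_of_abs_le zero_le_one
    (WithLp.toLp 2 fun k => ((z k : ℝ) - n) / n : Vec d) fun k => ?_
  · simpa using this
  · have h1 : ((z k : ℕ) : ℝ) ≤ 2 * n := by
      have := (z k).2
      exact_mod_cast (by omega : (z k : ℕ) ≤ 2 * n)
    have h0 : (0 : ℝ) ≤ ((z k : ℕ) : ℝ) := Nat.cast_nonneg _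
    simp only
    rw [abs_div, Nat.abs_cast]
    refine div_le_one_of_le₀ ?_ (Nat.cast_nonneg _)
    rw [abs_le]; constructor <;> linarith

theorem exists_mem_directionGrid {d n : ℕ} (hn : 1 ≤ n) {θ : Vec d} (hθ : ‖θ‖ ≤ 1) :
    ∃ η ∈ directionGrid d n, ‖θ - η‖ ≤ d / n := by
  have hn0 : (0 : ℝ) < n := by exact_mod_cast hn
  have hk : ∀ k, |θ k| ≤ 1 := fun k => (PiLp.norm_apply_le θ k).trans hθ
  have hpos : ∀ k, 0 ≤ n * θ k + n := fun k => by nlinarith [(abs_le.1 (hk k)).1]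
  have hlt : ∀ k, ⌊n * θ k + n⌋₊ < 2 * n + 1 := by
    intro k
    rw [Nat.lt_succ_iff]
    apply Nat.floor_le_of_le
    push_cast
    nlinarith [(abs_le.1 (hk k)).2]
  refine ⟨_, Finset.mem_image_of_mem _ (Finset.mem_univ fun k => ⟨⌊n * θ k + n⌋₊, hlt k⟩), ?_⟩
  rw [div_eq_mul_one_div]
  refine norm_le_card_mul_of_abs_le (by positivity) _ fun k => ?_
  simp only [PiLp.sub_apply]
  have h1 := Nat.floor_le (hpos k)
  have h2 := Nat.lt_floor_add_one (n * θ k + n)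
  have h3 : θ k - ((⌊n * θ k + n⌋₊ : ℝ) - n) / n = (n * θ k + n - ⌊n * θ k + n⌋₊) / n := by
    field_simp; ring
  rw [h3, abs_div, Nat.abs_cast]
  gcongr
  rw [abs_le]; constructor <;> linarith

/-- The inner product of the errors with `m(ηᵀx) - f` is of the order that the dimension `N` of the
coarsest approximating space allows, for all links `m` of finite energy at once. -/
def NoiseBound {d n : ℕ} (f : Vec d → ℝ) (B l : ℝ) (N : ℕ) (x : Fin n → Vec d)
    (ξ : EuclideanSpace ℝ (Fin n)) (η : Vec d) : Prop :=
  ∀ (m p : ℝ → ℝ) (ν : Measure ℝ), IsEnergyLink m p ν →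
    |inner ℝ ξ (WithLp.toLp 2 fun i => m (inner ℝ η (x i)) - f (x i))|
      ≤ B * Real.sqrt N * ‖(WithLp.toLp 2 fun i => m (inner ℝ η (x i)) - f (x i) :
            EuclideanSpace ℝ (Fin n))‖
        + 5 * B * Real.sqrt (2 * n * l ^ 3 * ν.real univ) * (Real.sqrt N / N ^ 2)

/-- The noise bound can only fail on an open set, which is therefore measurable although the bound
quantifies over an uncountable class of links. -/
theorem isOpen_setOf_not_noiseBound {d n : ℕ} {f : Vec d → ℝ} (hf : Continuous f) (B l : ℝ)
    (N : ℕ) (η : Vec d) :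
    IsOpen {z : (Fin n → Vec d) × EuclideanSpace ℝ (Fin n) | ¬ NoiseBound f B l N z.1 z.2 η} := by
  have : {z : (Fin n → Vec d) × EuclideanSpace ℝ (Fin n) | ¬ NoiseBound f B l N z.1 z.2 η}
      = ⋃ (q : (ℝ → ℝ) × (ℝ → ℝ) × Measure ℝ) (_ : IsEnergyLink q.1 q.2.1 q.2.2),
        {z | B * Real.sqrt N * ‖(WithLp.toLp 2 fun i => q.1 (inner ℝ η (z.1 i)) - f (z.1 i) :
            EuclideanSpace ℝ (Fin n))‖
          + 5 * B * Real.sqrt (2 * n * l ^ 3 * q.2.2.real univ) * (Real.sqrt N / N ^ 2)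
          < |inner ℝ z.2 (WithLp.toLp 2 fun i => q.1 (inner ℝ η (z.1 i)) - f (z.1 i))|} := by
    ext z
    simp only [NoiseBound, mem_ofPred_eq, mem_iUnion, Prod.exists, exists_prop]
    push Not
    rfl
  rw [this]
  refine isOpen_iUnion fun q => isOpen_iUnion fun hq => ?_
  have hm : Continuous q.1 := continuous_iff_continuousAt.2 fun t => (hq.hasDerivAt t).continuousAt
  have hv : Continuous fun z : (Fin n → Vec d) × EuclideanSpace ℝ (Fin n) =>
      (WithLp.toLp 2 fun i => q.1 (inner ℝ η (z.1 i)) - f (z.1 i) : EuclideanSpace ℝ (Fin n)) := by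
    refine (PiLp.continuous_toLp 2 _).comp (continuous_pi fun i => ?_)
    fun_prop
  exact isOpen_lt (by fun_prop) (by fun_prop)

/-- For a fixed direction and fixed covariates the noise bound fails with exponentially small
probability. The space used by the chain at level `k ≥ 1` has dimension at most `12 · 2ᵏ⁻¹ N`,
and a deviation of `2ᵏ⁻¹ N` is allowed; this gives the constant `104 = 8 · (12 + 1)`. -/
theorem IsSubGaussianVec.measure_not_noiseBound_le {d n : ℕ} {σ : ℝ} (hσ : 0 < σ)
    {κ : Measure (EuclideanSpace ℝ (Fin n))} [IsProbabilityMeasure κ] (hκ : IsSubGaussianVec σ κ)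
    (f : Vec d → ℝ) {l : ℝ} (hl : 0 < l) {N : ℕ} (hN : 1 ≤ N) (x : Fin n → Vec d) (η : Vec d)
    (hx : ∀ i, |inner ℝ η (x i)| ≤ l / 2) :
    κ {ξ | ¬ NoiseBound f (Real.sqrt (104 * σ)) l N x ξ η}
      ≤ (n + 1) * ENNReal.ofReal (Real.exp (-N)) := by
  set t : Fin n → ℝ := fun i => inner ℝ η (x i) with ht
  have htl : ∀ i, t i ∈ Icc (-(l / 2)) (-(l / 2) + l) := fun i => by
    have := abs_le.1 (hx i)
    constructor <;> linarith
  have hNk : ∀ k : ℕ, 1 ≤ 2 ^ k * N := fun k => Nat.one_le_iff_ne_zero.2 (by positivity)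
  choose W hWdim hW using fun k => exists_piecewise_linear_approx t hl htl (hNk k)
  set f' : EuclideanSpace ℝ (Fin n) := WithLp.toLp 2 fun i => f (x i) with hf'
  -- the space in which the chain lives at level `k`: the coarsest space and the fixed vector at level
  -- `0`, two successive spaces afterwards
  set V : ℕ → Submodule ℝ (EuclideanSpace ℝ (Fin n)) := fun k =>
    if k = 0 then W 0 ⊔ Submodule.span ℝ {f'} else W (k - 1) ⊔ W k with hV
  set M : ℕ → ℕ := fun k => 2 ^ (k - 1) * N with hM
  have hNM : ∀ k, N ≤ M k := fun k => Nat.le_mul_of_pos_left _ (by positivity)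
  have hVdim : ∀ k, (Module.finrank ℝ (V k) : ℝ) ≤ 12 * M k := by
    intro k
    have : Module.finrank ℝ (V k) ≤ 12 * M k := by
      rcases Nat.eq_zero_or_pos k with rfl | hk
      · rw [show V 0 = W 0 ⊔ Submodule.span ℝ {f'} from if_pos rfl]
        have h1 := Submodule.finrank_add_le_finrank_add_finrank (W 0) (Submodule.span ℝ {f'})
        have h2 : Module.finrank ℝ (Submodule.span ℝ {f'}) ≤ 1 := by
          simpa using finrank_span_le_card (R := ℝ) ({f'} : Set (EuclideanSpace ℝ (Fin n)))
        have h3 := hWdim 0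
        simp only [hM, pow_zero, one_mul, zero_tsub] at h3 ⊢
        omega
      · rw [show V k = W (k - 1) ⊔ W k from if_neg hk.ne']
        have h1 := Submodule.finrank_add_le_finrank_add_finrank (W (k - 1)) (W k)
        have h2 := hWdim (k - 1)
        have h3 := hWdim k
        have h4 : 2 ^ k * N = 2 * (2 ^ (k - 1) * N) := by
          conv_lhs => rw [← Nat.sub_add_cancel hk, pow_succ]
          ring
        simp only [hM]
        omega
    exact_mod_cast this
  set Bad : ℕ → Set (EuclideanSpace ℝ (Fin n)) := fun k =>
    {ξ | ∃ v ∈ V k, Real.sqrt (8 * σ * (12 * M k + M k)) * ‖v‖ < |inner ℝ ξ v|} with hBad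
  have hBadle : ∀ k, κ (Bad k) ≤ ENNReal.ofReal (Real.exp (-N)) := by
    intro k
    refine (hκ.measure_subspace_le hσ (V k) (hVdim k) (Nat.cast_nonneg _)).trans ?_
    refine ENNReal.ofReal_le_ofReal (Real.exp_le_exp.2 (neg_le_neg ?_))
    exact_mod_cast hNM k
  have hsub : {ξ | ¬ NoiseBound f (Real.sqrt (104 * σ)) l N x ξ η}
      ⊆ ⋃ k ∈ Finset.range (n + 1), Bad k := by
    intro ξ hξ
    by_contra hcon
    apply hξ
    simp only [mem_iUnion, not_exists, hBad, mem_ofPred_eq, not_and, not_lt] at hcon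
    have hgood : ∀ k < n + 1, ∀ v ∈ V k,
        |inner ℝ ξ v| ≤ Real.sqrt (104 * σ) * Real.sqrt (M k) * ‖v‖ := by
      intro k hk v hv
      refine (hcon k (Finset.mem_range.2 hk) v hv).trans (le_of_eq ?_)
      rw [← Real.sqrt_mul (by positivity)]
      congr 2; ring
    intro m p ν hm
    -- `n` levels suffice, since `n ≤ 2ⁿ N`
    have := chaining_bound t hl hN (K := n)
      ((Nat.lt_two_pow_self).le.trans (Nat.le_mul_of_pos_right _ hN)) W hW f' ξ
      (Real.sqrt_nonneg (104 * σ))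
      (fun v hv => by simpa [hM] using hgood 0 (by omega) v (by simpa [hV] using hv))
      (fun k hk v hv => by
        have := hgood (k + 1) (by omega) v (by simpa [hV] using hv)
        simpa [hM] using this) hm
    have he : (WithLp.toLp 2 fun i => m (t i)) - f'
        = (WithLp.toLp 2 fun i => m (inner ℝ η (x i)) - f (x i) : EuclideanSpace ℝ (Fin n)) := by
      ext i; simp [hf', ht]
    rwa [he] at this
  refine (measure_mono hsub).trans ((measure_biUnion_finset_le _ _).trans ?_)
  refine (Finset.sum_le_sum fun k _ => hBadle k).trans ?_
  rw [Finset.sum_const, Finset.card_range, nsmul_eq_mul]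
  push_cast
  rfl

variable {Ω : Type*} [MeasurableSpace Ω]

/-- The noise bound holds for all directions of a polynomially large grid at once, with probability
tending to one: the failure probability for one direction is exponentially small in the dimension
`n^{1/5}`. -/
theorem tendsto_measure_not_noiseBound {d : ℕ} {μ : Measure Ω} [IsProbabilityMeasure μ]
    {X : ℕ → Ω → Vec d} {ξ : ℕ → Ω → ℝ} (hX : ∀ i, Measurable (X i)) (hξ : ∀ i, Measurable (ξ i))
    (hindep : iIndepFun (fun i ω => (X i ω, ξ i ω)) μ)
    (hid : ∀ i, IdentDistrib (fun ω => (X i ω, ξ i ω)) (fun ω => (X 0 ω, ξ 0 ω)) μ μ)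
    {σ : ℝ} (hσ0 : 0 < σ) (hσ : ∀ᵐ x ∂(μ.map (X 0)), ∀ c : ℝ,
      ∫⁻ y, ENNReal.ofReal (Real.exp (c * y)) ∂(condDistrib (ξ 0) (X 0) μ x)
        ≤ ENNReal.ofReal (Real.exp (σ * c ^ 2)))
    {T : ℝ} (hT : ∀ i, ∀ᵐ ω ∂μ, ‖X i ω‖ ≤ T) {f : Vec d → ℝ} (hf : Continuous f) {l : ℝ}
    (hl : 0 < l) (hdT : d * T ≤ l / 2) :
    Tendsto (fun n : ℕ => μ {ω | ¬ ∀ η ∈ directionGrid d n,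
      NoiseBound f (Real.sqrt (104 * σ)) l ⌈(n : ℝ) ^ (1 / 5 : ℝ)⌉₊ (fun i : Fin n => X i ω)
        (WithLp.toLp 2 fun i : Fin n => ξ i ω) η}) atTop (𝓝 0) := by
  set B := Real.sqrt (104 * σ)
  set N : ℕ → ℕ := fun n => ⌈(n : ℝ) ^ (1 / 5 : ℝ)⌉₊ with hN
  have hbound : ∀ n : ℕ, 1 ≤ n → μ {ω | ¬ ∀ η ∈ directionGrid d n,
      NoiseBound f B l (N n) (fun i : Fin n => X i ω) (WithLp.toLp 2 fun i : Fin n => ξ i ω) η}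
      ≤ ENNReal.ofReal ((2 * n + 1) ^ d * (n + 1) * Real.exp (-(n : ℝ) ^ (1 / 5 : ℝ))) := by
    intro n hn
    have hN1 : 1 ≤ N n := by
      rw [hN, Nat.one_le_ceil_iff]
      have : (0 : ℝ) < n := by exact_mod_cast hn
      positivity
    set Xn : Ω → Fin n → Vec d := fun ω i => X i ω with hXn
    set ξn : Ω → EuclideanSpace ℝ (Fin n) := fun ω => WithLp.toLp 2 fun i : Fin n => ξ i ω with hξn
    have hXnm : Measurable Xn := measurable_pi_lambda _ fun i => hX i
    have hξnm : Measurable ξn :=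
      (WithLp.measurable_toLp 2 (Fin n → ℝ)).comp (measurable_pi_lambda _ fun i => hξ i)
    set U : Set ((Fin n → Vec d) × EuclideanSpace ℝ (Fin n)) :=
      ⋃ η ∈ directionGrid d n, {z | ¬ NoiseBound f B l (N n) z.1 z.2 η} with hU
    have hUm : MeasurableSet U := (isOpen_biUnion fun η _ =>
      isOpen_setOf_not_noiseBound hf B l (N n) η).measurableSet
    have hset : {ω | ¬ ∀ η ∈ directionGrid d n, NoiseBound f B l (N n) (fun i : Fin n => X i ω)
        (WithLp.toLp 2 fun i : Fin n => ξ i ω) η} = (fun ω => (Xn ω, ξn ω)) ⁻¹' U := by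
      ext ω
      simp only [hU, mem_ofPred_eq, mem_preimage, mem_iUnion, exists_prop]
      push Not
      rfl
    have haeT : ∀ᵐ x ∂(μ.map Xn), ∀ i, ‖x i‖ ≤ T := by
      rw [ae_map_iff hXnm.aemeasurable]
      · exact ae_all_iff.2 fun i : Fin n => hT i
      · rw [ofPred_forall]
        exact MeasurableSet.iInter fun i => measurableSet_le (by fun_prop) measurable_const
    rw [hset, ← Measure.map_apply (hXnm.prodMk hξnm) hUm,
      ← compProd_map_condDistrib hξnm.aemeasurable, Measure.compProd_apply hUm]
    have hprob : IsProbabilityMeasure (μ.map Xn) := Measure.isProbabilityMeasure_map hXnm.aemeasurable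
    -- conditionally on the covariates, a union bound over the grid of directions
    calc ∫⁻ x, condDistrib ξn Xn μ x (Prod.mk x ⁻¹' U) ∂(μ.map Xn)
        ≤ ∫⁻ _, ENNReal.ofReal ((2 * n + 1) ^ d * (n + 1) * Real.exp (-(n : ℝ) ^ (1 / 5 : ℝ)))
          ∂(μ.map Xn) := by
          refine lintegral_mono_ae ?_
          filter_upwards [haeT, ae_condDistrib_isSubGaussianVec hX hξ hindep hid hσ n]
            with x hx hsg
          have h1 : Prod.mk x ⁻¹' U
              = ⋃ η ∈ directionGrid d n, {y | ¬ NoiseBound f B l (N n) x y η} := by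
            simp only [hU, preimage_iUnion]; rfl
          rw [h1]
          refine (measure_biUnion_finset_le _ _).trans ?_
          refine (Finset.sum_le_sum fun η hη => IsSubGaussianVec.measure_not_noiseBound_le hσ0 hsg
            f hl hN1 x η fun i => ?_).trans ?_
          · refine (abs_real_inner_le_norm _ _).trans (le_trans ?_ hdT)
            have := norm_le_of_mem_directionGrid hη
            exact mul_le_mul this (hx i) (norm_nonneg _) (Nat.cast_nonneg _)
          · rw [Finset.sum_const, nsmul_eq_mul, mul_assoc,
              ENNReal.ofReal_mul (by positivity), ENNReal.ofReal_mul (by positivity)]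
            refine mul_le_mul' ?_ (mul_le_mul' ?_ ?_)
            · rw [← ENNReal.ofReal_natCast]
              refine ENNReal.ofReal_le_ofReal ?_
              exact_mod_cast card_directionGrid_le d n
            · rw [ENNReal.ofReal_add (by positivity) (by norm_num)]
              simp
            · refine ENNReal.ofReal_le_ofReal (Real.exp_le_exp.2 (neg_le_neg ?_))
              exact Nat.le_ceil _
      _ = _ := by simp
  -- `exp (-n^{1/5})` beats every power of `n`, that is, every power of `n^{1/5}`
  have hlim : Tendsto (fun n : ℕ => ENNReal.ofReal
      ((2 * n + 1) ^ d * (n + 1) * Real.exp (-(n : ℝ) ^ (1 / 5 : ℝ)))) atTop (𝓝 0) := by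
    rw [← ENNReal.ofReal_zero]
    refine (ENNReal.continuous_ofReal.tendsto 0).comp ?_
    have h1 : Tendsto (fun n : ℕ => (n : ℝ) ^ (1 / 5 : ℝ)) atTop atTop :=
      (tendsto_rpow_atTop (by norm_num)).comp tendsto_natCast_atTop_atTop
    have h2 := ((Real.tendsto_pow_mul_exp_neg_atTop_nhds_zero (5 * (d + 1))).comp h1).const_mul
      ((3 : ℝ) ^ d * 2)
    rw [mul_zero] at h2
    refine squeeze_zero' (Eventually.of_forall fun n => by positivity) ?_ h2
    filter_upwards [eventually_ge_atTop 1] with n hn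
    have hn1 : (1 : ℝ) ≤ n := by exact_mod_cast hn
    have h3 : ((n : ℝ) ^ (1 / 5 : ℝ)) ^ (5 * (d + 1)) = (n : ℝ) ^ (d + 1) := by
      rw [pow_mul, ← Real.rpow_natCast _ 5, ← Real.rpow_mul (by positivity)]
      norm_num
    simp only [Function.comp]
    rw [h3]
    calc (2 * (n : ℝ) + 1) ^ d * (n + 1) * Real.exp (-(n : ℝ) ^ (1 / 5 : ℝ))
        ≤ (3 * n) ^ d * (2 * n) * Real.exp (-(n : ℝ) ^ (1 / 5 : ℝ)) := by
          gcongr <;> linarith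
      _ = _ := by rw [mul_pow]; ring
  refine tendsto_of_tendsto_of_tendsto_of_le_of_le' tendsto_const_nhds hlim
    (Eventually.of_forall fun _ => bot_le) ?_
  filter_upwards [eventually_ge_atTop 1] with n hn using hbound n hn

end ConvexSIM

/-! ### Laws of large numbers and Gram matrices -/

namespace ConvexSIM

variable {Ω : Type*} [MeasurableSpace Ω]

/-- Identically distributed, pairwise independent covariates. -/
structure IsIIDDesign {d : ℕ} (μ : Measure Ω) (X : ℕ → Ω → Vec d) : Prop where
  measurable : ∀ i, Measurable (X i)
  indep : Pairwise fun i j => IndepFun (X i) (X j) μ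
  identDistrib : ∀ i, IdentDistrib (X i) (X 0) μ μ

theorem IsSingleIndexSample.isIIDDesign {d : ℕ} {μ : Measure Ω} {X : ℕ → Ω → Vec d}
    {ξ Y : ℕ → Ω → ℝ} {m₀ : ℝ → ℝ} {θ₀ : Vec d} (h : IsSingleIndexSample μ X ξ Y m₀ θ₀) :
    IsIIDDesign μ X where
  measurable := h.measurable_X
  indep := fun _ _ hij => (h.indep.indepFun hij).comp measurable_fst measurable_fst
  identDistrib := fun i => (h.identDistrib i).comp measurable_fst

/-- The weak law of large numbers, for averages indexed by `Fin n`. -/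
theorem tendsto_measure_lt_abs_avg_sub {μ : Measure Ω} [IsProbabilityMeasure μ] {Y : ℕ → Ω → ℝ}
    (hint : Integrable (Y 0) μ) (hindep : Pairwise fun i j => IndepFun (Y i) (Y j) μ)
    (hid : ∀ i, IdentDistrib (Y i) (Y 0) μ μ) {ε : ℝ} (hε : 0 < ε) :
    Tendsto (fun n : ℕ => μ {ω | ε < |(∑ i : Fin n, Y i ω) / n - ∫ ω, Y 0 ω ∂μ|}) atTop (𝓝 0) := by
  have h1 := strong_law_ae_real Y hint hindep hid
  have hmeas : ∀ n : ℕ, AEStronglyMeasurable (fun ω => (∑ i ∈ Finset.range n, Y i ω) / n) μ := by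
    intro n
    have : AEMeasurable (fun ω => ∑ i ∈ Finset.range n, Y i ω) μ :=
      Finset.aemeasurable_fun_sum _ fun i _ => (hid i).aemeasurable_fst
    exact (this.div_const _).aestronglyMeasurable
  have h2 := tendstoInMeasure_of_tendsto_ae hmeas h1
  rw [tendstoInMeasure_iff_dist] at h2
  refine tendsto_of_tendsto_of_tendsto_of_le_of_le tendsto_const_nhds (h2 ε hε)
    (fun _ => bot_le) fun n => measure_mono fun ω hω => ?_
  simp only [mem_ofPred_eq, Real.dist_eq] at hω ⊢
  rw [Finset.sum_range]
  exact hω.le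

/-- The uniform law of large numbers over a compact family of functions. -/
theorem tendsto_measure_exists_lt_abs_avg_sub {d : ℕ} {μ : Measure Ω} [IsProbabilityMeasure μ]
    {X : ℕ → Ω → Vec d} (hX : IsIIDDesign μ X) {χ : Set (Vec d)} (hχ : ∀ i, ∀ᵐ ω ∂μ, X i ω ∈ χ)
    {Z : Type*} [PseudoMetricSpace Z] {K : Set Z} (hK : IsCompact K) {F : Z → Vec d → ℝ}
    (hFm : ∀ z ∈ K, Measurable (F z)) (hFi : ∀ z ∈ K, Integrable (fun ω => F z (X 0 ω)) μ)
    (hF : ∀ ε > 0, ∃ δ > 0, ∀ z ∈ K, ∀ z' ∈ K, dist z z' < δ → ∀ x ∈ χ, |F z x - F z' x| ≤ ε)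
    {ε : ℝ} (hε : 0 < ε) :
    Tendsto (fun n : ℕ => μ {ω | ∃ z ∈ K,
      ε < |(∑ i : Fin n, F z (X i ω)) / n - ∫ ω, F z (X 0 ω) ∂μ|}) atTop (𝓝 0) := by
  -- a finite net of the compact family reduces the claim to finitely many functions
  obtain ⟨δ, hδ, hFδ⟩ := hF (ε / 3) (by positivity)
  obtain ⟨t, htK, htf, hcov⟩ := hK.finite_cover_balls hδ
  have hnull : μ {ω | ¬ ∀ i, X i ω ∈ χ} = 0 := by
    rw [← ae_iff]; exact ae_all_iff.2 hχ
  have hsub : ∀ n : ℕ, 1 ≤ n → {ω | ∃ z ∈ K,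
      ε < |(∑ i : Fin n, F z (X i ω)) / n - ∫ ω, F z (X 0 ω) ∂μ|}
      ⊆ {ω | ¬ ∀ i, X i ω ∈ χ} ∪ ⋃ z ∈ htf.toFinset,
        {ω | ε / 3 < |(∑ i : Fin n, F z (X i ω)) / n - ∫ ω, F z (X 0 ω) ∂μ|} := by
    rintro n hn ω ⟨z, hzK, hz⟩
    by_cases hω : ∀ i, X i ω ∈ χ
    swap
    · exact Or.inl hω
    right
    obtain ⟨z', hz't, hzz'⟩ := mem_iUnion₂.1 (hcov hzK)
    have hz'K := htK hz't
    have hn0 : (0 : ℝ) < n := by exact_mod_cast hn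
    refine mem_iUnion₂.2 ⟨z', htf.mem_toFinset.2 hz't, ?_⟩
    have hd : ∀ x ∈ χ, |F z x - F z' x| ≤ ε / 3 := hFδ z hzK z' hz'K hzz'
    have h1 : |(∑ i : Fin n, F z (X i ω)) / n - (∑ i : Fin n, F z' (X i ω)) / n| ≤ ε / 3 := by
      rw [← sub_div, ← Finset.sum_sub_distrib, abs_div, Nat.abs_cast, div_le_iff₀ hn0]
      refine (Finset.abs_sum_le_sum_abs _ _).trans ?_
      refine (Finset.sum_le_sum fun (i : Fin n) _ => hd (X i ω) (hω i)).trans ?_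
      simp [mul_comm]
    have h2 : |(∫ ω, F z (X 0 ω) ∂μ) - ∫ ω, F z' (X 0 ω) ∂μ| ≤ ε / 3 := by
      rw [← integral_sub (hFi z hzK) (hFi z' hz'K)]
      have := norm_integral_le_of_norm_le_const (μ := μ) (C := ε / 3)
        (f := fun ω => F z (X 0 ω) - F z' (X 0 ω)) (by
          filter_upwards [hχ 0] with ω hω using hd _ hω)
      simpa using this
    simp only [mem_ofPred_eq]
    by_contra hcon
    push Not at hcon
    rw [abs_le] at h1 h2 hcon
    have : |(∑ i : Fin n, F z (X i ω)) / n - ∫ ω, F z (X 0 ω) ∂μ| ≤ ε := by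
      rw [abs_le]; constructor <;> linarith [h1.1, h1.2, h2.1, h2.2, hcon.1, hcon.2]
    linarith
  have hlim : Tendsto (fun n : ℕ => ∑ z ∈ htf.toFinset,
      μ {ω | ε / 3 < |(∑ i : Fin n, F z (X i ω)) / n - ∫ ω, F z (X 0 ω) ∂μ|}) atTop (𝓝 0) := by
    rw [show 𝓝 (0 : ℝ≥0∞) = 𝓝 (∑ _z ∈ htf.toFinset, 0) by simp]
    refine tendsto_finsetSum _ fun z hz => ?_
    have hzK := htK (htf.mem_toFinset.1 hz)
    exact tendsto_measure_lt_abs_avg_sub (Y := fun i ω => F z (X i ω)) (hFi z hzK)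
      (fun i j hij => (hX.indep hij).comp (hFm z hzK) (hFm z hzK))
      (fun i => (hX.identDistrib i).comp (hFm z hzK)) (by positivity)
  refine tendsto_of_tendsto_of_tendsto_of_le_of_le' tendsto_const_nhds hlim
    (Eventually.of_forall fun _ => bot_le) ?_
  filter_upwards [eventually_ge_atTop 1] with n hn
  refine (measure_mono (hsub n hn)).trans ((measure_union_le _ _).trans ?_)
  rw [hnull, zero_add]
  exact measure_biUnion_finset_le _ _

/-- The variance of an average of `n` terms is at most the second moment of one term over `n`. -/
theorem integral_sq_avg_sub_le {d : ℕ} {μ : Measure Ω} [IsProbabilityMeasure μ]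
    {X : ℕ → Ω → Vec d} (hX : IsIIDDesign μ X) {f : Vec d → ℝ} (hf : Measurable f)
    (hfi : MemLp (fun ω => f (X 0 ω)) 2 μ) {n : ℕ} (hn : 1 ≤ n) :
    Integrable (fun ω => ((∑ i : Fin n, f (X i ω)) / n - ∫ ω, f (X 0 ω) ∂μ) ^ 2) μ ∧
      ∫ ω, ((∑ i : Fin n, f (X i ω)) / n - ∫ ω, f (X 0 ω) ∂μ) ^ 2 ∂μ
        ≤ (∫ ω, f (X 0 ω) ^ 2 ∂μ) / n := by
  have hn0 : (0 : ℝ) < n := by exact_mod_cast hn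
  have hid : ∀ i, IdentDistrib (fun ω => f (X i ω)) (fun ω => f (X 0 ω)) μ μ := fun i =>
    (hX.identDistrib i).comp hf
  have hLp : ∀ i, MemLp (fun ω => f (X i ω)) 2 μ := fun i => (hid i).memLp_iff.2 hfi
  set S : Ω → ℝ := fun ω => ∑ i : Fin n, f (X i ω) with hS
  have hSeq : S = ∑ i : Fin n, fun ω => f (X i ω) := by ext ω; simp [hS]
  have hSLp : MemLp S 2 μ := by rw [hSeq]; exact memLp_finsetSum' _ fun i _ => hLp i
  have hmean : ∫ ω, S ω / n ∂μ = ∫ ω, f (X 0 ω) ∂μ := by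
    rw [integral_div]
    simp only [hS]
    rw [integral_finsetSum _ fun (i : Fin n) _ => (hLp i).integrable one_le_two,
      Finset.sum_congr rfl fun (i : Fin n) _ => (hid i).integral_eq]
    simp
    field_simp
  have hdLp : MemLp (fun ω => S ω / n) 2 μ := by
    simpa [div_eq_inv_mul] using hSLp.const_mul (n : ℝ)⁻¹
  have hvar : Var[fun ω => S ω / n; μ] = (∫ ω, (S ω / n - ∫ ω, f (X 0 ω) ∂μ) ^ 2 ∂μ) := by
    rw [variance_eq_integral hdLp.aestronglyMeasurable.aemeasurable, hmean]
  constructor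
  · exact (hdLp.sub (memLp_const _)).integrable_sq
  · rw [← hvar]
    have h1 : (fun ω => S ω / n) = fun ω => (n : ℝ)⁻¹ * S ω := by ext ω; ring
    rw [h1, variance_const_mul, hSeq, IndepFun.variance_sum (fun (i : Fin n) _ => hLp i)
      (fun (i : Fin n) _ (j : Fin n) _ hij =>
        (hX.indep (fun h : (i : ℕ) = j => hij (Fin.ext h))).comp hf hf)]
    have h2 : ∀ i : Fin n, Var[fun ω => f (X i ω); μ] ≤ ∫ ω, f (X 0 ω) ^ 2 ∂μ := by
      intro i
      rw [(hid i).variance_eq]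
      exact variance_le_expectation_sq hfi.aestronglyMeasurable
    calc _ ≤ (n : ℝ)⁻¹ ^ 2 * ∑ _i : Fin n, ∫ ω, f (X 0 ω) ^ 2 ∂μ := by
          gcongr with i; exact h2 i
      _ = _ := by
        rw [Finset.sum_const, Finset.card_univ, Fintype.card_fin, nsmul_eq_mul]; field_simp

/-- The squared Frobenius distance between the empirical and the population Gram matrices of the
functions `b j`. -/
noncomputable def gramDist {d : ℕ} (μ : Measure Ω) (X : ℕ → Ω → Vec d) {ι : Type*} [Fintype ι]
    (b : ι → Vec d → ℝ) (n : ℕ) (ω : Ω) : ℝ :=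
  ∑ j, ∑ k, ((∑ i : Fin n, b j (X i ω) * b k (X i ω)) / n
    - ∫ ω, b j (X 0 ω) * b k (X 0 ω) ∂μ) ^ 2

/-- Empirical Gram matrices are close to the population Gram matrix at the parametric rate,
whatever their size: only the pointwise bound on `∑ bⱼ²` matters. -/
theorem measure_lt_gramDist_le {d : ℕ} {μ : Measure Ω} [IsProbabilityMeasure μ]
    {X : ℕ → Ω → Vec d} (hX : IsIIDDesign μ X) {ι : Type*} [Fintype ι] {b : ι → Vec d → ℝ}
    (hb : ∀ j, Measurable (b j)) {B : ℝ} (hB : ∀ᵐ ω ∂μ, ∑ j, b j (X 0 ω) ^ 2 ≤ B)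
    {n : ℕ} (hn : 1 ≤ n) {ε : ℝ} (hε : 0 < ε) :
    μ {ω | ε < gramDist μ X b n ω} ≤ ENNReal.ofReal (B ^ 2 / (n * ε)) := by
  have hn0 : (0 : ℝ) < n := by exact_mod_cast hn
  have hbB : ∀ j, ∀ᵐ ω ∂μ, b j (X 0 ω) ^ 2 ≤ B := fun j => by
    filter_upwards [hB] with ω hω
    exact (Finset.single_le_sum (f := fun j => b j (X 0 ω) ^ 2) (fun j _ => sq_nonneg _)
      (Finset.mem_univ j)).trans hω
  have hLp : ∀ j k, MemLp (fun ω => b j (X 0 ω) * b k (X 0 ω)) 2 μ := by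
    intro j k
    refine MemLp.of_bound (((hb j).comp (hX.measurable 0)).mul
      ((hb k).comp (hX.measurable 0))).aestronglyMeasurable B ?_
    filter_upwards [hbB j, hbB k] with ω h1 h2
    rw [Real.norm_eq_abs, abs_le]
    constructor <;> nlinarith [sq_nonneg (b j (X 0 ω) + b k (X 0 ω)),
      sq_nonneg (b j (X 0 ω) - b k (X 0 ω))]
  have hjk := fun j k => integral_sq_avg_sub_le hX (f := fun x => b j x * b k x)
    ((hb j).mul (hb k)) (hLp j k) hn
  have hint : Integrable (gramDist μ X b n) μ :=
    integrable_finsetSum _ fun j _ => integrable_finsetSum _ fun k _ => (hjk j k).1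
  have hmean : ∫ ω, gramDist μ X b n ω ∂μ ≤ B ^ 2 / n := by
    unfold gramDist
    rw [integral_finsetSum _ fun j _ => integrable_finsetSum _ fun k _ => (hjk j k).1]
    calc _ ≤ ∑ j, ∑ k, (∫ ω, (b j (X 0 ω) * b k (X 0 ω)) ^ 2 ∂μ) / n := by
          refine Finset.sum_le_sum fun j _ => ?_
          rw [integral_finsetSum _ fun k _ => (hjk j k).1]
          exact Finset.sum_le_sum fun k _ => (hjk j k).2
      _ = (∫ ω, (∑ j, b j (X 0 ω) ^ 2) ^ 2 ∂μ) / n := by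
          simp_rw [← Finset.sum_div]
          congr 1
          have : ∀ j, ∑ k, ∫ ω, (b j (X 0 ω) * b k (X 0 ω)) ^ 2 ∂μ
              = ∫ ω, ∑ k, (b j (X 0 ω) * b k (X 0 ω)) ^ 2 ∂μ := fun j =>
            (integral_finsetSum _ fun k _ => (hLp j k).integrable_sq).symm
          simp_rw [this]
          rw [← integral_finsetSum _ fun j _ => integrable_finsetSum _ fun k _ =>
            (hLp j k).integrable_sq]
          refine integral_congr_ae (Eventually.of_forall fun ω => ?_)
          simp only [sq (∑ j, b j (X 0 ω) ^ 2), Finset.sum_mul_sum, mul_pow]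
      _ ≤ B ^ 2 / n := by
          gcongr
          have h0 : ∀ᵐ ω ∂μ, ‖(∑ j, b j (X 0 ω) ^ 2) ^ 2‖ ≤ B ^ 2 := by
            filter_upwards [hB] with ω hω
            have : 0 ≤ ∑ j, b j (X 0 ω) ^ 2 := Finset.sum_nonneg fun j _ => sq_nonneg _
            rw [Real.norm_eq_abs, abs_of_nonneg (sq_nonneg _)]
            gcongr
          have := norm_integral_le_of_norm_le_const h0
          simp only [probReal_univ, mul_one] at this
          exact (le_abs_self _).trans this
  have hnn : 0 ≤ᵐ[μ] gramDist μ X b n := Eventually.of_forall fun ω =>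
    Finset.sum_nonneg fun j _ => Finset.sum_nonneg fun k _ => sq_nonneg _
  have hM := mul_meas_ge_le_integral_of_nonneg hnn hint ε
  rw [measureReal_def] at hM
  have h1 : (μ {ω | ε ≤ gramDist μ X b n ω}).toReal ≤ B ^ 2 / (n * ε) := by
    rw [← div_div, le_div_iff₀ hε, mul_comm]
    exact hM.trans hmean
  refine (measure_mono (t := {ω | ε ≤ gramDist μ X b n ω}) fun ω (hω : ε < _) => hω.le).trans
    ((ENNReal.le_ofReal_iff_toReal_le (measure_ne_top _ _) (by positivity)).2 h1)

/-- The distance of the Gram matrices bounds the difference of the empirical and the population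
second moment of every linear combination of the functions `b j`. -/
theorem abs_avg_sq_sub_le {d : ℕ} {μ : Measure Ω} {X : ℕ → Ω → Vec d} {ι : Type*} [Fintype ι]
    {b : ι → Vec d → ℝ} (hint : ∀ j k, Integrable (fun ω => b j (X 0 ω) * b k (X 0 ω)) μ)
    (n : ℕ) (ω : Ω) (c : ι → ℝ) :
    |(∑ i : Fin n, (∑ j, c j * b j (X i ω)) ^ 2) / n - ∫ ω, (∑ j, c j * b j (X 0 ω)) ^ 2 ∂μ|
      ≤ Real.sqrt (gramDist μ X b n ω) * ∑ j, c j ^ 2 := by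
  have hexp : ∀ x, (∑ j, c j * b j x) ^ 2 = ∑ j, ∑ k, (c j * c k) * (b j x * b k x) := by
    intro x
    rw [sq, Finset.sum_mul_sum]
    exact Finset.sum_congr rfl fun j _ => Finset.sum_congr rfl fun k _ => by ring
  have h1 : (∑ i : Fin n, (∑ j, c j * b j (X i ω)) ^ 2) / n
      - ∫ ω, (∑ j, c j * b j (X 0 ω)) ^ 2 ∂μ
      = ∑ j, ∑ k, (c j * c k) * ((∑ i : Fin n, b j (X i ω) * b k (X i ω)) / n
        - ∫ ω, b j (X 0 ω) * b k (X 0 ω) ∂μ) := by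
    simp_rw [hexp]
    rw [integral_finsetSum _ fun j _ => integrable_finsetSum _ fun k _ =>
      (hint j k).const_mul _]
    simp_rw [integral_finsetSum _ fun k _ => (hint _ k).const_mul _, integral_const_mul]
    rw [Finset.sum_comm, Finset.sum_div, ← Finset.sum_sub_distrib]
    refine Finset.sum_congr rfl fun j _ => ?_
    rw [Finset.sum_comm, Finset.sum_div, ← Finset.sum_sub_distrib]
    refine Finset.sum_congr rfl fun k _ => ?_
    rw [← Finset.mul_sum, mul_sub, mul_div_assoc]
  rw [h1]
  apply abs_le_of_sq_le_sq _ (mul_nonneg (Real.sqrt_nonneg _)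
    (Finset.sum_nonneg fun j _ => sq_nonneg _))
  have hg : 0 ≤ gramDist μ X b n ω :=
    Finset.sum_nonneg fun j _ => Finset.sum_nonneg fun k _ => sq_nonneg _
  rw [mul_pow, Real.sq_sqrt hg]
  rw [← Finset.sum_product', mul_comm]
  refine (Finset.sum_mul_sq_le_sq_mul_sq _ _ _).trans (le_of_eq ?_)
  have hc : (∑ j, c j ^ 2) ^ 2 = ∑ j, ∑ k, c j ^ 2 * c k ^ 2 := by rw [sq, Finset.sum_mul_sum]
  rw [Finset.sum_product, Finset.sum_product, gramDist, hc]
  simp only [mul_pow]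

end ConvexSIM

/-! ### Identifiability of the direction -/

namespace ConvexSIM

variable {Ω : Type*} [MeasurableSpace Ω]

/-- Zeros with nonzero derivative are isolated, hence countable in number. -/
theorem countable_zeros_with_deriv_ne_zero {φ φ' : ℝ → ℝ} (h : ∀ s, HasDerivAt φ (φ' s) s) :
    {s | φ s = 0 ∧ φ' s ≠ 0}.Countable := by
  set S := {s | φ s = 0 ∧ φ' s ≠ 0} with hS
  have hiso : S = {s ∈ S | 𝓝[S ∩ Ioi s] s = ⊥} := by
    ext s
    refine ⟨fun hs => ⟨hs, ?_⟩, fun hs => hs.1⟩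
    have h1 : ∀ᶠ z in 𝓝[≠] s, φ z ≠ 0 := (h s).eventually_ne hs.2
    have h2 : ∀ᶠ z in 𝓝[S ∩ Ioi s] s, φ z ≠ 0 :=
      h1.filter_mono (nhdsWithin_mono _ fun z hz => (ne_of_gt hz.2 : z ≠ s))
    have h3 : ∀ᶠ z in 𝓝[S ∩ Ioi s] s, φ z = 0 := by
      filter_upwards [self_mem_nhdsWithin] with z hz using hz.1.1
    have h4 : ∀ᶠ z in 𝓝[S ∩ Ioi s] s, False := by
      filter_upwards [h2, h3] with z hz1 hz2 using hz1 hz2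
    exact eventually_false_iff_eq_bot.1 h4
  rw [hiso]
  exact countable_setOfPred_isolated_right_within

/-- A mixed design does not charge a set that meets every line in the first coordinate direction
in countably many points. -/
theorem MixedDesign.ae_notMem {d : ℕ} [NeZero d] {μ : Measure Ω} {X : Ω → Vec d} {θ₀ : Vec d}
    (h : MixedDesign μ X θ₀) (hX : Measurable X) {A : Set (Vec d)} (hA : MeasurableSet A)
    (hline : ∀ x : Vec d, {s : ℝ | x + s • EuclideanSpace.single 0 1 ∈ A}.Countable) :
    ∀ᵐ ω ∂μ, X ω ∉ A := by
  obtain ⟨d₁, hd1, -, hac, hdisc, -⟩ := h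
  set I := {j : Fin d // (j : ℕ) < d₁}
  set J := {j : Fin d // d₁ ≤ (j : ℕ)}
  choose! S hSc hS using hdisc
  set C : Set (J → ℝ) := Set.pi univ fun j => S j.1 with hC
  have hCc : C.Countable := Set.countable_univ_pi fun j => hSc j.1 j.2
  have hXC : ∀ᵐ ω ∂μ, (fun j : J => X ω j.1) ∈ C := by
    have : ∀ᵐ ω ∂μ, ∀ j : J, X ω j.1 ∈ S j.1 := ae_all_iff.2 fun j => hS j.1 j.2
    filter_upwards [this] with ω hω j _ using hω j
  -- the vector with continuous coordinates `y` and discrete coordinates `c`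
  set glue : (I → ℝ) → (J → ℝ) → Vec d := fun y c =>
    WithLp.toLp 2 fun j => if h : (j : ℕ) < d₁ then y ⟨j, h⟩ else c ⟨j, not_lt.1 h⟩ with hglue
  have hglueX : ∀ ω, glue (fun j : I => X ω j.1) (fun j : J => X ω j.1) = X ω := by
    intro ω; ext j
    simp only [hglue]
    split_ifs <;> rfl
  have hgm : ∀ c, Measurable fun y => glue y c := by
    intro c
    refine (WithLp.measurable_toLp 2 (Fin d → ℝ)).comp (measurable_pi_lambda _ fun j => ?_)
    by_cases hj : (j : ℕ) < d₁
    · simp only [hj, dif_pos]; exact measurable_pi_apply _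
    · simp only [hj, dif_neg, not_false_eq_true]; exact measurable_const
  set e : I → ℝ := Pi.single ⟨0, by rw [Fin.val_zero]; omega⟩ 1 with he
  -- for fixed discrete coordinates, Fubini's theorem along the first coordinate direction
  have hvol : ∀ c, ∀ᵐ y ∂(volume : Measure (I → ℝ)), glue y c ∉ A := by
    intro c
    have hm : MeasurableSet {y | glue y c ∉ A} := (hgm c hA).compl
    refine ae_mem_of_ae_add_linearMap_mem (𝕜 := ℝ) ((LinearMap.id : ℝ →ₗ[ℝ] ℝ).smulRight e)
      volume volume hm fun y => ?_
    have hs : {s : ℝ | glue (y + s • e) c ∈ A}.Countable := by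
      refine (hline (glue y c)).mono fun s hs => ?_
      have h1 : glue (y + s • e) c = glue y c + s • EuclideanSpace.single 0 1 := by
        ext j
        simp only [hglue, he, PiLp.add_apply, PiLp.smul_apply, PiLp.single_apply]
        by_cases hj : (j : ℕ) < d₁
        · simp only [hj, dif_pos, Pi.add_apply, Pi.smul_apply, Pi.single_apply]
          congr 2
          by_cases hj0 : j = 0
          · subst hj0; simp
          · have : (⟨j, hj⟩ : I) ≠ ⟨0, by rw [Fin.val_zero]; omega⟩ := fun h =>
              hj0 (congrArg Subtype.val h)
            simp [hj0, this]
        · have : j ≠ 0 := by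
            rintro rfl
            apply hj
            rw [Fin.val_zero]; omega
          simp [hj, this]
      show glue y c + s • EuclideanSpace.single 0 1 ∈ A
      rw [← h1]; exact hs
    have h0 := hs.measure_zero volume
    refine measure_mono_null (fun s hs => ?_) h0
    exact not_not.1 hs
  have hmap : ∀ c, ∀ᵐ ω ∂μ, glue (fun j : I => X ω j.1) c ∉ A := by
    intro c
    have hm : Measurable fun ω (j : I) => X ω j.1 := by fun_prop
    have := hac.ae_le (hvol c)
    exact ae_of_ae_map hm.aemeasurable this
  -- the discrete coordinates take countably many values
  have hall : ∀ᵐ ω ∂μ, ∀ c ∈ C, glue (fun j : I => X ω j.1) c ∉ A :=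
    (ae_ball_iff hCc).2 fun c _ => hmap c
  filter_upwards [hall, hXC] with ω h1 h2
  have := h1 _ h2
  rwa [hglueX] at this

/-- Under nondegeneracy the second coordinate is not a function of the index, even on part of the
range of the index. -/
theorem NondegenerateGivenIndex.ae_notMem {d : ℕ} {μ : Measure Ω} [IsProbabilityMeasure μ]
    {X : Ω → Vec d} {θ₀ : Vec d} (h : NondegenerateGivenIndex μ X θ₀) (hX : Measurable X)
    {v : Vec d} (hv : v ∉ Submodule.span ℝ {θ₀}) {G : Set (ℝ × ℝ)} (hG : MeasurableSet G)
    (hXG : ∀ᵐ ω ∂μ, ((inner ℝ θ₀ (X ω) : ℝ), (inner ℝ v (X ω) : ℝ)) ∈ G) {U : Set ℝ}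
    (hsec : ∀ u ∈ U, {t | (u, t) ∈ G}.Subsingleton) :
    ∀ᵐ ω ∂μ, inner ℝ θ₀ (X ω) ∉ U := by
  have hm0 : Measurable fun ω => (inner ℝ θ₀ (X ω) : ℝ) := by fun_prop
  have hmv : Measurable fun ω => (inner ℝ v (X ω) : ℝ) := by fun_prop
  have h1 : ∀ᵐ z ∂(μ.map fun ω => ((inner ℝ θ₀ (X ω) : ℝ), (inner ℝ v (X ω) : ℝ))), z ∈ G :=
    (ae_map_iff (hm0.prodMk hmv).aemeasurable hG).2 hXG
  rw [← compProd_map_condDistrib hmv.aemeasurable] at h1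
  have h2 := Measure.ae_ae_of_ae_compProd h1
  refine ae_of_ae_map (p := fun u => u ∉ U) hm0.aemeasurable ?_
  filter_upwards [h2, h v hv] with u hu1 hu2 huU
  set κ := condDistrib (fun ω => (inner ℝ v (X ω) : ℝ)) (fun ω => (inner ℝ θ₀ (X ω) : ℝ)) μ u
    with hκ
  obtain ⟨t, ht⟩ := hu1.exists
  apply hu2 t
  have h3 : ∀ᵐ s ∂κ, s = t := by
    filter_upwards [hu1] with s hs using hsec u huU hs ht
  calc κ = κ.map id := Measure.map_id.symm
    _ = κ.map (fun _ => t) := Measure.map_congr h3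
    _ = Measure.dirac t := by simp

/-- Identifiability of the direction. Equality of the two regression functions forces equality of
their derivatives in the first coordinate almost everywhere; a value and a nonzero slope determine
a point on the graph of a convex function, so that `θᵀX` would be a function of `θ₀ᵀX`. -/
theorem eq_direction_of_ae_eq {d : ℕ} [NeZero d] {μ : Measure Ω} [IsProbabilityMeasure μ]
    {X : Ω → Vec d} {θ₀ θ : Vec d} (hX : Measurable X) (hdesign : MixedDesign μ X θ₀)
    (hnd : NondegenerateGivenIndex μ X θ₀) (hθ₀ : ‖θ₀‖ = 1) (hθ₀_pos : 0 < θ₀ 0)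
    (hθ : θ ∈ ParamSpace d) {m p m₀ p₀ : ℝ → ℝ} (hm : ∀ t, HasDerivAt m (p t) t)
    (hpc : Continuous p) (hpm : Monotone p) (hm₀ : ∀ t, HasDerivAt m₀ (p₀ t) t)
    (hp₀c : Continuous p₀) (hne : ¬ ∀ᵐ ω ∂μ, p₀ (inner ℝ θ₀ (X ω)) = 0)
    (heq : ∀ᵐ ω ∂μ, m (inner ℝ θ (X ω)) = m₀ (inner ℝ θ₀ (X ω))) : θ = θ₀ := by
  have hmc : Continuous m := continuous_iff_continuousAt.2 fun t => (hm t).continuousAt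
  have hm₀c : Continuous m₀ := continuous_iff_continuousAt.2 fun t => (hm₀ t).continuousAt
  -- the points where the two functions agree but their derivatives in the first coordinate differ
  set A : Set (Vec d) := {x | m (inner ℝ θ x) - m₀ (inner ℝ θ₀ x) = 0 ∧
    p (inner ℝ θ x) * θ 0 - p₀ (inner ℝ θ₀ x) * θ₀ 0 ≠ 0} with hA
  have hAm : MeasurableSet A := by
    refine MeasurableSet.inter ?_ (MeasurableSet.compl ?_)
    · exact (isClosed_eq (by fun_prop) continuous_const).measurableSet
    · exact (isClosed_eq (f := fun x : Vec d => p (inner ℝ θ x) * θ 0 - p₀ (inner ℝ θ₀ x) * θ₀ 0)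
        (by fun_prop) continuous_const).measurableSet
  have hline : ∀ x : Vec d, {s : ℝ | x + s • EuclideanSpace.single 0 1 ∈ A}.Countable := by
    intro x
    have hinner : ∀ (η : Vec d) (s : ℝ), inner ℝ η (x + s • EuclideanSpace.single 0 1)
        = inner ℝ η x + s * η 0 := by
      intro η s
      rw [inner_add_right, inner_smul_right, EuclideanSpace.inner_single_right]
      simp
    have hlin : ∀ (η : Vec d) (s : ℝ),
        HasDerivAt (fun s => (inner ℝ η x : ℝ) + s * η 0) (η 0) s := by
      intro η s
      simpa using ((hasDerivAt_id s).mul_const (η 0)).const_add (inner ℝ η x : ℝ)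
    have := countable_zeros_with_deriv_ne_zero
      (φ := fun s => m (inner ℝ θ x + s * θ 0) - m₀ (inner ℝ θ₀ x + s * θ₀ 0))
      (φ' := fun s => p (inner ℝ θ x + s * θ 0) * θ 0 - p₀ (inner ℝ θ₀ x + s * θ₀ 0) * θ₀ 0)
      fun s => ((hm _).comp s (hlin θ s)).sub ((hm₀ _).comp s (hlin θ₀ s))
    convert this using 1
    ext s
    simp only [hA, mem_ofPred_eq, hinner]
  have hslope : ∀ᵐ ω ∂μ, p (inner ℝ θ (X ω)) * θ 0 = p₀ (inner ℝ θ₀ (X ω)) * θ₀ 0 := by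
    filter_upwards [hdesign.ae_notMem hX hAm hline, heq] with ω h1 h2
    by_contra hcon
    exact h1 ⟨sub_eq_zero.2 h2, sub_ne_zero.2 hcon⟩
  have hspan : θ ∈ Submodule.span ℝ {θ₀} := by
    by_contra hv
    apply hne
    set G : Set (ℝ × ℝ) := {z | m z.2 = m₀ z.1 ∧ p z.2 * θ 0 = p₀ z.1 * θ₀ 0} with hG
    have hGm : MeasurableSet G := by
      refine MeasurableSet.inter ?_ ?_
      · exact (isClosed_eq (f := fun z : ℝ × ℝ => m z.2) (by fun_prop) (by fun_prop)).measurableSet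
      · exact (isClosed_eq (f := fun z : ℝ × ℝ => p z.2 * θ 0) (by fun_prop)
          (by fun_prop)).measurableSet
    -- The increasing function `p` would take the same nonzero value at two points `t < t'` with
    -- `m t = m t'`; by the mean value theorem and monotonicity that value is zero.
    have key : ∀ u t t' : ℝ, p₀ u ≠ 0 → t < t' → (u, t) ∈ G → (u, t') ∈ G → False := by
      rintro u t t' hu htt ⟨h1, h2⟩ ⟨h3, h4⟩
      simp only at h1 h2 h3 h4
      have hθ0 : θ 0 ≠ 0 := by
        intro h0
        rw [h0, mul_zero] at h2
        exact (mul_ne_zero hu hθ₀_pos.ne') h2.symm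
      have hpp : p t = p t' := mul_right_cancel₀ hθ0 (h2.trans h4.symm)
      obtain ⟨s, hs, hs'⟩ := exists_hasDerivAt_eq_slope m p htt hmc.continuousOn
        fun x _ => hm x
      have h5 : p s = 0 := by rw [hs', h3, h1, sub_self, zero_div]
      have h6 : p t = 0 := by
        have := hpm hs.1.le; have := hpm hs.2.le
        linarith
      rw [h6, zero_mul] at h2
      exact (mul_ne_zero hu hθ₀_pos.ne') h2.symm
    have := hnd.ae_notMem hX hv hGm (U := {u | p₀ u ≠ 0})
      (by filter_upwards [heq, hslope] with ω h1 h2 using ⟨h1, h2⟩) (by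
        intro u hu t ht t' ht'
        rcases lt_trichotomy t t' with hlt | heq | hlt
        · exact (key u t t' hu hlt ht ht').elim
        · exact heq
        · exact (key u t' t hu hlt ht' ht).elim)
    filter_upwards [this] with ω hω
    by_contra hcon
    exact hω hcon
  -- a multiple of `θ₀` with norm one and nonnegative first coordinate is `θ₀`
  obtain ⟨a, rfl⟩ := Submodule.mem_span_singleton.1 hspan
  have h1 : |a| = 1 := by
    have := hθ.1
    rwa [norm_smul, hθ₀, mul_one] at this
  have h2 : 0 ≤ a := by
    have h3 := hθ.2
    simp only [PiLp.smul_apply, smul_eq_mul] at h3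
    exact nonneg_of_mul_nonneg_left h3 hθ₀_pos
  rw [abs_of_nonneg h2] at h1
  rw [h1, one_smul]

/-- The functions of the index and the functions `vᵀX p₀(θ₀ᵀX)`, `v ⟂ θ₀`, span a positive angle
in `L²`: the component orthogonal to the functions of the index is injective in `v`, hence bounded
below because `v` ranges over a finite-dimensional space. -/
theorem exists_angle_bound {Ω : Type*} [mΩ : MeasurableSpace Ω] {d : ℕ} {μ : Measure Ω}
    [IsProbabilityMeasure μ] {X : Ω → Vec d} {θ₀ : Vec d} (hX : Measurable X) (hnd : NondegenerateGivenIndex μ X θ₀)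
    {T : ℝ} (hT : ∀ᵐ ω ∂μ, ‖X ω‖ ≤ T) {p₀ : ℝ → ℝ} (hp₀c : Continuous p₀) {L : ℝ}
    (hL : ∀ᵐ ω ∂μ, |p₀ (inner ℝ θ₀ (X ω))| ≤ L)
    (hne : ¬ ∀ᵐ ω ∂μ, p₀ (inner ℝ θ₀ (X ω)) = 0) :
    ∃ c > 0, ∀ v : Vec d, inner ℝ θ₀ v = 0 → ∀ w : ℝ → ℝ, Measurable w →
      MemLp (fun ω => w (inner ℝ θ₀ (X ω))) 2 μ →
      c * ‖v‖ ^ 2 ≤ ∫ ω, (w (inner ℝ θ₀ (X ω)) + inner ℝ v (X ω) * p₀ (inner ℝ θ₀ (X ω))) ^ 2 ∂μ := by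
  set Z : Ω → ℝ := fun ω => inner ℝ θ₀ (X ω) with hZ
  have hZm : Measurable Z := by fun_prop
  set f : Vec d → Ω → ℝ := fun v ω => inner ℝ v (X ω) * p₀ (Z ω) with hf
  have hfLp : ∀ v, MemLp (f v) 2 μ := by
    intro v
    refine MemLp.of_bound (Measurable.aestronglyMeasurable (by fun_prop)) (‖v‖ * T * L) ?_
    filter_upwards [hT, hL] with ω h1 h2
    rw [hf, norm_mul, Real.norm_eq_abs, Real.norm_eq_abs]
    have h3 : |(inner ℝ v (X ω) : ℝ)| ≤ ‖v‖ * T :=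
      (abs_real_inner_le_norm _ _).trans (by gcongr)
    exact mul_le_mul h3 h2 (abs_nonneg _) ((abs_nonneg _).trans h3)
  have hfact : Fact (MeasurableSpace.comap Z inferInstance ≤ mΩ) := ⟨hZm.comap_le⟩
  -- `M` is the closed space of square integrable functions of the index; `Q v` is the component of
  -- `vᵀX p₀(θ₀ᵀX)` orthogonal to it
  set M := lpMeas ℝ ℝ (MeasurableSpace.comap Z inferInstance) 2 μ with hM
  set Tm : Vec d →ₗ[ℝ] Lp ℝ 2 μ :=
    { toFun := fun v => (hfLp v).toLp
      map_add' := by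
        intro v w
        rw [← MemLp.toLp_add]
        refine MemLp.toLp_congr _ _ (Eventually.of_forall fun ω => ?_)
        simp only [hf, inner_add_left, Pi.add_apply]; ring
      map_smul' := by
        intro a v
        rw [RingHom.id_apply, ← MemLp.toLp_const_smul]
        refine MemLp.toLp_congr _ _ (Eventually.of_forall fun ω => ?_)
        simp only [hf, real_inner_smul_left, Pi.smul_apply, smul_eq_mul]; ring } with hTm
  set Q : (Submodule.span ℝ {θ₀})ᗮ →ₗ[ℝ] Lp ℝ 2 μ :=
    (Mᗮ.starProjection : Lp ℝ 2 μ →ₗ[ℝ] Lp ℝ 2 μ) ∘ₗ Tm ∘ₗ Submodule.subtype _ with hQ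
  -- if that component vanishes, then `vᵀX` is a function of the index wherever `p₀ ≠ 0`
  have hker : LinearMap.ker Q = ⊥ := by
    rw [LinearMap.ker_eq_bot']
    intro v hv
    have h1 : Mᗮ.starProjection (Tm v) = 0 := hv
    have h2 : Tm (v : Vec d) ∈ M := by
      rw [← Submodule.orthogonal_orthogonal M]
      exact (Submodule.starProjection_apply_eq_zero_iff _).1 h1
    have h3 : AEStronglyMeasurable[MeasurableSpace.comap Z inferInstance] (Tm (v : Vec d) : Ω → ℝ) μ :=
      mem_lpMeas_iff_aestronglyMeasurable.1 h2
    obtain ⟨g, hg, hfg⟩ := h3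
    obtain ⟨ψ, hψ, rfl⟩ := hg.exists_eq_measurable_comp
    by_contra hv0
    apply hne
    have hvspan : (v : Vec d) ∉ Submodule.span ℝ {θ₀} := by
      intro hmem
      apply hv0
      have := Submodule.inner_right_of_mem_orthogonal hmem v.2
      rw [inner_self_eq_zero] at this
      exact Subtype.ext this
    have hGm : MeasurableSet {z : ℝ × ℝ | z.2 * p₀ z.1 = ψ z.1} :=
      measurableSet_eq_fun (by fun_prop) (hψ.measurable.comp measurable_fst)
    have := hnd.ae_notMem hX hvspan hGm (U := {u | p₀ u ≠ 0}) ?_ ?_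
    · filter_upwards [this] with ω hω
      by_contra hcon
      exact hω hcon
    · filter_upwards [hfg, (hfLp (v : Vec d)).coeFn_toLp] with ω h4 h5
      exact h5.symm.trans h4
    · intro u hu t ht t' ht'
      simp only [mem_ofPred_eq] at ht ht' hu
      exact mul_right_cancel₀ hu (ht.trans ht'.symm)
  obtain ⟨K, hK0, hK⟩ := Q.exists_antilipschitzWith hker
  refine ⟨1 / (K : ℝ) ^ 2, by positivity, fun v hv w hw hwLp => ?_⟩
  have hvmem : v ∈ (Submodule.span ℝ {θ₀})ᗮ := by
    rw [Submodule.mem_orthogonal_singleton_iff_inner_right]; exact hv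
  have h1 : ‖v‖ ≤ K * ‖Q ⟨v, hvmem⟩‖ := by
    have := hK.le_mul_dist ⟨v, hvmem⟩ 0
    simpa using this
  have hwM : hwLp.toLp ∈ M := by
    rw [mem_lpMeas_iff_aestronglyMeasurable]
    refine AEStronglyMeasurable.congr ?_ hwLp.coeFn_toLp.symm
    have : Measurable[MeasurableSpace.comap Z inferInstance] Z := comap_measurable Z
    exact (hw.comp this).aestronglyMeasurable
  have h2 : Q ⟨v, hvmem⟩ = Mᗮ.starProjection (hwLp.toLp + Tm v) := by
    rw [map_add]
    have : Mᗮ.starProjection (hwLp.toLp) = 0 := by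
      rw [Submodule.starProjection_apply_eq_zero_iff]
      exact Submodule.le_orthogonal_orthogonal M hwM
    rw [this, zero_add]
    rfl
  have h3 : ‖Q ⟨v, hvmem⟩‖ ≤ ‖hwLp.toLp + Tm v‖ := by
    rw [h2]; exact Submodule.norm_starProjection_apply_le _ _
  have h4 : ‖hwLp.toLp + Tm v‖ ^ 2 = ∫ ω, (w (Z ω) + f v ω) ^ 2 ∂μ := by
    rw [← real_inner_self_eq_norm_sq, L2.inner_def]
    refine integral_congr_ae ?_
    have h5 : (hwLp.toLp + Tm v : Lp ℝ 2 μ) = (hwLp.add (hfLp v)).toLp := by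
      exact (MemLp.toLp_add hwLp (hfLp v)).symm
    rw [h5]
    filter_upwards [(hwLp.add (hfLp v)).coeFn_toLp] with ω hω
    rw [hω]
    simp only [Pi.add_apply, real_inner_self_eq_norm_sq, Real.norm_eq_abs, sq_abs, hZ]
  rw [← h4, one_div, inv_mul_le_iff₀ (by positivity), ← mul_pow]
  gcongr
  exact h1.trans (by gcongr)

end ConvexSIM

/-! ### Interpolation and cells -/

namespace ConvexSIM

theorem IsEnergyLink.sub {m₁ p₁ m₂ p₂ : ℝ → ℝ} {ν₁ ν₂ : Measure ℝ} (h₁ : IsEnergyLink m₁ p₁ ν₁)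
    (h₂ : IsEnergyLink m₂ p₂ ν₂) :
    IsEnergyLink (fun t => m₁ t - m₂ t) (fun t => p₁ t - p₂ t)
      ((2 : ℝ≥0) • ν₁ + (2 : ℝ≥0) • ν₂) := by
  have := h₁.finite
  have := h₂.finite
  refine ⟨inferInstance, fun t => (h₁.hasDerivAt t).sub (h₂.hasDerivAt t), fun s t hst => ?_⟩
  rw [measureReal_add_apply, measureReal_nnreal_smul_apply, measureReal_nnreal_smul_apply]
  have e1 := h₁.sq_sub_le s t hst
  have e2 := h₂.sq_sub_le s t hst
  simp only [NNReal.coe_ofNat]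
  nlinarith [sq_nonneg ((p₁ t - p₁ s) + (p₂ t - p₂ s))]

theorem IsEnergyLink.sub_measureReal_univ {m₁ p₁ m₂ p₂ : ℝ → ℝ} {ν₁ ν₂ : Measure ℝ}
    (h₁ : IsEnergyLink m₁ p₁ ν₁) (h₂ : IsEnergyLink m₂ p₂ ν₂) :
    ((2 : ℝ≥0) • ν₁ + (2 : ℝ≥0) • ν₂).real univ = 2 * ν₁.real univ + 2 * ν₂.real univ := by
  have := h₁.finite
  have := h₂.finite
  rw [measureReal_add_apply, measureReal_nnreal_smul_apply, measureReal_nnreal_smul_apply]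
  simp

/-- The derivative of a link of finite energy is `1/2`-Hölder. -/
theorem IsEnergyLink.abs_sub_le {m p : ℝ → ℝ} {ν : Measure ℝ} (h : IsEnergyLink m p ν) {A : ℝ}
    (hA : ν.real univ ≤ A) (s t : ℝ) : |p t - p s| ≤ Real.sqrt (A * |t - s|) := by
  have := h.finite
  apply Real.abs_le_sqrt
  have key : ∀ s t, s ≤ t → (p t - p s) ^ 2 ≤ A * |t - s| := by
    intro s t hst
    refine (h.sq_sub_le s t hst).trans ?_
    rw [abs_of_nonneg (sub_nonneg.2 hst), mul_comm]
    exact mul_le_mul_of_nonneg_right ((measureReal_mono (subset_univ _)).trans hA)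
      (sub_nonneg.2 hst)
  rcases le_total s t with hst | hst
  · exact key s t hst
  · rw [abs_sub_comm, ← neg_sub (p s), neg_sq]
    exact key t s hst

theorem IsEnergyLink.continuous_deriv {m p : ℝ → ℝ} {ν : Measure ℝ} (h : IsEnergyLink m p ν) :
    Continuous p := by
  rw [continuous_iff_continuousAt]
  intro t
  have h1 : Tendsto (fun u => Real.sqrt (ν.real univ * |u - t|)) (𝓝 t) (𝓝 0) := by
    have : Continuous fun u => Real.sqrt (ν.real univ * |u - t|) := by fun_prop
    simpa using this.tendsto t
  rw [ContinuousAt, tendsto_iff_norm_sub_tendsto_zero]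
  exact squeeze_zero (fun u => norm_nonneg _) (fun u => h.abs_sub_le le_rfl t u) h1

theorem IsEnergyLink.continuous {m p : ℝ → ℝ} {ν : Measure ℝ} (h : IsEnergyLink m p ν) :
    Continuous m := continuous_iff_continuousAt.2 fun t => (h.hasDerivAt t).continuousAt

/-- A function is somewhere at most as large as its mean square. -/
theorem exists_sq_le_of_integral {h : ℝ → ℝ} (hc : Continuous h) {a b I : ℝ} (hab : a < b)
    (hI : ∫ t in a..b, h t ^ 2 ≤ I) : ∃ x ∈ Icc a b, (b - a) * h x ^ 2 ≤ I := by
  obtain ⟨x, hx, hmin⟩ := isCompact_Icc.exists_isMinOn (nonempty_Icc.2 hab.le)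
    (f := fun t => h t ^ 2) (by fun_prop)
  refine ⟨x, hx, le_trans ?_ hI⟩
  have : ∫ _t in a..b, h x ^ 2 ≤ ∫ t in a..b, h t ^ 2 :=
    intervalIntegral.integral_mono_on hab.le (by simp) (by apply Continuous.intervalIntegrable; fun_prop)
      fun t ht => hmin ht
  simpa using this

/-- Interpolation on one short interval: the derivative is a difference quotient up to the
roughness on the interval. -/
theorem IsEnergyLink.sq_deriv_le {h q : ℝ → ℝ} {ν : Measure ℝ} (hh : IsEnergyLink h q ν) {a δ : ℝ}
    (hδ : 0 < δ) {s : ℝ} (hs : s ∈ Icc a (a + δ)) :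
    q s ^ 2 ≤ 216 / δ ^ 3 * (∫ t in a..(a + δ), h t ^ 2) + 2 * δ * ν.real (Ioc a (a + δ)) := by
  have := hh.finite
  have hc := hh.continuous
  have hii : ∀ u v, IntervalIntegrable (fun t => h t ^ 2) volume u v := fun u v => by
    apply Continuous.intervalIntegrable; fun_prop
  set I := ∫ t in a..(a + δ), h t ^ 2 with hI
  set V := ν.real (Ioc a (a + δ)) with hV
  have hmono : ∀ u v, a ≤ u → u ≤ v → v ≤ a + δ → ∫ t in u..v, h t ^ 2 ≤ I := by
    intro u v h1 h2 h3
    exact intervalIntegral.integral_mono_interval h1 h2 h3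
      (Eventually.of_forall fun t => sq_nonneg _) (hii _ _)
  -- small values in the first and in the last third of the interval give a small slope at some `z`
  obtain ⟨x, hx, hxI⟩ := exists_sq_le_of_integral hc (a := a) (b := a + δ / 3) (by linarith)
    (hmono a (a + δ / 3) le_rfl (by linarith) (by linarith))
  obtain ⟨y, hy, hyI⟩ := exists_sq_le_of_integral hc (a := a + 2 * δ / 3) (b := a + δ)
    (by linarith) (hmono (a + 2 * δ / 3) (a + δ) (by linarith) (by linarith) le_rfl)
  have hxy : δ / 3 ≤ y - x := by linarith [hx.2, hy.1]
  obtain ⟨z, hz, hz'⟩ := exists_hasDerivAt_eq_slope h q (show x < y by linarith)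
    hc.continuousOn fun t _ => hh.hasDerivAt t
  have hzI : z ∈ Icc a (a + δ) := ⟨by linarith [hx.1, hz.1], by linarith [hy.2, hz.2]⟩
  have hq : q z ^ 2 ≤ 108 / δ ^ 3 * I := by
    have h1 : q z * (y - x) = h y - h x := by rw [hz']; field_simp [show y - x ≠ 0 by linarith]
    have h2 : (q z) ^ 2 * (δ / 3) ^ 2 ≤ 12 * I / δ := by
      calc (q z) ^ 2 * (δ / 3) ^ 2 ≤ (q z) ^ 2 * (y - x) ^ 2 := by gcongr
        _ = (h y - h x) ^ 2 := by rw [← mul_pow, h1]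
        _ ≤ 2 * h y ^ 2 + 2 * h x ^ 2 := by nlinarith [sq_nonneg (h y + h x)]
        _ ≤ 12 * I / δ := by
          rw [le_div_iff₀ hδ]; nlinarith
    have h3 : 108 / δ ^ 3 * I = (12 * I / δ) / (δ / 3) ^ 2 := by field_simp; ring
    rw [h3, le_div_iff₀ (by positivity)]
    exact h2
  have hdiff : (q s - q z) ^ 2 ≤ δ * V := by
    have key : ∀ u v, u ∈ Icc a (a + δ) → v ∈ Icc a (a + δ) → u ≤ v →
        (q v - q u) ^ 2 ≤ δ * V := by
      intro u v hu hv huv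
      refine (hh.sq_sub_le u v huv).trans (mul_le_mul ?_ ?_ measureReal_nonneg hδ.le)
      · linarith [hu.1, hv.2]
      · exact measureReal_mono (Ioc_subset_Ioc hu.1 hv.2)
    rcases le_total z s with h1 | h1
    · exact key z s hzI hs h1
    · rw [← neg_sub, neg_sq]; exact key s z hs hzI h1
  have h5 : 216 / δ ^ 3 * I = 2 * (108 / δ ^ 3 * I) := by ring
  rw [h5]
  nlinarith [sq_nonneg (q z - (q s - q z))]

/-- The interpolation inequality between `h`, `h'` and the roughness of `h`, at any scale that
divides the interval. -/
theorem IsEnergyLink.integral_sq_deriv_le {h q : ℝ → ℝ} {ν : Measure ℝ} (hh : IsEnergyLink h q ν)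
    {a δ : ℝ} (hδ : 0 < δ) (N : ℕ) :
    ∫ t in a..(a + N * δ), q t ^ 2
      ≤ 216 / δ ^ 2 * (∫ t in a..(a + N * δ), h t ^ 2) + 2 * δ ^ 2 * ν.real univ := by
  have := hh.finite
  have hc := hh.continuous
  have hqc := hh.continuous_deriv
  have hcell : ∀ b, ∫ t in b..(b + δ), q t ^ 2
      ≤ 216 / δ ^ 2 * (∫ t in b..(b + δ), h t ^ 2) + 2 * δ ^ 2 * ν.real (Ioc b (b + δ)) := by
    intro b
    have := intervalIntegral.integral_mono_on (show b ≤ b + δ by linarith)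
      (by apply Continuous.intervalIntegrable; fun_prop)
      (intervalIntegrable_const (μ := volume) (a := b) (b := b + δ))
      fun s hs => hh.sq_deriv_le hδ hs
    refine this.trans (le_of_eq ?_)
    rw [intervalIntegral.integral_const, smul_eq_mul]
    field_simp
    ring
  have key : ∀ k : ℕ, ∫ t in a..(a + k * δ), q t ^ 2
      ≤ 216 / δ ^ 2 * (∫ t in a..(a + k * δ), h t ^ 2)
        + 2 * δ ^ 2 * ν.real (Ioc a (a + k * δ)) := by
    intro k
    induction k with
    | zero => simp
    | succ k ih =>
      have e : a + (k + 1 : ℕ) * δ = (a + k * δ) + δ := by push_cast; ring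
      rw [e, ← intervalIntegral.integral_add_adjacent_intervals (b := a + k * δ)
        (f := fun t => q t ^ 2) (by apply Continuous.intervalIntegrable; fun_prop)
        (by apply Continuous.intervalIntegrable; fun_prop),
        ← intervalIntegral.integral_add_adjacent_intervals (b := a + k * δ)
        (f := fun t => h t ^ 2) (by apply Continuous.intervalIntegrable; fun_prop)
        (by apply Continuous.intervalIntegrable; fun_prop)]
      have h1 : ν.real (Ioc a (a + k * δ + δ))
          = ν.real (Ioc a (a + k * δ)) + ν.real (Ioc (a + k * δ) (a + k * δ + δ)) := by
        rw [← measureReal_union (Set.disjoint_left.2 fun u hu hu' => absurd hu.2 (not_le.2 hu'.1))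
          measurableSet_Ioc, Ioc_union_Ioc_eq_Ioc]
        · have : (0 : ℝ) ≤ k * δ := by positivity
          linarith
        · linarith
      rw [h1]
      have := hcell (a + k * δ)
      linarith
  exact (key N).trans (add_le_add le_rfl (mul_le_mul_of_nonneg_left
    (measureReal_mono (subset_univ _)) (by positivity)))

/-- The index of the cell of `t` when `[a, a + l]` is divided into `N + 1` cells of equal length;
points beyond the end are put into the last cell. -/
noncomputable def cellIndex (a l : ℝ) (N : ℕ) (t : ℝ) : Fin (N + 1) :=
  ⟨min N ⌊(t - a) * (N + 1) / l⌋₊, by omega⟩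

theorem measurable_cellIndex (a l : ℝ) (N : ℕ) : Measurable (cellIndex a l N) := by
  have h1 : Measurable fun t : ℝ => min N ⌊(t - a) * (N + 1) / l⌋₊ := by
    have : Measurable fun t : ℝ => ⌊(t - a) * (N + 1) / l⌋₊ := Nat.measurable_floor.comp (by fun_prop)
    exact measurable_const.min this
  refine measurable_to_countable' fun k => ?_
  have : cellIndex a l N ⁻¹' {k} = (fun t : ℝ => min N ⌊(t - a) * (N + 1) / l⌋₊) ⁻¹' {(k : ℕ)} := by
    ext t; simp [cellIndex, Fin.ext_iff]
  rw [this]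
  exact h1 (measurableSet_singleton _)

theorem cellIndex_eq {a l : ℝ} (hl : 0 < l) {N : ℕ} (k : Fin (N + 1)) {t : ℝ}
    (ht : t ∈ Ico (a + k * (l / (N + 1))) (a + (k + 1) * (l / (N + 1)))) :
    cellIndex a l N t = k := by
  have hN : (0 : ℝ) < N + 1 := by positivity
  have h1 : ⌊(t - a) * (N + 1) / l⌋₊ = (k : ℕ) := by
    rw [Nat.floor_eq_iff]
    · constructor
      · rw [le_div_iff₀ hl]
        have := ht.1
        have h2 : (k : ℝ) * (l / (N + 1)) ≤ t - a := by linarith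
        rw [← mul_div_assoc, div_le_iff₀ hN] at h2
        exact h2
      · rw [div_lt_iff₀ hl]
        have := ht.2
        have h2 : t - a < ((k : ℝ) + 1) * (l / (N + 1)) := by linarith
        rw [← mul_div_assoc, lt_div_iff₀ hN] at h2
        exact h2
    · have := ht.1
      have h2 : (0 : ℝ) ≤ (k : ℝ) * (l / (N + 1)) := by positivity
      have : 0 ≤ t - a := by linarith
      positivity
  apply Fin.ext
  simp only [cellIndex, h1]
  have := k.2
  omega

theorem abs_sub_cell_left_le {a l : ℝ} (hl : 0 < l) {N : ℕ} {t : ℝ} (ht : t ∈ Icc a (a + l)) :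
    (a + (cellIndex a l N t : ℕ) * (l / (N + 1))) ∈ Icc a (a + l) ∧
      |t - (a + (cellIndex a l N t : ℕ) * (l / (N + 1)))| ≤ l / (N + 1) := by
  have hN : (0 : ℝ) < N + 1 := by positivity
  have h0 : 0 ≤ (t - a) * (N + 1) / l := by
    have : 0 ≤ t - a := by linarith [ht.1]
    positivity
  set k := ⌊(t - a) * (N + 1) / l⌋₊ with hk
  have h1 : (k : ℝ) * (l / (N + 1)) ≤ t - a := by
    have := Nat.floor_le h0
    rw [le_div_iff₀ hl] at this
    rw [← mul_div_assoc, div_le_iff₀ hN]; exact this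
  have h2 : t - a < (k + 1) * (l / (N + 1)) := by
    have := Nat.lt_floor_add_one ((t - a) * (N + 1) / l)
    rw [div_lt_iff₀ hl] at this
    rw [← mul_div_assoc, lt_div_iff₀ hN]; exact this
  have hδ : 0 < l / (N + 1) := by positivity
  have hcell : ((cellIndex a l N t : ℕ) : ℝ) = min (N : ℝ) k := by simp [cellIndex, hk]
  rw [hcell]
  have h3 : ((N : ℝ) + 1) * (l / (N + 1)) = l := by field_simp
  rcases le_total (k : ℝ) N with h | h
  · rw [min_eq_right h]
    refine ⟨⟨by nlinarith [Nat.cast_nonneg (α := ℝ) k], by linarith [ht.2]⟩, ?_⟩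
    rw [abs_le]; constructor <;> linarith
  · rw [min_eq_left h]
    have h4 : (N : ℝ) * (l / (N + 1)) ≤ k * (l / (N + 1)) := by gcongr
    refine ⟨⟨by nlinarith [Nat.cast_nonneg (α := ℝ) N], by linarith [ht.2]⟩, ?_⟩
    rw [abs_le]; constructor <;> linarith [ht.2]

end ConvexSIM

/-! ### Step functions of the index plus weighted linear functions -/

namespace ConvexSIM

variable {Ω : Type*} [MeasurableSpace Ω] {d : ℕ}

/-- A step function of the index `θ₀ᵀx` on the `N + 1` cells of `[α, α + l]`, plus a linear
function of `x` times the weight `p₀(θ₀ᵀx)`. -/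
noncomputable def stepPlusLinear (α l : ℝ) (p₀ : ℝ → ℝ) (θ₀ : Vec d) (N : ℕ)
    (a : Fin (N + 1) → ℝ) (v : Vec d) (x : Vec d) : ℝ :=
  a (cellIndex α l N (inner ℝ θ₀ x)) + inner ℝ v x * p₀ (inner ℝ θ₀ x)

/-- A density bounded below gives every cell a probability of order `1 / (N + 1)`. -/
theorem le_integral_sq_step {μ : Measure Ω} [IsProbabilityMeasure μ] {Z : Ω → ℝ}
    (hZ : Measurable Z) {α l cf : ℝ} (hl : 0 < l) (hcf : 0 < cf)
    (hlow : ENNReal.ofReal cf • volume.restrict (Icc α (α + l)) ≤ μ.map Z) (N : ℕ)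
    (a : Fin (N + 1) → ℝ) :
    cf * l * ((∑ k, a k ^ 2) / (N + 1)) ≤ ∫ ω, a (cellIndex α l N (Z ω)) ^ 2 ∂μ := by
  have hN : (0 : ℝ) < N + 1 := by positivity
  have hm : Measurable fun ω => cellIndex α l N (Z ω) := (measurable_cellIndex α l N).comp hZ
  have hS : ∀ k, MeasurableSet {ω | cellIndex α l N (Z ω) = k} := fun k =>
    hm (measurableSet_singleton k)
  have hsum : ∀ ω, a (cellIndex α l N (Z ω)) ^ 2
      = ∑ k, {ω | cellIndex α l N (Z ω) = k}.indicator (fun _ => a k ^ 2) ω := by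
    intro ω
    simp [Set.indicator_apply]
  simp_rw [hsum]
  rw [integral_finsetSum _ fun k _ => (integrable_const _).indicator (hS k)]
  simp_rw [integral_indicator_const _ (hS _)]
  rw [Finset.sum_div, Finset.mul_sum]
  refine Finset.sum_le_sum fun k _ => ?_
  have hP : cf * (l / (N + 1)) ≤ μ.real {ω | cellIndex α l N (Z ω) = k} := by
    set I := Ico (α + k * (l / (N + 1))) (α + (k + 1) * (l / (N + 1))) with hI
    have h1 : (ENNReal.ofReal cf • volume.restrict (Icc α (α + l))) I ≤ μ.map Z I := hlow I
    have hsub : I ⊆ Icc α (α + l) := by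
      intro t ht
      have hk : ((k : ℕ) : ℝ) + 1 ≤ N + 1 := by exact_mod_cast k.2
      have h2 : ((k : ℝ) + 1) * (l / (N + 1)) ≤ (N + 1) * (l / (N + 1)) := by gcongr
      have h3 : ((N : ℝ) + 1) * (l / (N + 1)) = l := by field_simp
      have h4 : (0 : ℝ) ≤ k * (l / (N + 1)) := by positivity
      exact ⟨by linarith [ht.1], by linarith [ht.2]⟩
    rw [Measure.smul_apply, Measure.restrict_apply measurableSet_Ico, inter_eq_left.2 hsub,
      Real.volume_Ico, smul_eq_mul, ← ENNReal.ofReal_mul hcf.le,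
      Measure.map_apply hZ measurableSet_Ico] at h1
    have e : α + (k + 1) * (l / (N + 1)) - (α + k * (l / (N + 1))) = l / (N + 1) := by ring
    rw [e] at h1
    have h5 : Z ⁻¹' I ⊆ {ω | cellIndex α l N (Z ω) = k} := fun ω hω => cellIndex_eq hl k hω
    exact (ENNReal.ofReal_le_iff_le_toReal (measure_ne_top _ _)).1 (h1.trans (measure_mono h5))
  calc cf * l * (a k ^ 2 / (N + 1)) = (cf * (l / (N + 1))) * a k ^ 2 := by ring
    _ ≤ μ.real {ω | cellIndex α l N (Z ω) = k} * a k ^ 2 := by gcongr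
    _ = _ := by simp

/-- The population version of the local identifiability: the step part and the direction part
cannot cancel. -/
theorem exists_stepPlusLinear_bound {μ : Measure Ω} [IsProbabilityMeasure μ] {X : Ω → Vec d}
    {θ₀ : Vec d} (hX : Measurable X) (hnd : NondegenerateGivenIndex μ X θ₀) {T : ℝ}
    (hT : ∀ᵐ ω ∂μ, ‖X ω‖ ≤ T) {p₀ : ℝ → ℝ} (hp₀ : Continuous p₀) {L : ℝ}
    (hL : ∀ᵐ ω ∂μ, |p₀ (inner ℝ θ₀ (X ω))| ≤ L) (hne : ¬ ∀ᵐ ω ∂μ, p₀ (inner ℝ θ₀ (X ω)) = 0)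
    {α l cf : ℝ} (hl : 0 < l) (hcf : 0 < cf)
    (hlow : ENNReal.ofReal cf • volume.restrict (Icc α (α + l))
      ≤ μ.map fun ω => (inner ℝ θ₀ (X ω) : ℝ)) :
    ∃ c > 0, ∀ (N : ℕ) (a : Fin (N + 1) → ℝ) (v : Vec d), inner ℝ θ₀ v = 0 →
      c * ((∑ k, a k ^ 2) / (N + 1) + ∫ ω, a (cellIndex α l N (inner ℝ θ₀ (X ω))) ^ 2 ∂μ
        + ‖v‖ ^ 2) ≤ ∫ ω, stepPlusLinear α l p₀ θ₀ N a v (X ω) ^ 2 ∂μ := by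
  obtain ⟨c₁, hc₁, hang⟩ := exists_angle_bound hX hnd hT hp₀ hL hne
  set A := 2 + 2 * (T * L) ^ 2 / c₁ with hA
  have hA0 : 0 < A := by positivity
  set B := A / (cf * l) + A + 1 / c₁ with hB
  have hB0 : 0 < B := by positivity
  refine ⟨1 / B, by positivity, fun N a v hv => ?_⟩
  have hZm : Measurable fun ω => (inner ℝ θ₀ (X ω) : ℝ) := by fun_prop
  have hwm : Measurable fun t => a (cellIndex α l N t) :=
    (measurable_of_finite a).comp (measurable_cellIndex α l N)
  have hwLp : MemLp (fun ω => a (cellIndex α l N (inner ℝ θ₀ (X ω)))) 2 μ := by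
    refine MemLp.of_bound (hwm.comp hZm).aestronglyMeasurable (∑ k, |a k|) (ae_of_all _ fun ω => ?_)
    exact Finset.single_le_sum (f := fun k => |a k|) (fun k _ => abs_nonneg _) (Finset.mem_univ _)
  have hvbd : ∀ᵐ ω ∂μ, |inner ℝ v (X ω) * p₀ (inner ℝ θ₀ (X ω))| ≤ ‖v‖ * (T * L) := by
    filter_upwards [hT, hL] with ω h1 h2
    rw [abs_mul]
    have h3 := abs_real_inner_le_norm v (X ω)
    calc _ ≤ (‖v‖ * ‖X ω‖) * L := mul_le_mul h3 h2 (abs_nonneg _) (by positivity)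
      _ ≤ (‖v‖ * T) * L := by
        have := (abs_nonneg _).trans h2
        gcongr
      _ = _ := by ring
  have hvLp : MemLp (fun ω => inner ℝ v (X ω) * p₀ (inner ℝ θ₀ (X ω))) 2 μ :=
    MemLp.of_bound (by fun_prop : Measurable _).aestronglyMeasurable _ hvbd
  set J := ∫ ω, stepPlusLinear α l p₀ θ₀ N a v (X ω) ^ 2 ∂μ with hJ
  have h1 : c₁ * ‖v‖ ^ 2 ≤ J := hang v hv _ hwm hwLp
  set W := ∫ ω, a (cellIndex α l N (inner ℝ θ₀ (X ω))) ^ 2 ∂μ with hW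
  have hFLp : MemLp (fun ω => stepPlusLinear α l p₀ θ₀ N a v (X ω)) 2 μ := hwLp.add hvLp
  have h2 : W ≤ 2 * J + 2 * (‖v‖ * (T * L)) ^ 2 := by
    have : W ≤ ∫ ω, (2 * stepPlusLinear α l p₀ θ₀ N a v (X ω) ^ 2 + 2 * (‖v‖ * (T * L)) ^ 2) ∂μ := by
      refine integral_mono_ae hwLp.integrable_sq
        ((hFLp.integrable_sq.const_mul 2).add (integrable_const _)) ?_
      filter_upwards [hvbd] with ω hω
      have h3 := sq_le_sq' (neg_le_of_abs_le hω) (le_of_abs_le hω)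
      simp only [stepPlusLinear]
      nlinarith [sq_nonneg (a (cellIndex α l N (inner ℝ θ₀ (X ω)))
        + 2 * (inner ℝ v (X ω) * p₀ (inner ℝ θ₀ (X ω))))]
    rw [integral_add (hFLp.integrable_sq.const_mul 2) (integrable_const _), integral_const_mul] at this
    simpa using this
  have h3 : ‖v‖ ^ 2 ≤ 1 / c₁ * J := by
    rw [one_div, ← div_eq_inv_mul, le_div_iff₀ hc₁, mul_comm]; exact h1
  have h4 : W ≤ A * J := by
    have : (‖v‖ * (T * L)) ^ 2 ≤ (1 / c₁ * J) * (T * L) ^ 2 := by rw [mul_pow]; gcongr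
    calc W ≤ 2 * J + 2 * ((1 / c₁ * J) * (T * L) ^ 2) := by linarith
      _ = A * J := by rw [hA]; ring
  have h5 : (∑ k, a k ^ 2) / (N + 1) ≤ A / (cf * l) * J := by
    have := (le_integral_sq_step hZm hl hcf hlow N a).trans h4
    rw [div_mul_eq_mul_div, le_div_iff₀ (by positivity), mul_comm]
    exact this
  rw [one_div, ← div_eq_inv_mul, div_le_iff₀ hB0]
  calc _ ≤ A / (cf * l) * J + A * J + 1 / c₁ * J := by gcongr
    _ = J * B := by rw [hB]; ring

/-- With probability tending to one, empirical second moments dominate population second moments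
simultaneously for all step functions on `⌈n ^ (2/5)⌉ + 1` cells plus weighted linear functions. -/
theorem tendsto_measure_not_stepPlusLinear_bound {μ : Measure Ω} [IsProbabilityMeasure μ]
    {X : ℕ → Ω → Vec d} (hX : IsIIDDesign μ X) {T : ℝ} (hT : ∀ᵐ ω ∂μ, ‖X 0 ω‖ ≤ T) {θ₀ : Vec d}
    {p₀ : ℝ → ℝ} (hp₀ : Continuous p₀) {L : ℝ} (hL : ∀ᵐ ω ∂μ, |p₀ (inner ℝ θ₀ (X 0 ω))| ≤ L)
    {α l c : ℝ} (hc : 0 < c)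
    (hpop : ∀ (N : ℕ) (a : Fin (N + 1) → ℝ) (v : Vec d), inner ℝ θ₀ v = 0 →
      c * ((∑ k, a k ^ 2) / (N + 1) + ∫ ω, a (cellIndex α l N (inner ℝ θ₀ (X 0 ω))) ^ 2 ∂μ
        + ‖v‖ ^ 2) ≤ ∫ ω, stepPlusLinear α l p₀ θ₀ N a v (X 0 ω) ^ 2 ∂μ) :
    Tendsto (fun n : ℕ => μ {ω | ¬ ∀ (a : Fin (⌈(n : ℝ) ^ (2 / 5 : ℝ)⌉₊ + 1) → ℝ) (v : Vec d),
      inner ℝ θ₀ v = 0 →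
      ∫ ω', stepPlusLinear α l p₀ θ₀ _ a v (X 0 ω') ^ 2 ∂μ
        ≤ 2 * ((∑ i : Fin n, stepPlusLinear α l p₀ θ₀ _ a v (X i ω) ^ 2) / n)}) atTop (𝓝 0) := by
  set B := 1 + (T * L) ^ 2 with hB
  have hT0 : ∀ᵐ ω ∂μ, ‖X 0 ω‖ ≤ T ∧ |p₀ (inner ℝ θ₀ (X 0 ω))| ≤ L := hT.and hL
  -- the basis of step functions and weighted coordinates
  let b : ∀ N : ℕ, Fin (N + 1) ⊕ Fin d → Vec d → ℝ := fun N =>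
    Sum.elim (fun k x => if cellIndex α l N (inner ℝ θ₀ x) = k then 1 else 0)
      (fun j x => x j * p₀ (inner ℝ θ₀ x))
  have hbm : ∀ N j, Measurable (b N j) := by
    intro N j
    rcases j with k | j
    · exact Measurable.ite (((measurable_cellIndex α l N).comp (by fun_prop))
        (measurableSet_singleton k)) measurable_const measurable_const
    · have : Measurable fun x : Vec d => x j * p₀ (inner ℝ θ₀ x) := by fun_prop
      exact this
  have hbB : ∀ N, ∀ᵐ ω ∂μ, ∑ j, b N j (X 0 ω) ^ 2 ≤ B := by
    intro N
    filter_upwards [hT0] with ω ⟨h1, h2⟩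
    rw [Fintype.sum_sum_type]
    simp only [b, Sum.elim_inl, Sum.elim_inr, mul_pow, ← Finset.sum_mul, ite_pow]
    rw [← EuclideanSpace.real_norm_sq_eq]
    have h3 : ‖X 0 ω‖ ^ 2 * p₀ (inner ℝ θ₀ (X 0 ω)) ^ 2 ≤ T ^ 2 * L ^ 2 := by
      rw [← sq_abs (p₀ _)]; gcongr
    simp
    rw [hB, mul_pow]; linarith
  have hbb : ∀ N j k, Integrable (fun ω => b N j (X 0 ω) * b N k (X 0 ω)) μ := by
    intro N j k
    have hLp : ∀ j, MemLp (fun ω => b N j (X 0 ω)) 2 μ := by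
      intro j
      refine MemLp.of_bound ((hbm N j).comp (hX.measurable 0)).aestronglyMeasurable (Real.sqrt B) ?_
      filter_upwards [hbB N] with ω hω
      apply Real.abs_le_sqrt
      exact (Finset.single_le_sum (f := fun j => b N j (X 0 ω) ^ 2) (fun j _ => sq_nonneg _)
        (Finset.mem_univ j)).trans hω
    exact (hLp j).integrable_mul (hLp k)
  have hexp : ∀ N (a : Fin (N + 1) → ℝ) (v : Vec d) x,
      ∑ j, Sum.elim a v j * b N j x = stepPlusLinear α l p₀ θ₀ N a v x := by
    intro N a v x
    rw [Fintype.sum_sum_type]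
    simp only [b, Sum.elim_inl, Sum.elim_inr, ← mul_assoc, ← Finset.sum_mul, stepPlusLinear]
    congr 1
    · simp
    · congr 1
      simp [PiLp.inner_apply, mul_comm]
  have hsq : ∀ N (a : Fin (N + 1) → ℝ) (v : Vec d),
      ∑ j, Sum.elim a v j ^ 2 = ∑ k, a k ^ 2 + ‖v‖ ^ 2 := by
    intro N a v
    rw [Fintype.sum_sum_type, EuclideanSpace.real_norm_sq_eq]
    simp
  let N : ℕ → ℕ := fun n => ⌈(n : ℝ) ^ (2 / 5 : ℝ)⌉₊
  let ε : ℕ → ℝ := fun n => (c / (2 * (N n + 1))) ^ 2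
  have hsub : ∀ n : ℕ, {ω | ¬ ∀ (a : Fin (N n + 1) → ℝ) (v : Vec d), inner ℝ θ₀ v = 0 →
      ∫ ω', stepPlusLinear α l p₀ θ₀ _ a v (X 0 ω') ^ 2 ∂μ
        ≤ 2 * ((∑ i : Fin n, stepPlusLinear α l p₀ θ₀ _ a v (X i ω) ^ 2) / n)}
      ⊆ {ω | ε n < gramDist μ X (b (N n)) n ω} := by
    intro n ω hω
    by_contra hcon
    refine hω fun a v hv => ?_
    have hle : gramDist μ X (b (N n)) n ω ≤ ε n := not_lt.1 hcon
    have h1 := abs_avg_sq_sub_le (X := X) (hbb (N n)) n ω (Sum.elim a v)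
    simp only [hexp, hsq] at h1
    have h2 : Real.sqrt (gramDist μ X (b (N n)) n ω) ≤ c / (2 * (N n + 1)) :=
      Real.sqrt_le_iff.2 ⟨by positivity, hle⟩
    have hs0 : 0 ≤ ∑ k, a k ^ 2 := Finset.sum_nonneg fun k _ => sq_nonneg _
    have h3 : Real.sqrt (gramDist μ X (b (N n)) n ω) * (∑ k, a k ^ 2 + ‖v‖ ^ 2)
        ≤ (c * ((∑ k, a k ^ 2) / (N n + 1) + ‖v‖ ^ 2)) / 2 := by
      have h4 : ‖v‖ ^ 2 / (N n + 1) ≤ ‖v‖ ^ 2 := div_le_self (sq_nonneg _) (by simp)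
      calc _ ≤ c / (2 * (N n + 1)) * (∑ k, a k ^ 2 + ‖v‖ ^ 2) := by gcongr
        _ = (c * ((∑ k, a k ^ 2) / (N n + 1) + ‖v‖ ^ 2 / (N n + 1))) / 2 := by field_simp
        _ ≤ _ := by gcongr
    have h5 := hpop (N n) a v hv
    have h6 : 0 ≤ ∫ ω, a (cellIndex α l (N n) (inner ℝ θ₀ (X 0 ω))) ^ 2 ∂μ :=
      integral_nonneg fun _ => sq_nonneg _
    have h7 := neg_le_of_abs_le (h1.trans h3)
    nlinarith
  -- there are of order `n^{2/5}` cells, so that a Gram distance `ε n` of order `n^{-4/5}` is allowed,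
  -- which is above the parametric order `n⁻¹` of the squared distance
  have hlim : Tendsto (fun n : ℕ => ENNReal.ofReal (B ^ 2 * 36 / c ^ 2 * (n : ℝ) ^ (-(1 / 5) : ℝ)))
      atTop (𝓝 0) := by
    have h1 : Tendsto (fun n : ℕ => (n : ℝ) ^ (-(1 / 5) : ℝ)) atTop (𝓝 0) :=
      (tendsto_rpow_neg_atTop (by norm_num)).comp tendsto_natCast_atTop_atTop
    have h2 := (h1.const_mul (B ^ 2 * 36 / c ^ 2))
    rw [mul_zero] at h2
    simpa using ENNReal.tendsto_ofReal h2
  refine tendsto_of_tendsto_of_tendsto_of_le_of_le' tendsto_const_nhds hlim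
    (Eventually.of_forall fun _ => zero_le) ?_
  filter_upwards [eventually_ge_atTop 1] with n hn
  have hn0 : (0 : ℝ) < n := by exact_mod_cast hn
  have hε : 0 < ε n := by positivity
  refine (measure_mono (hsub n)).trans ((measure_lt_gramDist_le hX (hbm _) (hbB _) hn hε).trans ?_)
  apply ENNReal.ofReal_le_ofReal
  have hn1 : (1 : ℝ) ≤ (n : ℝ) ^ (2 / 5 : ℝ) := Real.one_le_rpow (by exact_mod_cast hn) (by norm_num)
  have hN : (N n : ℝ) + 1 ≤ 3 * (n : ℝ) ^ (2 / 5 : ℝ) := by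
    have := (Nat.ceil_lt_add_one (by positivity : (0 : ℝ) ≤ (n : ℝ) ^ (2 / 5 : ℝ))).le
    simp only [N]; linarith
  have hpow : ((n : ℝ) ^ (2 / 5 : ℝ)) ^ 2 = n * (n : ℝ) ^ (-(1 / 5) : ℝ) := by
    rw [← Real.rpow_natCast, ← Real.rpow_mul hn0.le]
    nth_rewrite 2 [← Real.rpow_one (n : ℝ)]
    rw [← Real.rpow_add hn0]; norm_num
  have hN2 : ((N n : ℝ) + 1) ^ 2 ≤ 9 * (n * (n : ℝ) ^ (-(1 / 5) : ℝ)) := by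
    rw [← hpow]
    calc ((N n : ℝ) + 1) ^ 2 ≤ (3 * (n : ℝ) ^ (2 / 5 : ℝ)) ^ 2 := by gcongr
      _ = _ := by ring
  have e : B ^ 2 / (n * ε n) = B ^ 2 * 4 / (c ^ 2 * n) * ((N n : ℝ) + 1) ^ 2 := by
    simp only [ε]; field_simp; try ring
  rw [e]
  calc _ ≤ B ^ 2 * 4 / (c ^ 2 * n) * (9 * (n * (n : ℝ) ^ (-(1 / 5) : ℝ))) := by gcongr
    _ = _ := by field_simp; try ring

end ConvexSIM

/-! ### Comparison of the norms near the truth -/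

namespace ConvexSIM

variable {Ω : Type*} [MeasurableSpace Ω] {d : ℕ}

/-- The mean value inequality for `m` minus a linear function of slope `c`. -/
theorem abs_sub_le_of_deriv_sub_le {m p : ℝ → ℝ} (h : ∀ t, HasDerivAt m (p t) t) {s t c C : ℝ}
    (hC : ∀ u ∈ uIcc s t, |p u - c| ≤ C) : |m t - m s - c * (t - s)| ≤ C * |t - s| := by
  have h1 : ∀ u ∈ uIcc s t, HasDerivWithinAt (fun u => m u - c * u) (p u - c) (uIcc s t) u :=
    fun u _ => ((h u).sub (by simpa using (hasDerivAt_id u).const_mul c)).hasDerivWithinAt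
  have := (convex_uIcc s t).norm_image_sub_le_of_norm_hasDerivWithin_le h1 hC left_mem_uIcc
    right_mem_uIcc
  rw [Real.norm_eq_abs, Real.norm_eq_abs] at this
  convert this using 2
  ring

theorem IsEnergyLink.abs_sub_linear_le {m p : ℝ → ℝ} {ν : Measure ℝ} (h : IsEnergyLink m p ν)
    {A : ℝ} (hA : ν.real univ ≤ A) (s t : ℝ) :
    |m t - m s - p s * (t - s)| ≤ Real.sqrt (A * |t - s|) * |t - s| := by
  have hA0 : 0 ≤ A := measureReal_nonneg.trans hA
  refine abs_sub_le_of_deriv_sub_le h.hasDerivAt fun u hu => (h.abs_sub_le hA s u).trans ?_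
  apply Real.sqrt_le_sqrt
  exact mul_le_mul_of_nonneg_left (Set.abs_sub_left_of_mem_uIcc hu) hA0

/-- The component orthogonal to `θ₀` of the difference of two unit vectors. -/
theorem norm_sub_sq_orthogonal {θ θ₀ : Vec d} (hθ : ‖θ‖ = 1) (hθ₀ : ‖θ₀‖ = 1) :
    inner ℝ θ₀ (θ - θ₀ + (‖θ - θ₀‖ ^ 2 / 2) • θ₀) = 0 ∧
      ‖θ - θ₀ + (‖θ - θ₀‖ ^ 2 / 2) • θ₀‖ ^ 2 = ‖θ - θ₀‖ ^ 2 - ‖θ - θ₀‖ ^ 4 / 4 := by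
  have h1 : inner ℝ θ₀ (θ - θ₀) = -(‖θ - θ₀‖ ^ 2 / 2) := by
    have := norm_sub_sq_real θ θ₀
    rw [inner_sub_right, real_inner_self_eq_norm_sq, real_inner_comm, this, hθ, hθ₀]
    ring
  refine ⟨?_, ?_⟩
  · rw [inner_add_right, inner_smul_right, real_inner_self_eq_norm_sq, hθ₀, h1]; ring
  · rw [norm_add_sq_real, inner_smul_right, real_inner_comm, h1, norm_smul, hθ₀, Real.norm_eq_abs,
      mul_one, sq_abs]
    ring

theorem sq_le_three_mul_of_abs_sub_le {F g r s : ℝ} (h : |F - g| ≤ r + s) :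
    F ^ 2 ≤ 3 * g ^ 2 + 3 * r ^ 2 + 3 * s ^ 2 := by
  have h1 := sq_le_sq' (neg_le_of_abs_le h) (le_of_abs_le h)
  nlinarith [sq_nonneg (2 * g - (F - g)), sq_nonneg (r - s)]

theorem sq_le_two_mul_of_abs_sub_le {F g e : ℝ} (h : |F - g| ≤ e) :
    F ^ 2 ≤ 2 * g ^ 2 + 2 * e ^ 2 := by
  have h1 := sq_le_sq' (neg_le_of_abs_le h) (le_of_abs_le h)
  nlinarith [sq_nonneg (2 * g - F)]

set_option maxHeartbeats 800000 in
/-- Near the truth, the empirical norm of `m(θᵀx) - m₀(θ₀ᵀx)` controls the population norm of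
`m - m₀`: to first order the difference is a step function of `θ₀ᵀx` plus a weighted linear
function of `x`, and the remainder is absorbed as long as `(θ, m')` is close to `(θ₀, m₀')`. -/
theorem exists_integral_sq_sub_le_of_close {μ : Measure Ω} [IsProbabilityMeasure μ]
    {X : Ω → Vec d} (hX : Measurable X) {θ₀ : Vec d} (hθ₀ : ‖θ₀‖ = 1) {α l T L A c : ℝ}
    (hl : 0 < l) (hT : 0 < T) (hL0 : 0 ≤ L) (hc : 0 < c) {m₀ p₀ : ℝ → ℝ} {ν₀ : Measure ℝ}
    (h₀ : IsEnergyLink m₀ p₀ ν₀) (hL : ∀ t ∈ Icc α (α + l), |p₀ t| ≤ L)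
    (hZ : ∀ᵐ ω ∂μ, inner ℝ θ₀ (X ω) ∈ Icc α (α + l))
    (hpop : ∀ (N : ℕ) (a : Fin (N + 1) → ℝ) (v : Vec d), inner ℝ θ₀ v = 0 →
      c * ((∑ k, a k ^ 2) / (N + 1) + ∫ ω, a (cellIndex α l N (inner ℝ θ₀ (X ω))) ^ 2 ∂μ
        + ‖v‖ ^ 2) ≤ ∫ ω, stepPlusLinear α l p₀ θ₀ N a v (X ω) ^ 2 ∂μ) :
    ∃ η > 0, ∃ C > 0, ∀ (n : ℕ), 1 ≤ n → ∀ (x : Fin n → Vec d),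
      (∀ i, ‖x i‖ ≤ T) → (∀ i, inner ℝ θ₀ (x i) ∈ Icc α (α + l)) → ∀ N : ℕ,
      (∀ (a : Fin (N + 1) → ℝ) (v : Vec d), inner ℝ θ₀ v = 0 →
        ∫ ω, stepPlusLinear α l p₀ θ₀ _ a v (X ω) ^ 2 ∂μ
          ≤ 2 * ((∑ i : Fin n, stepPlusLinear α l p₀ θ₀ _ a v (x i) ^ 2) / n)) →
      ∀ (m p : ℝ → ℝ) (ν : Measure ℝ) (θ : Vec d), IsEnergyLink m p ν → ν.real univ ≤ A →
      ‖θ‖ = 1 → ‖θ - θ₀‖ ≤ η → (∀ t ∈ Icc α (α + l), |p t - p₀ t| ≤ η) →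
      ∫ ω, (m (inner ℝ θ₀ (X ω)) - m₀ (inner ℝ θ₀ (X ω))) ^ 2 ∂μ
        ≤ C * ((∑ i : Fin n, (m (inner ℝ θ (x i)) - m₀ (inner ℝ θ₀ (x i))) ^ 2) / n
          + (1 / ((N : ℝ) + 1)) ^ 2) := by
  -- `κ` is the constant of the linearization error; it is small compared with `√c` once `η` is small
  obtain ⟨η, hη, hη1, hκ⟩ : ∃ η > 0, η ≤ 1 ∧
      Real.sqrt (A * (T * η)) * T + η * T + η * T * L ≤ Real.sqrt c / 4 := by
    have hcont : Continuous fun η : ℝ => Real.sqrt (A * (T * η)) * T + η * T + η * T * L := by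
      fun_prop
    have h1 := (hcont.tendsto 0).eventually_le_const
      (show Real.sqrt (A * (T * 0)) * T + 0 * T + 0 * T * L < Real.sqrt c / 4 by
        simp; exact hc)
    obtain ⟨δ, hδ, hball⟩ := Metric.eventually_nhds_iff.1 h1
    refine ⟨min (δ / 2) 1, by positivity, min_le_right _ _, hball ?_⟩
    rw [Real.dist_eq, sub_zero, abs_of_pos (by positivity)]
    exact (min_le_left _ _).trans_lt (by linarith)
  set κ := Real.sqrt (A * (T * η)) * T + η * T + η * T * L with hκdef
  have hκ0 : 0 ≤ κ := by positivity
  have hκ2 : κ ^ 2 ≤ c / 16 := by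
    calc κ ^ 2 ≤ (Real.sqrt c / 4) ^ 2 := by gcongr
      _ = c / 16 := by rw [div_pow, Real.sq_sqrt hc.le]; norm_num
  refine ⟨η, hη, 24 / c + (24 / c + 2) * l ^ 2, by positivity, ?_⟩
  intro n hn x hxT hxZ N hemp m p ν θ hm hA hθ hθη hpη
  have hA0 : 0 ≤ A := measureReal_nonneg.trans hA
  have hN : (0 : ℝ) < N + 1 := by positivity
  have hn0 : (0 : ℝ) < n := by exact_mod_cast hn
  obtain ⟨hw0, hwn⟩ := norm_sub_sq_orthogonal hθ hθ₀
  set v := θ - θ₀ with hv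
  set w := v + (‖v‖ ^ 2 / 2) • θ₀ with hw
  have hv1 : ‖v‖ ≤ 1 := hθη.trans hη1
  have hwv : 3 / 4 * ‖v‖ ^ 2 ≤ ‖w‖ ^ 2 := by
    have : ‖v‖ ^ 4 ≤ ‖v‖ ^ 2 := pow_le_pow_of_le_one (norm_nonneg _) hv1 (by norm_num)
    linarith
  -- the step function interpolating `m - m₀` at the left end points of the cells
  let a : Fin (N + 1) → ℝ := fun k =>
    m (α + (k : ℕ) * (l / (N + 1))) - m₀ (α + (k : ℕ) * (l / (N + 1)))
  set e := l / ((N : ℝ) + 1) with he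
  have he0 : 0 ≤ e := by positivity
  have hstep : ∀ t ∈ Icc α (α + l), |(m t - m₀ t) - a (cellIndex α l N t)| ≤ e := by
    intro t ht
    obtain ⟨h1, h2⟩ := abs_sub_cell_left_le (N := N) hl ht
    have h3 := abs_sub_le_of_deriv_sub_le (m := fun t => m t - m₀ t) (p := fun t => p t - p₀ t)
      (fun t => (hm.hasDerivAt t).sub (h₀.hasDerivAt t))
      (s := α + (cellIndex α l N t : ℕ) * (l / (N + 1))) (t := t) (c := 0) (C := η) (by
        intro u hu
        rw [sub_zero]
        exact hpη u ((ordConnected_Icc.uIcc_subset h1 ht) hu))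
    rw [zero_mul, sub_zero] at h3
    calc _ ≤ η * |t - (α + (cellIndex α l N t : ℕ) * (l / (N + 1)))| := h3
      _ ≤ 1 * (l / (N + 1)) := by gcongr
      _ = e := by rw [he, one_mul]
  -- the linearization error
  have hrem : ∀ i, |stepPlusLinear α l p₀ θ₀ N a w (x i)
      - (m (inner ℝ θ (x i)) - m₀ (inner ℝ θ₀ (x i)))| ≤ κ * ‖v‖ + e := by
    intro i
    set t := inner ℝ θ (x i) with ht
    set s := inner ℝ θ₀ (x i) with hs
    have hts : t - s = inner ℝ v (x i) := by rw [ht, hs, hv, inner_sub_left]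
    have hd : |t - s| ≤ T * ‖v‖ := by
      rw [hts, mul_comm]
      exact (abs_real_inner_le_norm _ _).trans (by gcongr; exact hxT i)
    have hd' : |t - s| ≤ T * η := hd.trans (by gcongr)
    have hsT : |s| ≤ T := (abs_real_inner_le_norm _ _).trans (by rw [hθ₀, one_mul]; exact hxT i)
    have h1 := hm.abs_sub_linear_le hA s t
    have h1' : |m t - m s - p s * (t - s)| ≤ Real.sqrt (A * (T * η)) * (T * ‖v‖) :=
      h1.trans (by gcongr)
    have h2 : |(p s - p₀ s) * (t - s)| ≤ η * (T * ‖v‖) := by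
      rw [abs_mul]; exact mul_le_mul (hpη s (hxZ i)) hd (abs_nonneg _) hη.le
    have h3 := hstep s (hxZ i)
    have h4 : |‖v‖ ^ 2 / 2 * s * p₀ s| ≤ (η * ‖v‖) * T * L := by
      rw [abs_mul, abs_mul, abs_of_nonneg (by positivity : 0 ≤ ‖v‖ ^ 2 / 2)]
      have : ‖v‖ ^ 2 / 2 ≤ η * ‖v‖ := by
        have : ‖v‖ * ‖v‖ ≤ η * ‖v‖ := by gcongr
        linarith [sq ‖v‖, sq_nonneg ‖v‖]
      gcongr
      exact hL s (hxZ i)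
    have hws : inner ℝ w (x i) = (t - s) + ‖v‖ ^ 2 / 2 * s := by
      rw [hw, inner_add_left, inner_smul_left, hts]; simp [hs]
    have hexp : stepPlusLinear α l p₀ θ₀ N a w (x i) - (m t - m₀ s)
        = -((m s - m₀ s) - a (cellIndex α l N s)) - (m t - m s - p s * (t - s))
          - (p s - p₀ s) * (t - s) + ‖v‖ ^ 2 / 2 * s * p₀ s := by
      simp only [stepPlusLinear, ← hs, hws]; ring
    rw [hexp]
    have h1a := abs_le.1 h1'
    have h2a := abs_le.1 h2
    have h3a := abs_le.1 h3
    have h4a := abs_le.1 h4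
    have hk : κ * ‖v‖ = Real.sqrt (A * (T * η)) * (T * ‖v‖) + η * (T * ‖v‖) + η * ‖v‖ * T * L := by
      rw [hκdef]; ring
    rw [hk, abs_le]
    constructor <;> linarith
  set G := (∑ i : Fin n, (m (inner ℝ θ (x i)) - m₀ (inner ℝ θ₀ (x i))) ^ 2) / n with hG
  set J := ∫ ω, stepPlusLinear α l p₀ θ₀ N a w (X ω) ^ 2 ∂μ with hJ
  have hG0 : 0 ≤ G := by positivity
  have havg : (∑ i : Fin n, stepPlusLinear α l p₀ θ₀ N a w (x i) ^ 2) / n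
      ≤ 3 * G + 3 * κ ^ 2 * ‖v‖ ^ 2 + 3 * e ^ 2 := by
    have : ∑ i : Fin n, stepPlusLinear α l p₀ θ₀ N a w (x i) ^ 2
        ≤ ∑ i : Fin n, (3 * (m (inner ℝ θ (x i)) - m₀ (inner ℝ θ₀ (x i))) ^ 2
          + (3 * κ ^ 2 * ‖v‖ ^ 2 + 3 * e ^ 2)) := by
      refine Finset.sum_le_sum fun i _ => ?_
      have := sq_le_three_mul_of_abs_sub_le (hrem i)
      rw [mul_pow] at this
      linarith
    rw [div_le_iff₀ hn0]
    refine this.trans (le_of_eq ?_)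
    rw [Finset.sum_add_distrib, ← Finset.mul_sum, Finset.sum_const, Finset.card_univ,
      Fintype.card_fin, nsmul_eq_mul, hG]
    field_simp
    try ring
  have hp := hpop N a w hw0
  rw [← hJ] at hp
  have hs0 : 0 ≤ (∑ k, a k ^ 2) / ((N : ℝ) + 1) := by positivity
  set W := ∫ ω, a (cellIndex α l N (inner ℝ θ₀ (X ω))) ^ 2 ∂μ with hW
  have hW0 : 0 ≤ W := integral_nonneg fun _ => sq_nonneg _
  -- the part `κ² ‖v‖²` of the error is absorbed by the lower bound `c ‖w‖² ≤ J`
  have hJ12 : J ≤ 12 * G + 12 * e ^ 2 := by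
    have h1 := (hemp a w hw0).trans (mul_le_mul_of_nonneg_left havg zero_le_two)
    rw [← hJ] at h1
    have h2 : κ ^ 2 * ‖v‖ ^ 2 ≤ c / 16 * ‖v‖ ^ 2 := by gcongr
    have h3 : c * ‖w‖ ^ 2 ≤ J := le_trans (by gcongr; linarith) hp
    have h4 : c * (3 / 4 * ‖v‖ ^ 2) ≤ c * ‖w‖ ^ 2 := by gcongr
    linarith
  have hWJ : W ≤ 1 / c * J := by
    rw [one_div, ← div_eq_inv_mul, le_div_iff₀ hc, mul_comm]
    exact le_trans (by gcongr; linarith [sq_nonneg ‖w‖]) hp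
  have hZm : Measurable fun ω => (inner ℝ θ₀ (X ω) : ℝ) := by fun_prop
  have hwLp : MemLp (fun ω => a (cellIndex α l N (inner ℝ θ₀ (X ω)))) 2 μ := by
    refine MemLp.of_bound (((measurable_of_finite a).comp
      (measurable_cellIndex α l N)).comp hZm).aestronglyMeasurable (∑ k, |a k|)
      (ae_of_all _ fun ω => ?_)
    exact Finset.single_le_sum (f := fun k => |a k|) (fun k _ => abs_nonneg _) (Finset.mem_univ _)
  have hfin : ∫ ω, (m (inner ℝ θ₀ (X ω)) - m₀ (inner ℝ θ₀ (X ω))) ^ 2 ∂μ ≤ 2 * W + 2 * e ^ 2 := by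
    have h1 : ∫ ω, (m (inner ℝ θ₀ (X ω)) - m₀ (inner ℝ θ₀ (X ω))) ^ 2 ∂μ
        ≤ ∫ ω, (2 * a (cellIndex α l N (inner ℝ θ₀ (X ω))) ^ 2 + 2 * e ^ 2) ∂μ := by
      refine integral_mono_of_nonneg (ae_of_all _ fun _ => sq_nonneg _)
        ((hwLp.integrable_sq.const_mul 2).add (integrable_const _)) ?_
      filter_upwards [hZ] with ω hω
      exact sq_le_two_mul_of_abs_sub_le (hstep _ hω)
    rw [integral_add (hwLp.integrable_sq.const_mul 2) (integrable_const _), integral_const_mul] at h1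
    simpa using h1
  have he2 : e ^ 2 = l ^ 2 * (1 / ((N : ℝ) + 1)) ^ 2 := by rw [he]; ring
  have hE0 : 0 ≤ (1 / ((N : ℝ) + 1)) ^ 2 := by positivity
  calc _ ≤ 2 * W + 2 * e ^ 2 := hfin
    _ ≤ 2 * (1 / c * (12 * G + 12 * e ^ 2)) + 2 * e ^ 2 := by
      have : 1 / c * J ≤ 1 / c * (12 * G + 12 * e ^ 2) := by gcongr
      linarith
    _ = 24 / c * G + (24 / c + 2) * l ^ 2 * (1 / ((N : ℝ) + 1)) ^ 2 := by rw [he2]; ring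
    _ ≤ _ := by
      have : 0 ≤ 24 / c := by positivity
      have h5 : 0 ≤ (24 / c + 2) * l ^ 2 := by positivity
      have h6 := mul_nonneg this hE0
      have h7 := mul_nonneg h5 hG0
      linarith

end ConvexSIM

/-! ### Bounds for nearly affine links -/

namespace ConvexSIM

variable {Ω : Type*} [MeasurableSpace Ω] {d : ℕ}

theorem exists_uniform_modulus {Z : Type*} [PseudoMetricSpace Z] {K : Set Z} (hK : IsCompact K)
    {χ : Set (Vec d)} (hχ : IsCompact χ) {F : Z → Vec d → ℝ} (hF : Continuous (Function.uncurry F)) :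
    ∀ ε > 0, ∃ δ > 0, ∀ z ∈ K, ∀ z' ∈ K, dist z z' < δ → ∀ x ∈ χ, |F z x - F z' x| ≤ ε := by
  intro ε hε
  have h := (hK.prod hχ).uniformContinuousOn_of_continuous (f := Function.uncurry F)
    hF.continuousOn
  obtain ⟨δ, hδ, h1⟩ := Metric.uniformContinuousOn_iff.1 h ε hε
  refine ⟨δ, hδ, fun z hz z' hz' hd x hx => ?_⟩
  have := h1 (z, x) ⟨hz, hx⟩ (z', x) ⟨hz', hx⟩ (by simpa [Prod.dist_eq, hδ] using hd)
  rw [Real.dist_eq] at this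
  exact this.le

theorem integrable_of_continuous_of_mem_compact {μ : Measure Ω} [IsProbabilityMeasure μ]
    {X : Ω → Vec d} (hX : Measurable X) {χ : Set (Vec d)} (hχ : IsCompact χ)
    (hXχ : ∀ᵐ ω ∂μ, X ω ∈ χ) {f : Vec d → ℝ} (hf : Continuous f) :
    Integrable (fun ω => f (X ω)) μ := by
  obtain ⟨C, hC⟩ := hχ.exists_bound_of_continuousOn hf.continuousOn
  refine Integrable.of_bound (hf.measurable.comp hX).aestronglyMeasurable C ?_
  filter_upwards [hXχ] with ω hω using hC _ hω

theorem continuousOn_integral_of_continuous {μ : Measure Ω} [IsProbabilityMeasure μ] {X : Ω → Vec d}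
    (hX : Measurable X) {χ : Set (Vec d)} (hχ : IsCompact χ) (hXχ : ∀ᵐ ω ∂μ, X ω ∈ χ)
    {Z : Type*} [PseudoMetricSpace Z] {K : Set Z} (hK : IsCompact K) {F : Z → Vec d → ℝ}
    (hF : Continuous (Function.uncurry F)) : ContinuousOn (fun z => ∫ ω, F z (X ω) ∂μ) K := by
  have hFz : ∀ z, Continuous (F z) := fun z => hF.comp (by fun_prop : Continuous fun x => (z, x))
  rw [Metric.continuousOn_iff]
  intro z hz ε hε
  obtain ⟨δ, hδ, h⟩ := exists_uniform_modulus hK hχ hF (ε / 2) (by positivity)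
  refine ⟨δ, hδ, fun z' hz' hd => ?_⟩
  rw [Real.dist_eq, ← integral_sub (integrable_of_continuous_of_mem_compact hX hχ hXχ (hFz z'))
    (integrable_of_continuous_of_mem_compact hX hχ hXχ (hFz z))]
  have := norm_integral_le_of_norm_le_const (μ := μ) (C := ε / 2)
    (f := fun ω => F z' (X ω) - F z (X ω)) (by
      filter_upwards [hXχ] with ω hω using h z' hz' z hz hd _ hω)
  rw [Real.norm_eq_abs] at this
  simp at this
  linarith

theorem isClosed_paramSpace (d : ℕ) [NeZero d] : IsClosed (ParamSpace d) :=
  (isClosed_eq continuous_norm continuous_const).inter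
    (isClosed_le continuous_const (by fun_prop : Continuous fun η : Vec d => η 0))

theorem isCompact_paramSpace (d : ℕ) [NeZero d] : IsCompact (ParamSpace d) :=
  (isCompact_closedBall (0 : Vec d) 1).of_isClosed_subset (isClosed_paramSpace d)
    fun θ hθ => by simp [hθ.1]

/-- If the covariance matrix is positive definite, no nontrivial affine function of an index
vanishes almost surely. -/
theorem linear_index_not_ae_zero {μ : Measure Ω} [IsProbabilityMeasure μ] {X : Ω → Vec d}
    (hX : ∀ j, MemLp (fun ω => X ω j) 2 μ) (hcov : (covMatrix μ X).PosDef) {a b : ℝ} {θ : Vec d}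
    (hθ : θ ≠ 0) (h : ∀ᵐ ω ∂μ, a + b * inner ℝ θ (X ω) = 0) : a = 0 ∧ b = 0 := by
  have hb : b = 0 := by
    by_contra hb
    have h1 : (fun ω => ∑ j, θ j * X ω j) =ᵐ[μ] fun _ => -a / b := by
      filter_upwards [h] with ω hω
      have : inner ℝ θ (X ω) = ∑ j, θ j * X ω j := by simp [PiLp.inner_apply, mul_comm]
      rw [← this]
      field_simp
      linarith
    have h2 : ∀ i, ∑ j, θ j * covMatrix μ X i j = 0 := by
      intro i
      have h3 : covariance (fun ω => X ω i) (fun ω => ∑ j, θ j * X ω j) μ = 0 := by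
        rw [covariance, integral_congr_ae h1]
        refine integral_eq_zero_of_ae ?_
        filter_upwards [h1] with ω hω
        simp [hω]
      rw [covariance_fun_sum_right (fun j => (hX j).const_mul _) (hX i)] at h3
      simpa [covariance_const_mul_right, covMatrix] using h3
    have h4 := hcov.dotProduct_mulVec_pos (x := fun j => θ j) (by
      intro h0; apply hθ; ext j; exact congrFun h0 j)
    have h5 : (covMatrix μ X).mulVec (fun j => θ j) = 0 := by
      ext i
      simp only [Matrix.mulVec, dotProduct, Pi.zero_apply]
      rw [← h2 i]
      exact Finset.sum_congr rfl fun j _ => mul_comm _ _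
    rw [h5] at h4
    simp at h4
  refine ⟨?_, hb⟩
  obtain ⟨ω, hω⟩ := h.exists
  simpa [hb] using hω

/-- With probability tending to one, the empirical norm of an affine function of an index controls
its coefficients, uniformly in the direction. -/
theorem exists_tendsto_measure_not_affine_bound [NeZero d] {μ : Measure Ω} [IsProbabilityMeasure μ]
    {X : ℕ → Ω → Vec d} (hX : IsIIDDesign μ X) {χ : Set (Vec d)} (hχ : IsCompact χ)
    (hXχ : ∀ i, ∀ᵐ ω ∂μ, X i ω ∈ χ) (hcov : (covMatrix μ (X 0)).PosDef) :
    ∃ c > 0, Tendsto (fun n : ℕ => μ {ω | ¬ ∀ (a b : ℝ), ∀ θ ∈ ParamSpace d,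
      c * (a ^ 2 + b ^ 2) ≤ (∑ i : Fin n, (a + b * inner ℝ θ (X i ω)) ^ 2) / n}) atTop (𝓝 0) := by
  -- by homogeneity, the coefficients may be taken on the unit circle, which makes the class compact
  let F : ℝ × ℝ × Vec d → Vec d → ℝ := fun z x => (z.1 + z.2.1 * inner ℝ z.2.2 x) ^ 2
  let K : Set (ℝ × ℝ × Vec d) := {z | z.1 ^ 2 + z.2.1 ^ 2 = 1 ∧ z.2.2 ∈ ParamSpace d}
  have hF : Continuous (Function.uncurry F) := by
    simp only [F, Function.uncurry_def]; fun_prop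
  have hFz : ∀ z, Continuous (F z) := fun z => hF.comp (by fun_prop : Continuous fun x => (z, x))
  have hK : IsCompact K := by
    refine ((isCompact_Icc (a := (-1 : ℝ)) (b := 1)).prod ((isCompact_Icc (a := (-1 : ℝ))
      (b := 1)).prod (isCompact_paramSpace d))).of_isClosed_subset ?_ ?_
    · exact (isClosed_eq (by fun_prop) continuous_const).inter
        ((isClosed_paramSpace d).preimage (by fun_prop))
    · rintro ⟨a, b, θ⟩ ⟨h1, h2⟩
      simp only at h1 h2
      exact ⟨⟨by nlinarith [sq_nonneg b], by nlinarith [sq_nonneg b]⟩,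
        ⟨by nlinarith [sq_nonneg a], by nlinarith [sq_nonneg a]⟩, h2⟩
  have hXm := hX.measurable 0
  have hLp : ∀ j, MemLp (fun ω => X 0 ω j) 2 μ := by
    intro j
    rw [memLp_two_iff_integrable_sq (by fun_prop : Measurable _).aestronglyMeasurable]
    exact integrable_of_continuous_of_mem_compact hXm hχ (hXχ 0)
      (f := fun x => x j ^ 2) (by fun_prop)
  have hpos : ∀ z ∈ K, 0 < ∫ ω, F z (X 0 ω) ∂μ := by
    rintro ⟨a, b, θ⟩ ⟨h1, h2⟩
    refine lt_of_le_of_ne (integral_nonneg fun _ => sq_nonneg _) fun h0 => ?_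
    have h3 := (integral_eq_zero_iff_of_nonneg (fun _ => sq_nonneg _)
      (integrable_of_continuous_of_mem_compact hXm hχ (hXχ 0) (hFz (a, b, θ)))).1 h0.symm
    have hθ : θ ≠ 0 := by
      have : ‖θ‖ = 1 := h2.1
      rintro rfl
      simp at this
    obtain ⟨ha, hb⟩ := linear_index_not_ae_zero hLp hcov (a := a) (b := b) hθ (by
      filter_upwards [h3] with ω hω
      simpa [F] using hω)
    simp [ha, hb] at h1
  obtain ⟨c, hc, hcK⟩ := hK.exists_forall_le'
    (continuousOn_integral_of_continuous hXm hχ (hXχ 0) hK hF) hpos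
  refine ⟨c / 2, by positivity, ?_⟩
  have hT := tendsto_measure_exists_lt_abs_avg_sub hX hXχ hK (F := F)
    (fun z _ => (hFz z).measurable)
    (fun z _ => integrable_of_continuous_of_mem_compact hXm hχ (hXχ 0) (hFz z))
    (exists_uniform_modulus hK hχ hF) (ε := c / 2) (by positivity)
  refine tendsto_of_tendsto_of_tendsto_of_le_of_le tendsto_const_nhds hT
    (fun _ => zero_le) fun n => measure_mono ?_
  intro ω hω
  by_contra hcon
  refine hω fun a b θ hθ => ?_
  simp only [mem_ofPred_eq, not_exists, not_and, not_lt] at hcon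
  rcases eq_or_lt_of_le (show 0 ≤ a ^ 2 + b ^ 2 by positivity) with h0 | h0
  · rw [← h0, mul_zero]; positivity
  -- normalize the coefficients
  set s := Real.sqrt (a ^ 2 + b ^ 2) with hs
  have hs0 : 0 < s := Real.sqrt_pos.2 h0
  have hs2 : s ^ 2 = a ^ 2 + b ^ 2 := Real.sq_sqrt h0.le
  have hz : ((a / s, b / s, θ) : ℝ × ℝ × Vec d) ∈ K := by
    refine ⟨?_, hθ⟩
    simp only
    field_simp
    linarith
  have h1 := neg_le_of_abs_le (hcon _ hz)
  have h2 := hcK _ hz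
  have h3 : (∑ i : Fin n, F (a / s, b / s, θ) (X i ω)) / n
      = ((∑ i : Fin n, (a + b * inner ℝ θ (X i ω)) ^ 2) / n) / s ^ 2 := by
    rw [div_right_comm]
    congr 1
    rw [Finset.sum_div]
    refine Finset.sum_congr rfl fun i _ => ?_
    simp only [F]
    field_simp
  have h4 : c / 2 ≤ ((∑ i : Fin n, (a + b * inner ℝ θ (X i ω)) ^ 2) / n) / s ^ 2 := by
    rw [← h3]; linarith
  rw [le_div_iff₀ (by positivity), hs2] at h4
  exact h4

/-- A link with small roughness is nearly affine, so an empirical bound for it bounds its values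
and its derivative. -/
theorem IsEnergyLink.exists_bound_of_avg_sq_le {c a b : ℝ} (hc : 0 < c) (hab : a ≤ b) :
    ∃ C > 0, ∀ (n : ℕ) (t : Fin n → ℝ), 1 ≤ n → (∀ i, t i ∈ Icc a b) →
      (∀ u v : ℝ, c * (u ^ 2 + v ^ 2) ≤ (∑ i, (u + v * t i) ^ 2) / n) →
      ∀ (m p : ℝ → ℝ) (ν : Measure ℝ) (A M : ℝ), IsEnergyLink m p ν → ν.real univ ≤ A ^ 2 →
      0 ≤ A → 0 ≤ M →
      (∀ t, p t = p (max a (min b t))) → (∑ i, m (t i) ^ 2) / n ≤ M ^ 2 →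
      |m a| ≤ C * (M + A) ∧ ∀ t, |p t| ≤ C * (M + A) := by
  set l := b - a with hl
  have hl0 : 0 ≤ l := by rw [hl]; linarith
  set C₀ := Real.sqrt (2 / c) * (1 + Real.sqrt l * l) with hC₀
  have hC₀0 : 0 < C₀ := by positivity
  refine ⟨C₀ * (1 + |a|) + Real.sqrt l, by positivity, ?_⟩
  intro n t hn ht hlin m p ν A M hm hA hA0 hM0 hclamp hM
  have hn0 : (0 : ℝ) < n := by exact_mod_cast hn
  have hroot : ∀ s, |s - a| ≤ l → Real.sqrt (A ^ 2 * |s - a|) ≤ A * Real.sqrt l := by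
    intro s hs
    rw [Real.sqrt_mul (sq_nonneg A), Real.sqrt_sq hA0]
    gcongr
  set R := A * Real.sqrt l * l with hR
  have hR0 : 0 ≤ R := by positivity
  set B₁ := C₀ * (M + A) with hB₁
  have hB₁0 : 0 ≤ B₁ := by positivity
  have hrem : ∀ i, |((m a - p a * a) + p a * t i) - m (t i)| ≤ R := by
    intro i
    have h1 := hm.abs_sub_linear_le hA a (t i)
    have h2 : |t i - a| ≤ l := by
      rw [abs_of_nonneg (by linarith [(ht i).1])]; linarith [(ht i).2]
    have h3 : |m (t i) - m a - p a * (t i - a)| ≤ R :=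
      h1.trans (mul_le_mul (hroot _ h2) h2 (abs_nonneg _) (by positivity))
    rw [abs_sub_comm]
    convert h3 using 2
    ring
  have h1 : (∑ i, ((m a - p a * a) + p a * t i) ^ 2) / n ≤ 2 * M ^ 2 + 2 * R ^ 2 := by
    have h2 : ∑ i, ((m a - p a * a) + p a * t i) ^ 2 ≤ ∑ i, (2 * m (t i) ^ 2 + 2 * R ^ 2) :=
      Finset.sum_le_sum fun i _ => sq_le_two_mul_of_abs_sub_le (hrem i)
    rw [Finset.sum_add_distrib, ← Finset.mul_sum, Finset.sum_const, Finset.card_univ,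
      Fintype.card_fin, nsmul_eq_mul] at h2
    rw [div_le_iff₀ hn0] at hM ⊢
    linarith
  have h2 := (hlin _ _).trans h1
  rw [mul_comm, ← le_div_iff₀ hc] at h2
  have h2' : (2 * M ^ 2 + 2 * R ^ 2) / c ≤ B₁ ^ 2 := by
    have e : B₁ ^ 2 = 2 / c * ((1 + Real.sqrt l * l) * (M + A)) ^ 2 := by
      rw [hB₁, hC₀, mul_assoc, mul_pow, Real.sq_sqrt (by positivity)]
    have h3 : M ^ 2 + R ^ 2 ≤ ((1 + Real.sqrt l * l) * (M + A)) ^ 2 := by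
      have h4 : M + R ≤ (1 + Real.sqrt l * l) * (M + A) := by
        have : 0 ≤ Real.sqrt l * l * M := by positivity
        rw [hR]; linarith
      calc M ^ 2 + R ^ 2 ≤ (M + R) ^ 2 := by linarith [add_sq M R, mul_nonneg hM0 hR0]
        _ ≤ _ := by gcongr
    rw [e]
    calc (2 * M ^ 2 + 2 * R ^ 2) / c = 2 / c * (M ^ 2 + R ^ 2) := by ring
      _ ≤ _ := by gcongr
  have h3 : |m a - p a * a| ≤ B₁ := abs_le_of_sq_le_sq (by linarith [sq_nonneg (p a)]) hB₁0
  have h4 : |p a| ≤ B₁ := abs_le_of_sq_le_sq (by linarith [sq_nonneg (m a - p a * a)]) hB₁0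
  have e : (C₀ * (1 + |a|) + Real.sqrt l) * (M + A)
      = B₁ + B₁ * |a| + Real.sqrt l * M + A * Real.sqrt l := by rw [hB₁]; ring
  have h0 : 0 ≤ A * Real.sqrt l := by positivity
  have h0' : 0 ≤ Real.sqrt l * M := by positivity
  rw [e]
  refine ⟨?_, fun u => ?_⟩
  · have h5 : |m a| ≤ |m a - p a * a| + |p a| * |a| := by
      rw [← abs_mul]
      have := abs_add_le (m a - p a * a) (p a * a)
      rwa [sub_add_cancel] at this
    have h6 : |p a| * |a| ≤ B₁ * |a| := by gcongr
    linarith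
  · rw [hclamp u]
    set s := max a (min b u) with hs
    have hs1 : a ≤ s := le_max_left _ _
    have hs2 : s ≤ b := max_le hab (min_le_left _ _)
    have h5 := (hm.abs_sub_le hA a s).trans (hroot s (by
      rw [abs_of_nonneg (by linarith)]; linarith))
    have h7 : |p s| ≤ |p s - p a| + |p a| := by
      have := abs_add_le (p s - p a) (p a)
      rwa [sub_add_cancel] at this
    have : 0 ≤ B₁ * |a| := by positivity
    linarith

end ConvexSIM

/-! ### Consistency -/

namespace ConvexSIM

variable {Ω : Type*} [MeasurableSpace Ω] {d : ℕ}

/-- The parameters of a link on `[a, b]` with continuous derivative and of a direction: the value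
of the link at `a`, its derivative, and the direction. -/
abbrev LinkSpace (d : ℕ) (a b : ℝ) : Type := ℝ × BoundedContinuousFunction (Icc a b) ℝ × Vec d

/-- The link with value `z.1` at `a` and derivative `z.2.1`, which is extended by constants beyond
`[a, b]`. -/
noncomputable def linkOf {a b : ℝ} (hab : a ≤ b) (z : LinkSpace d a b) (t : ℝ) : ℝ :=
  z.1 + ∫ u in a..t, IccExtend hab z.2.1 u

theorem hasDerivAt_linkOf {a b : ℝ} (hab : a ≤ b) (z : LinkSpace d a b) (t : ℝ) :
    HasDerivAt (linkOf hab z) (IccExtend hab z.2.1 t) t := by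
  have hc : Continuous (IccExtend hab z.2.1) := z.2.1.continuous.Icc_extend'
  exact (hc.integral_hasStrictDerivAt a t).hasDerivAt.const_add _

theorem continuous_extend_link {a b : ℝ} (hab : a ≤ b) :
    Continuous fun w : LinkSpace d a b × ℝ => IccExtend hab w.1.2.1 w.2 := by
  have h1 : Continuous fun w : LinkSpace d a b × ℝ => w.1.2.1 := by fun_prop
  have h2 : Continuous fun w : LinkSpace d a b × ℝ => projIcc a b hab w.2 :=
    continuous_projIcc.comp continuous_snd
  exact continuous_eval.comp (h1.prodMk h2)

theorem continuous_linkOf {a b : ℝ} (hab : a ≤ b) :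
    Continuous fun w : LinkSpace d a b × ℝ => linkOf hab w.1 w.2 := by
  have h1 : Continuous (Function.uncurry fun (w : LinkSpace d a b × ℝ) (u : ℝ) =>
      IccExtend hab w.1.2.1 u) :=
    (continuous_extend_link hab).comp (by fun_prop :
      Continuous fun w : (LinkSpace d a b × ℝ) × ℝ => (w.1.1, w.2))
  have h3 := intervalIntegral.continuous_parametric_intervalIntegral_of_continuous (μ := volume)
    (a₀ := a) h1 (s := fun w => w.2) continuous_snd
  exact (by fun_prop : Continuous fun w : LinkSpace d a b × ℝ => w.1.1).add h3

theorem continuous_sq_linkOf_sub {a b : ℝ} (hab : a ≤ b) {m₀ : ℝ → ℝ} (hm₀ : Continuous m₀)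
    (θ₀ : Vec d) : Continuous (Function.uncurry fun (z : LinkSpace d a b) (x : Vec d) =>
      (linkOf hab z (inner ℝ z.2.2 x) - m₀ (inner ℝ θ₀ x)) ^ 2) := by
  have h1 : Continuous fun w : LinkSpace d a b × Vec d => linkOf hab w.1 (inner ℝ w.1.2.2 w.2) :=
    (continuous_linkOf hab).comp (by fun_prop :
      Continuous fun w : LinkSpace d a b × Vec d => (w.1, (inner ℝ w.1.2.2 w.2 : ℝ)))
  simp only [Function.uncurry_def]
  fun_prop

/-- Links with bounded value and bounded, increasing, `1/2`-Hölder derivative, together with a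
direction. -/
def linkClass (d : ℕ) [NeZero d] (a b A B : ℝ) :
    Set (LinkSpace d a b) :=
  Icc (-B) B ×ˢ {f : BoundedContinuousFunction (Icc a b) ℝ | (∀ t, f t ∈ Icc (-B) B) ∧ Monotone f ∧
    ∀ s t, |f s - f t| ≤ Real.sqrt (A * dist s t)} ×ˢ ParamSpace d

/-- The Arzelà–Ascoli theorem, applied to the derivatives of the links. -/
theorem isCompact_linkClass (d : ℕ) [NeZero d] (a b A B : ℝ) : IsCompact (linkClass d a b A B) := by
  have hev : ∀ s : Icc a b, Continuous fun f : BoundedContinuousFunction (Icc a b) ℝ => f s :=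
    fun s => continuous_eval_const s
  refine isCompact_Icc.prod (IsCompact.prod ?_ (isCompact_paramSpace d))
  refine BoundedContinuousFunction.arzela_ascoli₂ (Icc (-B) B) isCompact_Icc _ ?_
    (fun f t hf => hf.1 t) ?_
  · have h1 : IsClosed {f : BoundedContinuousFunction (Icc a b) ℝ | ∀ t, f t ∈ Icc (-B) B} := by
      rw [ofPred_forall]
      exact isClosed_iInter fun t => isClosed_Icc.preimage (hev t)
    have h2 : IsClosed {f : BoundedContinuousFunction (Icc a b) ℝ | Monotone f} := by
      simp only [Monotone, ofPred_forall]
      exact isClosed_iInter fun s => isClosed_iInter fun t => isClosed_iInter fun _ =>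
        isClosed_le (hev s) (hev t)
    have h3 : IsClosed {f : BoundedContinuousFunction (Icc a b) ℝ |
        ∀ s t, |f s - f t| ≤ Real.sqrt (A * dist s t)} := by
      simp only [ofPred_forall]
      exact isClosed_iInter fun s => isClosed_iInter fun t =>
        isClosed_le ((hev s).sub (hev t)).abs continuous_const
    exact h1.inter (h2.inter h3)
  · refine Metric.equicontinuous_of_continuity_modulus (fun r => Real.sqrt (A * r)) ?_ _ ?_
    · have : Continuous fun r => Real.sqrt (A * r) := by fun_prop
      simpa using this.tendsto 0
    · intro s t f
      rw [Real.dist_eq]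
      exact f.2.2.2 s t

/-- Identifiability on the class: at population distance zero the direction is `θ₀`, and on the
range of the index the derivative is the true one. -/
theorem eq_of_integral_sq_linkOf_sub_le_zero [NeZero d] {μ : Measure Ω} [IsProbabilityMeasure μ]
    {X : Ω → Vec d} (hX : Measurable X) {χ : Set (Vec d)} (hχ : IsCompact χ)
    (hXχ : ∀ᵐ ω ∂μ, X ω ∈ χ) {θ₀ : Vec d} (hdesign : MixedDesign μ X θ₀)
    (hnd : NondegenerateGivenIndex μ X θ₀) (hθ₀ : ‖θ₀‖ = 1) (hθ₀_pos : 0 < θ₀ 0)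
    {m₀ p₀ : ℝ → ℝ} (hm₀ : ∀ t, HasDerivAt m₀ (p₀ t) t) (hp₀ : Continuous p₀)
    (hne : ¬ ∀ᵐ ω ∂μ, p₀ (inner ℝ θ₀ (X ω)) = 0) {α l cf : ℝ} (hl : 0 < l) (hcf : 0 < cf)
    (hlow : ENNReal.ofReal cf • volume.restrict (Icc α (α + l))
      ≤ μ.map fun ω => (inner ℝ θ₀ (X ω) : ℝ)) {a b : ℝ} (hab : a ≤ b) {A B : ℝ}
    {z : LinkSpace d a b} (hz : z ∈ linkClass d a b A B)
    (h0 : ∫ ω, (linkOf hab z (inner ℝ z.2.2 (X ω)) - m₀ (inner ℝ θ₀ (X ω))) ^ 2 ∂μ ≤ 0) :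
    z.2.2 = θ₀ ∧ ∀ t ∈ Icc α (α + l), IccExtend hab z.2.1 t = p₀ t := by
  have hm₀c : Continuous m₀ := continuous_iff_continuousAt.2 fun t => (hm₀ t).continuousAt
  have hF : Continuous fun x : Vec d =>
      (linkOf hab z (inner ℝ z.2.2 x) - m₀ (inner ℝ θ₀ x)) ^ 2 :=
    (continuous_sq_linkOf_sub hab hm₀c θ₀).comp (by fun_prop : Continuous fun x => (z, x))
  have h1 := le_antisymm h0 (integral_nonneg fun _ => sq_nonneg _)
  have h2 := (integral_eq_zero_iff_of_nonneg (fun _ => sq_nonneg _)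
    (integrable_of_continuous_of_mem_compact hX hχ hXχ hF)).1 h1
  have h3 : ∀ᵐ ω ∂μ, linkOf hab z (inner ℝ z.2.2 (X ω)) = m₀ (inner ℝ θ₀ (X ω)) := by
    filter_upwards [h2] with ω hω
    simpa [sub_eq_zero] using hω
  have hpc : Continuous (IccExtend hab z.2.1) := z.2.1.continuous.Icc_extend'
  have hθ := eq_direction_of_ae_eq hX hdesign hnd hθ₀ hθ₀_pos hz.2.2
    (hasDerivAt_linkOf hab z) hpc (hz.2.1.2.1.IccExtend hab) hm₀ hp₀ hne h3
  refine ⟨hθ, ?_⟩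
  rw [hθ] at h3
  have hlc : Continuous (linkOf hab z) :=
    continuous_iff_continuousAt.2 fun t => (hasDerivAt_linkOf hab z t).continuousAt
  have h4 : ∀ᵐ t ∂(μ.map fun ω => (inner ℝ θ₀ (X ω) : ℝ)), linkOf hab z t = m₀ t :=
    (ae_map_iff (by fun_prop : Measurable _).aemeasurable
      (measurableSet_eq_fun hlc.measurable hm₀c.measurable)).2 h3
  have h5 : ∀ᵐ t ∂(volume.restrict (Ioo α (α + l))), linkOf hab z t = m₀ t := by
    have h6 := h4.filter_mono (ae_mono hlow)
    rw [Measure.ae_ennreal_smul_measure_iff (by simpa using hcf)] at h6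
    exact ae_restrict_of_ae_restrict_of_subset Ioo_subset_Icc_self h6
  have h7 : EqOn (linkOf hab z) m₀ (Ioo α (α + l)) :=
    MeasureTheory.Measure.eqOn_open_of_ae_eq h5 isOpen_Ioo hlc.continuousOn hm₀c.continuousOn
  have h8 : EqOn (IccExtend hab z.2.1) p₀ (Ioo α (α + l)) := by
    intro t ht
    refine (hasDerivAt_linkOf hab z t).unique ((hm₀ t).congr_of_eventuallyEq ?_)
    filter_upwards [isOpen_Ioo.mem_nhds ht] with u hu using h7 hu
  intro t ht
  rw [← closure_Ioo (by linarith : α ≠ α + l)] at ht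
  exact (h8.closure hpc hp₀) ht

/-- Identifiability, in quantitative form: on a compact class, a small population distance forces
the direction and the derivative of the link to be close to the truth. -/
theorem exists_close_of_integral_sq_le [NeZero d] {μ : Measure Ω} [IsProbabilityMeasure μ]
    {X : Ω → Vec d} (hX : Measurable X) {χ : Set (Vec d)} (hχ : IsCompact χ)
    (hXχ : ∀ᵐ ω ∂μ, X ω ∈ χ) {θ₀ : Vec d} (hdesign : MixedDesign μ X θ₀)
    (hnd : NondegenerateGivenIndex μ X θ₀) (hθ₀ : ‖θ₀‖ = 1) (hθ₀_pos : 0 < θ₀ 0)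
    {m₀ p₀ : ℝ → ℝ} (hm₀ : ∀ t, HasDerivAt m₀ (p₀ t) t) (hp₀ : Continuous p₀)
    (hne : ¬ ∀ᵐ ω ∂μ, p₀ (inner ℝ θ₀ (X ω)) = 0) {α l cf : ℝ} (hl : 0 < l) (hcf : 0 < cf)
    (hlow : ENNReal.ofReal cf • volume.restrict (Icc α (α + l))
      ≤ μ.map fun ω => (inner ℝ θ₀ (X ω) : ℝ)) {a b : ℝ} (hab : a ≤ b) (A B : ℝ) {η : ℝ}
    (hη : 0 < η) :
    ∃ δ > 0, ∀ z ∈ linkClass d a b A B,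
      ∫ ω, (linkOf hab z (inner ℝ z.2.2 (X ω)) - m₀ (inner ℝ θ₀ (X ω))) ^ 2 ∂μ ≤ δ →
      ‖z.2.2 - θ₀‖ ≤ η ∧ ∀ t ∈ Icc α (α + l), |IccExtend hab z.2.1 t - p₀ t| ≤ η := by
  have hm₀c : Continuous m₀ := continuous_iff_continuousAt.2 fun t => (hm₀ t).continuousAt
  have hK := isCompact_linkClass d a b A B
  let F : LinkSpace d a b → Vec d → ℝ := fun z x =>
    (linkOf hab z (inner ℝ z.2.2 x) - m₀ (inner ℝ θ₀ x)) ^ 2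
  have hF : Continuous (Function.uncurry F) := continuous_sq_linkOf_sub hab hm₀c θ₀
  have hFz : ∀ z, Continuous (F z) := fun z => hF.comp (by fun_prop : Continuous fun x => (z, x))
  have hΦ := continuousOn_integral_of_continuous hX hχ hXχ hK hF
  have hid : ∀ z ∈ linkClass d a b A B, ∫ ω, F z (X ω) ∂μ ≤ 0 →
      z.2.2 = θ₀ ∧ ∀ t ∈ Icc α (α + l), IccExtend hab z.2.1 t = p₀ t := fun z hz h0 =>
    eq_of_integral_sq_linkOf_sub_le_zero hX hχ hXχ hdesign hnd hθ₀ hθ₀_pos hm₀ hp₀ hne hl hcf hlow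
      hab hz h0
  -- on the compact parts of the class that stay away from the truth, the distance has a
  -- positive minimum
  have hK₁ : IsCompact (linkClass d a b A B ∩ {z | η ≤ ‖z.2.2 - θ₀‖}) :=
    hK.inter_right (isClosed_le continuous_const
      ((continuous_snd.comp continuous_snd).sub continuous_const).norm)
  have hK₂ : IsCompact ((linkClass d a b A B ×ˢ Icc α (α + l)) ∩
      {w | η ≤ |IccExtend hab w.1.2.1 w.2 - p₀ w.2|}) :=
    (hK.prod isCompact_Icc).inter_right (isClosed_le continuous_const
      ((continuous_extend_link hab).sub (hp₀.comp continuous_snd)).abs)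
  obtain ⟨δ₁, hδ₁, h1⟩ := hK₁.exists_forall_le' (hΦ.mono inter_subset_left) (a := 0) (by
    intro z hz
    by_contra hcon
    have h2 := (hid z hz.1 (not_lt.1 hcon)).1
    have h3 : η ≤ ‖z.2.2 - θ₀‖ := hz.2
    rw [h2, sub_self, norm_zero] at h3
    exact absurd hη (not_lt.2 h3))
  have hΦ₂ : ContinuousOn (fun w : LinkSpace d a b × ℝ => ∫ ω, F w.1 (X ω) ∂μ)
      ((linkClass d a b A B ×ˢ Icc α (α + l)) ∩
        {w | η ≤ |IccExtend hab w.1.2.1 w.2 - p₀ w.2|}) :=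
    ContinuousOn.comp (g := fun z => ∫ ω, F z (X ω) ∂μ) (f := Prod.fst) hΦ
      continuous_fst.continuousOn fun w hw => (mem_prod.1 hw.1).1
  obtain ⟨δ₂, hδ₂, h2⟩ := hK₂.exists_forall_le' hΦ₂ (a := 0) (by
    intro w hw
    by_contra hcon
    have h2 := (hid w.1 (mem_prod.1 hw.1).1 (not_lt.1 hcon)).2 w.2 (mem_prod.1 hw.1).2
    have h3 : η ≤ |IccExtend hab w.1.2.1 w.2 - p₀ w.2| := hw.2
    rw [h2, sub_self, abs_zero] at h3
    exact absurd hη (not_lt.2 h3))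
  have hδ : 0 < min δ₁ δ₂ := lt_min hδ₁ hδ₂
  refine ⟨min δ₁ δ₂ / 2, half_pos hδ, fun z hz hle => ⟨?_, fun t ht => ?_⟩⟩
  · by_contra hcon
    exact absurd ((min_le_left _ _).trans ((h1 z ⟨hz, (not_le.1 hcon).le⟩).trans hle))
      (not_le.2 (half_lt_self hδ))
  · by_contra hcon
    exact absurd ((min_le_right _ _).trans ((h2 (z, t) ⟨⟨hz, ht⟩, (not_le.1 hcon).le⟩).trans hle))
      (not_le.2 (half_lt_self hδ))

/-- Consistency: with probability tending to one, every convex link with bounded roughness that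
fits the true regression function well on the sample is close to the truth. -/
theorem exists_tendsto_measure_not_close [NeZero d] {μ : Measure Ω} [IsProbabilityMeasure μ]
    {X : ℕ → Ω → Vec d} (hX : IsIIDDesign μ X) {χ : Set (Vec d)} (hχ : IsCompact χ)
    (hXχ : ∀ i, ∀ᵐ ω ∂μ, X i ω ∈ χ) {θ₀ : Vec d} (hdesign : MixedDesign μ (X 0) θ₀)
    (hnd : NondegenerateGivenIndex μ (X 0) θ₀) (hθ₀ : ‖θ₀‖ = 1) (hθ₀_pos : 0 < θ₀ 0)
    {m₀ p₀ : ℝ → ℝ} (hm₀ : ∀ t, HasDerivAt m₀ (p₀ t) t) (hp₀ : Continuous p₀)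
    (hne : ¬ ∀ᵐ ω ∂μ, p₀ (inner ℝ θ₀ (X 0 ω)) = 0) {α l cf : ℝ} (hl : 0 < l) (hcf : 0 < cf)
    (hlow : ENNReal.ofReal cf • volume.restrict (Icc α (α + l))
      ≤ μ.map fun ω => (inner ℝ θ₀ (X 0 ω) : ℝ)) {a b : ℝ} (hab : a ≤ b) (A B : ℝ) {η : ℝ}
    (hη : 0 < η) :
    ∃ δ > 0, Tendsto (fun n : ℕ => μ {ω | ¬ ∀ (m p : ℝ → ℝ) (ν : Measure ℝ), ∀ θ ∈ ParamSpace d,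
      IsEnergyLink m p ν → Monotone p → (∀ t, p t = p (max a (min b t))) → ν.real univ ≤ A →
      |m a| ≤ B → (∀ t, |p t| ≤ B) →
      (∑ i : Fin n, (m (inner ℝ θ (X i ω)) - m₀ (inner ℝ θ₀ (X i ω))) ^ 2) / n ≤ δ →
      ‖θ - θ₀‖ ≤ η ∧ ∀ t ∈ Icc α (α + l), |p t - p₀ t| ≤ η}) atTop (𝓝 0) := by
  obtain ⟨δ, hδ, hclose⟩ := exists_close_of_integral_sq_le (hX.measurable 0) hχ (hXχ 0) hdesign hnd
    hθ₀ hθ₀_pos hm₀ hp₀ hne hl hcf hlow hab A B hη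
  have hm₀c : Continuous m₀ := continuous_iff_continuousAt.2 fun t => (hm₀ t).continuousAt
  have hK := isCompact_linkClass d a b A B
  let F : LinkSpace d a b → Vec d → ℝ := fun z x =>
    (linkOf hab z (inner ℝ z.2.2 x) - m₀ (inner ℝ θ₀ x)) ^ 2
  have hF : Continuous (Function.uncurry F) := continuous_sq_linkOf_sub hab hm₀c θ₀
  have hFz : ∀ z, Continuous (F z) := fun z => hF.comp (by fun_prop : Continuous fun x => (z, x))
  have hT := tendsto_measure_exists_lt_abs_avg_sub hX hXχ hK (F := F)
    (fun z _ => (hFz z).measurable)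
    (fun z _ => integrable_of_continuous_of_mem_compact (hX.measurable 0) hχ (hXχ 0) (hFz z))
    (exists_uniform_modulus hK hχ hF) (ε := δ / 2) (by positivity)
  refine ⟨δ / 2, by positivity, tendsto_of_tendsto_of_tendsto_of_le_of_le tendsto_const_nhds hT
    (fun _ => zero_le) fun n => measure_mono ?_⟩
  intro ω hω
  by_contra hcon
  refine hω fun m p ν θ hθ hm hp hclamp hA hma hpB havg => ?_
  simp only [mem_ofPred_eq, not_exists, not_and, not_lt] at hcon
  -- the restriction of `p` to `[a, b]` determines the link
  have hpc := hm.continuous_deriv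
  let f : BoundedContinuousFunction (Icc a b) ℝ :=
    BoundedContinuousFunction.mkOfCompact ⟨fun t => p t, by fun_prop⟩
  have hfp : IccExtend hab f = p := by
    ext t
    rw [hclamp t]
    rfl
  have hlink : ∀ t, linkOf hab (m a, f, θ) t = m t := by
    intro t
    simp only [linkOf, hfp]
    rw [intervalIntegral.integral_eq_sub_of_hasDerivAt (fun u _ => hm.hasDerivAt u)
      (hpc.intervalIntegrable _ _)]
    ring
  have hz : ((m a, f, θ) : LinkSpace d a b)
      ∈ linkClass d a b A B := by
    refine ⟨abs_le.1 hma, ⟨fun t => abs_le.1 (hpB t), fun s t hst => hp hst, fun s t => ?_⟩, hθ⟩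
    have := hm.abs_sub_le hA (t : ℝ) s
    exact this
  have h1 := neg_le_of_abs_le (hcon _ hz)
  have h2 := hclose _ hz
  simp only [F, hlink] at h1 h2
  rw [hfp] at h2
  exact h2 (by linarith)

end ConvexSIM

/-! ### The basic inequality -/

namespace ConvexSIM

variable {Ω : Type*} [MeasurableSpace Ω] {d : ℕ}

/-- The basic inequality, from comparing the penalized loss of the estimate with that of the truth.
The estimate has finite roughness because the truth has finite penalized loss. -/
theorem IsPLSE.basic_inequality {n : ℕ} [NeZero d] {D : Set ℝ} {x : Fin n → Vec d}
    {y e : Fin n → ℝ} {lam : ℝ} {m m₀ : ℝ → ℝ} {θ θ₀ : Vec d} (h : IsPLSE D x y lam m θ)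
    (hlam : 0 < lam) (hm₀ : IsConvexLink D m₀) (hR₀ : roughness D m₀ < ∞)
    (hθ₀ : θ₀ ∈ ParamSpace d) (hy : ∀ i, y i = m₀ (inner ℝ θ₀ (x i)) + e i) :
    roughness D m < ∞ ∧
      (∑ i, (m (inner ℝ θ (x i)) - m₀ (inner ℝ θ₀ (x i))) ^ 2) / n
        + lam ^ 2 * (roughness D m).toReal
      ≤ 2 / n * ∑ i, e i * (m (inner ℝ θ (x i)) - m₀ (inner ℝ θ₀ (x i)))
        + lam ^ 2 * (roughness D m₀).toReal := by
  have h1 := h.2.2 m₀ θ₀ hm₀ hθ₀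
  unfold penalizedLoss at h1
  have hlam2 : 0 < lam ^ 2 := by positivity
  have hne : ENNReal.ofReal (lam ^ 2) ≠ 0 := by simpa using hlam.ne'
  have hfin₀ : ENNReal.ofReal ((1 / (n : ℝ)) * ∑ i, (y i - m₀ (inner ℝ θ₀ (x i))) ^ 2)
      + ENNReal.ofReal (lam ^ 2) * roughness D m₀ < ∞ :=
    ENNReal.add_lt_top.2 ⟨ENNReal.ofReal_lt_top, ENNReal.mul_lt_top ENNReal.ofReal_lt_top hR₀⟩
  have hR : roughness D m < ∞ := by
    by_contra hcon
    rw [not_lt, top_le_iff] at hcon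
    rw [hcon, ENNReal.mul_top hne, add_top] at h1
    exact absurd (h1.trans_lt hfin₀) (lt_irrefl _)
  refine ⟨hR, ?_⟩
  have h2 := ENNReal.toReal_mono hfin₀.ne h1
  rw [ENNReal.toReal_add ENNReal.ofReal_ne_top (ENNReal.mul_ne_top ENNReal.ofReal_ne_top hR.ne),
    ENNReal.toReal_add ENNReal.ofReal_ne_top (ENNReal.mul_ne_top ENNReal.ofReal_ne_top hR₀.ne),
    ENNReal.toReal_mul, ENNReal.toReal_mul, ENNReal.toReal_ofReal hlam2.le,
    ENNReal.toReal_ofReal (by positivity), ENNReal.toReal_ofReal (by positivity)] at h2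
  have h3 : ∑ i, (y i - m (inner ℝ θ (x i))) ^ 2
      = ∑ i, (y i - m₀ (inner ℝ θ₀ (x i))) ^ 2
        - 2 * ∑ i, e i * (m (inner ℝ θ (x i)) - m₀ (inner ℝ θ₀ (x i)))
        + ∑ i, (m (inner ℝ θ (x i)) - m₀ (inner ℝ θ₀ (x i))) ^ 2 := by
    rw [Finset.mul_sum, ← Finset.sum_sub_distrib, ← Finset.sum_add_distrib]
    exact Finset.sum_congr rfl fun i _ => by rw [hy]; ring
  rw [h3] at h2
  have e1 : ∀ s t u : ℝ, 1 / (n : ℝ) * (s - 2 * t + u) = 1 / n * s - 2 / n * t + u / n := by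
    intro s t u; ring
  rw [e1] at h2
  linarith

/-- Solving the basic inequality for the empirical distance `G` and the root `S` of the roughness.
-/
theorem le_of_sq_add_sq_le {G S lam K₁ K₂ K₃ : ℝ} (hlam : 0 < lam) (hK₃ : 0 ≤ K₃)
    (h : G ^ 2 + lam ^ 2 * S ^ 2 ≤ K₁ * lam * G + K₂ * lam ^ 2 * S + K₃ * lam ^ 2) :
    G ≤ Real.sqrt (K₁ ^ 2 + K₂ ^ 2 + 2 * K₃) * lam ∧ S ≤ Real.sqrt (K₁ ^ 2 + K₂ ^ 2 + 2 * K₃) := by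
  set C := K₁ ^ 2 + K₂ ^ 2 + 2 * K₃ with hC
  have hC0 : 0 ≤ C := by positivity
  have h1 : G ^ 2 + lam ^ 2 * S ^ 2 ≤ C * lam ^ 2 := by
    have e1 : 0 ≤ (G - K₁ * lam) ^ 2 := sq_nonneg _
    have e2 : 0 ≤ lam ^ 2 * (S - K₂) ^ 2 := by positivity
    have e3 : (G - K₁ * lam) ^ 2 = G ^ 2 - 2 * (K₁ * lam * G) + K₁ ^ 2 * lam ^ 2 := by ring
    have e4 : lam ^ 2 * (S - K₂) ^ 2
        = lam ^ 2 * S ^ 2 - 2 * (K₂ * lam ^ 2 * S) + K₂ ^ 2 * lam ^ 2 := by ring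
    rw [hC]
    linarith
  constructor
  · refine le_of_sq_le_sq ?_ (by positivity)
    rw [mul_pow, Real.sq_sqrt hC0]
    have : 0 ≤ lam ^ 2 * S ^ 2 := by positivity
    linarith
  · refine Real.le_sqrt_of_sq_le ?_
    have : lam ^ 2 * S ^ 2 ≤ lam ^ 2 * C := by linarith [sq_nonneg G]
    exact le_of_mul_le_mul_left this (by positivity)

/-- The deterministic part of the rate: on the events where the noise is controlled, the basic
inequality gives the rate `lam` for the empirical distance and bounds the roughness. -/
theorem exists_rate_bound (d : ℕ) {B l T C₁ M₀ s M₁ R₀ : ℝ} (hB : 0 ≤ B) (hl : 0 < l) (hT : 0 ≤ T)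
    (hC₁ : 0 ≤ C₁) (hM₀ : 0 ≤ M₀) (hs : 0 ≤ s) (hR₀ : 0 ≤ R₀) :
    ∃ C, ∀ (n : ℕ), 1 ≤ n → ∀ (x : Fin n → Vec d) (e : Fin n → ℝ) (f : Vec d → ℝ)
      (m p : ℝ → ℝ) (ν : Measure ℝ) (θ η : Vec d) (lam P G S : ℝ), IsEnergyLink m p ν → 0 < lam →
      (n : ℝ) ^ (-(2 / 5) : ℝ) ≤ M₁ * lam → (∀ i, ‖x i‖ ≤ T) → (∑ i, e i ^ 2) / n ≤ s ^ 2 →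
      ‖θ - η‖ ≤ d / n → NoiseBound f B l ⌈(n : ℝ) ^ (1 / 5 : ℝ)⌉₊ x (WithLp.toLp 2 e) η →
      0 ≤ G → 0 ≤ S → G ^ 2 = (∑ i, (m (inner ℝ θ (x i)) - f (x i)) ^ 2) / n →
      S ^ 2 = ν.real univ →
      (∀ t, |p t| ≤ P) → P ≤ C₁ * (G + M₀ + S) →
      G ^ 2 + lam ^ 2 * S ^ 2 ≤ 2 / n * ∑ i, e i * (m (inner ℝ θ (x i)) - f (x i))
        + lam ^ 2 * R₀ →
      G ≤ C * lam ∧ S ≤ C := by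
  set W := Real.sqrt (2 * l ^ 3) with hW
  have hW0 : 0 ≤ W := Real.sqrt_nonneg _
  set K := (4 * B + 2 * s) * (T * d * C₁) with hK
  have hK0 : 0 ≤ K := by positivity
  refine ⟨Real.sqrt (((4 * B + K) * M₁) ^ 2 + ((20 * B * W + K) * M₁ ^ 2) ^ 2
    + 2 * (K * M₀ * M₁ ^ 2 + R₀)), ?_⟩
  intro n hn x e f m p ν θ η lam P G S hm hlam hρ hx he hθη hnoise hG hS hGe hSe hp hP hbasic
  have hn0 : (0 : ℝ) < n := by exact_mod_cast hn
  have hn1 : (1 : ℝ) ≤ n := by exact_mod_cast hn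
  -- all powers of `n` are expressed through its tenth root
  set q := (n : ℝ) ^ (1 / 10 : ℝ) with hq
  have hq1 : 1 ≤ q := Real.one_le_rpow hn1 (by norm_num)
  have hq0 : 0 < q := by linarith
  have hq10 : (n : ℝ) = q ^ 10 := by
    rw [hq, ← Real.rpow_natCast, ← Real.rpow_mul hn0.le]; norm_num
  have hq2 : (n : ℝ) ^ (1 / 5 : ℝ) = q ^ 2 := by
    rw [hq, ← Real.rpow_natCast, ← Real.rpow_mul hn0.le]; norm_num
  have hq4 : (n : ℝ) ^ (-(2 / 5) : ℝ) = (q ^ 4)⁻¹ := by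
    rw [hq, ← Real.rpow_natCast, ← Real.rpow_mul hn0.le, ← Real.rpow_neg hn0.le]; norm_num
  have hsq : Real.sqrt n = q ^ 5 := by
    rw [hq10, show q ^ 10 = (q ^ 5) ^ 2 by ring, Real.sqrt_sq (by positivity)]
  set N := ⌈(n : ℝ) ^ (1 / 5 : ℝ)⌉₊ with hN
  have hNl : q ^ 2 ≤ N := by rw [← hq2]; exact Nat.le_ceil _
  have hNu : (N : ℝ) ≤ (2 * q) ^ 2 := by
    have h1 := (Nat.ceil_lt_add_one (by positivity : (0 : ℝ) ≤ (n : ℝ) ^ (1 / 5 : ℝ))).le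
    rw [← hN, hq2] at h1
    have : 1 ≤ q ^ 2 := one_le_pow₀ hq1
    linarith [mul_pow 2 q 2]
  have hsN : Real.sqrt N ≤ 2 * q := by
    rw [← Real.sqrt_sq (by positivity : 0 ≤ 2 * q)]; exact Real.sqrt_le_sqrt hNu
  have hsN2 : Real.sqrt N / (N : ℝ) ^ 2 ≤ 2 / q ^ 3 := by
    calc Real.sqrt N / (N : ℝ) ^ 2 ≤ 2 * q / (q ^ 2) ^ 2 := by gcongr
      _ = 2 / q ^ 3 := by field_simp
  set ρ := (q ^ 4)⁻¹ with hρdef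
  have hρ0 : 0 < ρ := by positivity
  have hρ1 : ρ ≤ 1 := inv_le_one_of_one_le₀ (one_le_pow₀ hq1)
  rw [hq4] at hρ
  have hP0 : 0 ≤ P := (abs_nonneg _).trans (hp 0)
  -- replacing the direction by the nearby grid direction
  set κ := P * (T * (d / n)) with hκ
  have hκ0 : 0 ≤ κ := by positivity
  have hκP : κ ≤ ρ ^ 2 * (T * d * C₁) * (G + M₀ + S) := by
    have h1 : (n : ℝ)⁻¹ ≤ ρ ^ 2 := by
      rw [hq10, hρdef, inv_pow, ← pow_mul]
      exact inv_anti₀ (by positivity) (pow_le_pow_right₀ hq1 (by norm_num))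
    calc κ = P * (T * d) * (n : ℝ)⁻¹ := by rw [hκ]; ring
      _ ≤ (C₁ * (G + M₀ + S)) * (T * d) * ρ ^ 2 := by gcongr
      _ = _ := by ring
  have hdiff : ∀ i, |m (inner ℝ θ (x i)) - m (inner ℝ η (x i))| ≤ κ := by
    intro i
    have h1 := abs_sub_le_of_deriv_sub_le hm.hasDerivAt (s := inner ℝ η (x i))
      (t := inner ℝ θ (x i)) (c := 0) (C := P) (fun u _ => by rw [sub_zero]; exact hp u)
    rw [zero_mul, sub_zero, ← inner_sub_left] at h1
    refine h1.trans ?_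
    rw [hκ]
    gcongr
    calc _ ≤ ‖θ - η‖ * ‖x i‖ := abs_real_inner_le_norm _ _
      _ ≤ d / n * T := by gcongr; exact hx i
      _ = _ := mul_comm _ _
  set ξ : EuclideanSpace ℝ (Fin n) := WithLp.toLp 2 e with hξ
  set g : EuclideanSpace ℝ (Fin n) := WithLp.toLp 2 fun i => m (inner ℝ θ (x i)) - f (x i) with hg
  set g' : EuclideanSpace ℝ (Fin n) := WithLp.toLp 2 fun i => m (inner ℝ η (x i)) - f (x i) with hg'
  have hξn : ‖ξ‖ ≤ q ^ 5 * s := by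
    rw [EuclideanSpace.norm_eq, Real.sqrt_le_iff]
    refine ⟨by positivity, ?_⟩
    rw [div_le_iff₀ hn0] at he
    simp only [hξ, Real.norm_eq_abs, sq_abs]
    calc _ ≤ s ^ 2 * n := he
      _ = _ := by rw [hq10]; ring
  have hgn : ‖g‖ = q ^ 5 * G := by
    rw [EuclideanSpace.norm_eq, ← Real.sqrt_sq (by positivity : 0 ≤ q ^ 5 * G)]
    congr 1
    simp only [hg, Real.norm_eq_abs, sq_abs]
    rw [mul_pow, hGe, ← pow_mul, hq10]
    field_simp
  have hgg' : ‖g - g'‖ ≤ q ^ 5 * κ := by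
    rw [EuclideanSpace.norm_eq, Real.sqrt_le_iff]
    refine ⟨by positivity, ?_⟩
    calc ∑ i, ‖(g - g') i‖ ^ 2 ≤ ∑ _i : Fin n, κ ^ 2 := by
          refine Finset.sum_le_sum fun i _ => ?_
          have : (g - g') i = m (inner ℝ θ (x i)) - m (inner ℝ η (x i)) := by
            simp [hg, hg']
          rw [this, Real.norm_eq_abs]
          gcongr
          exact hdiff i
      _ = (q ^ 5 * κ) ^ 2 := by
        rw [Finset.sum_const, Finset.card_univ, Fintype.card_fin, nsmul_eq_mul, hq10]; ring
  have hg'n : ‖g'‖ ≤ q ^ 5 * (G + κ) := by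
    have := norm_sub_norm_le g' g
    rw [norm_sub_rev] at this
    linarith
  have hinner : ∑ i, e i * (m (inner ℝ θ (x i)) - f (x i)) = inner ℝ ξ g := by
    simp [hξ, hg, PiLp.inner_apply, mul_comm]
  have hsqV : Real.sqrt (2 * n * l ^ 3 * ν.real univ) = q ^ 5 * W * S := by
    rw [← hSe, show 2 * (n : ℝ) * l ^ 3 * S ^ 2 = n * (2 * l ^ 3) * S ^ 2 by ring,
      Real.sqrt_mul (by positivity), Real.sqrt_mul hn0.le, Real.sqrt_sq hS, hsq]
  have hn1 : inner ℝ ξ g' ≤ B * (2 * q) * (q ^ 5 * (G + κ)) + 5 * B * (q ^ 5 * W * S) * (2 / q ^ 3) := by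
    have h1 := (le_abs_self _).trans (hnoise m p ν hm)
    rw [hsqV] at h1
    refine h1.trans ?_
    gcongr
  have hn2 : inner ℝ ξ (g - g') ≤ (q ^ 5 * s) * (q ^ 5 * κ) :=
    (real_inner_le_norm _ _).trans (by gcongr)
  have hn3 : inner ℝ ξ g = inner ℝ ξ g' + inner ℝ ξ (g - g') := by rw [inner_sub_right]; ring
  have hmain : 2 / n * inner ℝ ξ g ≤ 4 * B * ρ * G + 20 * B * W * ρ ^ 2 * S + (4 * B + 2 * s) * κ := by
    calc 2 / n * inner ℝ ξ g ≤ 2 / n * (B * (2 * q) * (q ^ 5 * (G + κ))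
          + 5 * B * (q ^ 5 * W * S) * (2 / q ^ 3) + (q ^ 5 * s) * (q ^ 5 * κ)) := by
          gcongr
          linarith
      _ = 4 * B * ρ * G + 20 * B * W * ρ ^ 2 * S + (4 * B * ρ + 2 * s) * κ := by
        rw [hq10, hρdef]
        field_simp
        ring
      _ ≤ _ := by
        have : 4 * B * ρ ≤ 4 * B * 1 := by gcongr
        have := mul_le_mul_of_nonneg_right this hκ0
        linarith
  have hκK : (4 * B + 2 * s) * κ ≤ K * ρ * G + K * M₀ * ρ ^ 2 + K * ρ ^ 2 * S := by
    have h1 : ρ ^ 2 * G ≤ ρ * G := by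
      have : ρ ^ 2 ≤ ρ := by rw [sq]; exact mul_le_of_le_one_left hρ0.le hρ1
      gcongr
    calc (4 * B + 2 * s) * κ ≤ (4 * B + 2 * s) * (ρ ^ 2 * (T * d * C₁) * (G + M₀ + S)) := by gcongr
      _ = K * (ρ ^ 2 * G) + K * M₀ * ρ ^ 2 + K * ρ ^ 2 * S := by rw [hK]; ring
      _ ≤ K * (ρ * G) + K * M₀ * ρ ^ 2 + K * ρ ^ 2 * S := by gcongr
      _ = _ := by ring
  rw [hinner] at hbasic
  have hρ2 : ρ ^ 2 ≤ M₁ ^ 2 * lam ^ 2 := by rw [← mul_pow]; gcongr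
  refine le_of_sq_add_sq_le hlam (by positivity) ?_
  calc G ^ 2 + lam ^ 2 * S ^ 2
      ≤ (4 * B + K) * G * ρ + (20 * B * W + K) * S * ρ ^ 2 + K * M₀ * ρ ^ 2 + lam ^ 2 * R₀ := by
        linarith
    _ ≤ (4 * B + K) * G * (M₁ * lam) + (20 * B * W + K) * S * (M₁ ^ 2 * lam ^ 2)
        + K * M₀ * (M₁ ^ 2 * lam ^ 2) + lam ^ 2 * R₀ := by gcongr
    _ = _ := by ring

end ConvexSIM

/-! ### Events of high probability and the empirical rate -/

namespace ConvexSIM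

variable {Ω : Type*} [MeasurableSpace Ω] {d : ℕ}

/-- The property `P n` holds with (inner) probability tending to one. -/
def WithHighProb (μ : Measure Ω) (P : ℕ → Ω → Prop) : Prop :=
  Tendsto (fun n => μ {ω | ¬ P n ω}) atTop (𝓝 0)

theorem WithHighProb.mono {μ : Measure Ω} {P Q : ℕ → Ω → Prop} (h : WithHighProb μ P)
    (hPQ : ∀ᶠ n in atTop, ∀ ω, P n ω → Q n ω) : WithHighProb μ Q := by
  refine tendsto_of_tendsto_of_tendsto_of_le_of_le' tendsto_const_nhds h
    (Eventually.of_forall fun _ => zero_le) ?_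
  filter_upwards [hPQ] with n hn
  exact measure_mono fun ω hω hP => hω (hn ω hP)

theorem WithHighProb.and {μ : Measure Ω} {P Q : ℕ → Ω → Prop} (hP : WithHighProb μ P)
    (hQ : WithHighProb μ Q) : WithHighProb μ fun n ω => P n ω ∧ Q n ω := by
  have h := Tendsto.add hP hQ
  rw [add_zero] at h
  refine tendsto_of_tendsto_of_tendsto_of_le_of_le tendsto_const_nhds h (fun _ => zero_le) fun n =>
    (measure_mono ?_).trans (measure_union_le _ _)
  intro ω hω
  by_cases h1 : P n ω
  · exact Or.inr fun h2 => hω ⟨h1, h2⟩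
  · exact Or.inl h1

theorem WithHighProb.of_ae {μ : Measure Ω} {P : ℕ → Ω → Prop}
    (h : ∀ᶠ n in atTop, ∀ᵐ ω ∂μ, P n ω) : WithHighProb μ P :=
  tendsto_const_nhds.congr' (by
    filter_upwards [h] with n hn
    exact (ae_iff.1 hn).symm)

theorem TuningRate.withHighProb_le {μ : Measure Ω} {lam : ℕ → Ω → ℝ} (h : TuningRate μ lam) {ε : ℝ}
    (hε : 0 < ε) : WithHighProb μ fun n ω => lam n ω ≤ ε := by
  have h1 : Tendsto (fun n : ℕ => (n : ℝ) ^ (-(1 / 4) : ℝ)) atTop (𝓝 0) :=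
    (tendsto_rpow_neg_atTop (by norm_num)).comp tendsto_natCast_atTop_atTop
  have h2 : WithHighProb μ fun n ω => ENNReal.ofReal (lam n ω)
      ≤ ((1 : ℝ≥0) : ℝ≥0∞) * ENNReal.ofReal ((n : ℝ) ^ (-(1 / 4) : ℝ)) := by
    have := h.rate 1 one_pos
    simpa only [WithHighProb, not_le] using this
  refine h2.mono ?_
  filter_upwards [h1.eventually_le_const hε] with n hn ω hω
  rw [ENNReal.coe_one, one_mul, ENNReal.ofReal_le_ofReal_iff (by positivity)] at hω
  exact hω.trans hn

/-- The estimated link fits the truth on the sample at rate `lam`, and its roughness, values and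
derivative are bounded. -/
theorem exists_withHighProb_empirical_rate [NeZero d] {μ : Measure Ω} [IsProbabilityMeasure μ]
    {X : ℕ → Ω → Vec d} {ξ Y : ℕ → Ω → ℝ} {m₀ p₀ : ℝ → ℝ} {ν₀ : Measure ℝ} {θ₀ : Vec d}
    {lam : ℕ → Ω → ℝ} {mHat : ℕ → Ω → ℝ → ℝ} {θHat : ℕ → Ω → Vec d}
    (hsample : IsSingleIndexSample μ X ξ Y m₀ θ₀) (herr : SubGaussianErrors μ (X 0) (ξ 0))
    {χ : Set (Vec d)} (hχ : IsCompact χ) (hXχ : ∀ i, ∀ᵐ ω ∂μ, X i ω ∈ χ)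
    (hcov : (covMatrix μ (X 0)).PosDef) {a b : ℝ} (hab : a < b)
    (hD : ∀ θ ∈ ParamSpace d, ∀ x ∈ χ, inner ℝ θ x ∈ Icc a b) (hθ₀ : θ₀ ∈ ParamSpace d)
    (h₀ : IsEnergyLink m₀ p₀ ν₀) (hm₀ : IsConvexLink (Icc a b) m₀)
    (hR₀ : roughness (Icc a b) m₀ < ∞) (hlam : TuningRate μ lam)
    (hPLSE : ∀ n : ℕ, 1 ≤ n → ∀ᵐ ω ∂μ, IsPLSE (Icc a b) (fun i : Fin n => X i ω)
      (fun i : Fin n => Y i ω) (lam n ω) (mHat n ω) (θHat n ω)) (M₁ : ℝ) :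
    ∃ C ≥ 0, WithHighProb μ fun n ω => (n : ℝ) ^ (-(2 / 5) : ℝ) ≤ M₁ * lam n ω →
      ∃ (m p : ℝ → ℝ) (ν : Measure ℝ), IsEnergyLink m p ν ∧ Monotone p ∧
        (∀ t, p t = p (max a (min b t))) ∧
        (∀ t ∈ Icc a b, linkDeriv (Icc a b) (mHat n ω) t = p t) ∧
        θHat n ω ∈ ParamSpace d ∧ ν.real univ ≤ C ∧ |m a| ≤ C ∧ (∀ t, |p t| ≤ C) ∧
        (∑ i : Fin n, (m (inner ℝ (θHat n ω) (X i ω)) - m₀ (inner ℝ θ₀ (X i ω))) ^ 2) / n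
          ≤ C * lam n ω ^ 2 := by
  obtain ⟨T', hT'⟩ := hχ.isBounded.exists_norm_le
  set T := max T' 0 with hT
  have hT0 : 0 ≤ T := le_max_right _ _
  have hχT : ∀ x ∈ χ, ‖x‖ ≤ T := fun x hx => (hT' x hx).trans (le_max_left _ _)
  obtain ⟨M₀', hM₀'⟩ := isCompact_Icc.exists_bound_of_continuousOn
    (h₀.continuous.continuousOn (s := Icc a b))
  set M₀ := max M₀' 0 with hM₀d
  have hM₀0 : 0 ≤ M₀ := le_max_right _ _
  have hM₀ : ∀ t ∈ Icc a b, |m₀ t| ≤ M₀ := fun t ht => (hM₀' t ht).trans (le_max_left _ _)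
  obtain ⟨hξ2, σ, hσ0, hσ⟩ := ae_condDistrib_subGaussian (hsample.measurable_X 0)
    (hsample.measurable_ξ 0) herr
  set s := Real.sqrt (∫ ω, ξ 0 ω ^ 2 ∂μ + 1) with hs
  have hint0 : 0 ≤ ∫ ω, ξ 0 ω ^ 2 ∂μ := integral_nonneg fun _ => sq_nonneg _
  have hs2 : s ^ 2 = ∫ ω, ξ 0 ω ^ 2 ∂μ + 1 := Real.sq_sqrt (by positivity)
  obtain ⟨c, hc, haff⟩ := exists_tendsto_measure_not_affine_bound hsample.isIIDDesign hχ hXχ hcov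
  obtain ⟨C₁, hC₁, hbd⟩ := IsEnergyLink.exists_bound_of_avg_sq_le hc hab.le
  obtain ⟨C₂', hrate⟩ := exists_rate_bound d (B := Real.sqrt (104 * σ)) (l := 2 * (d * T) + 1)
    (T := T) (C₁ := 2 * C₁) (M₀ := M₀) (s := s) (M₁ := M₁)
    (R₀ := (roughness (Icc a b) m₀).toReal) (Real.sqrt_nonneg _) (by positivity) hT0
    (by positivity) hM₀0 (Real.sqrt_nonneg _) ENNReal.toReal_nonneg
  set C₂ := max C₂' 0 with hC₂
  have hC₂0 : 0 ≤ C₂ := le_max_right _ _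
  set C₃ := 2 * C₁ * (C₂ + M₀ + C₂) with hC₃
  have hC₃0 : 0 ≤ C₃ := by positivity
  refine ⟨C₂ ^ 2 + C₃, by positivity, ?_⟩
  have hnoise := tendsto_measure_not_noiseBound hsample.measurable_X hsample.measurable_ξ
    hsample.indep hsample.identDistrib hσ0 hσ (T := T)
    (fun i => (hXχ i).mono fun ω hω => hχT _ hω) (f := fun x => m₀ (inner ℝ θ₀ x))
    (h₀.continuous.comp (by fun_prop)) (l := 2 * (d * T) + 1) (by positivity) (by linarith)
  have hξavg : WithHighProb μ fun n ω => |(∑ i : Fin n, ξ i ω ^ 2) / n - ∫ ω, ξ 0 ω ^ 2 ∂μ| ≤ 1 := by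
    have := tendsto_measure_lt_abs_avg_sub (Y := fun i ω => ξ i ω ^ 2) hξ2
      (fun i j hij => (hsample.indep.indepFun hij).comp (measurable_snd.pow_const 2)
        (measurable_snd.pow_const 2))
      (fun i => (hsample.identDistrib i).comp (measurable_snd.pow_const 2)) one_pos
    simpa only [WithHighProb, not_le] using this
  have hsure : WithHighProb μ fun n ω => (∀ i, X i ω ∈ χ) ∧
      (∀ i, Y i ω = m₀ (inner ℝ θ₀ (X i ω)) + ξ i ω) ∧ 0 < lam n ω ∧
      IsPLSE (Icc a b) (fun i : Fin n => X i ω) (fun i : Fin n => Y i ω) (lam n ω) (mHat n ω)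
        (θHat n ω) := by
    refine WithHighProb.of_ae ?_
    filter_upwards [eventually_ge_atTop 1] with n hn
    filter_upwards [ae_all_iff.2 hXχ, ae_all_iff.2 hsample.model, hlam.pos n, hPLSE n hn]
      with ω h1 h2 h3 h4 using ⟨h1, h2, h3, h4⟩
  refine (((show WithHighProb μ _ from haff).and (show WithHighProb μ _ from hnoise)).and
    ((hξavg.and (hlam.withHighProb_le one_pos)).and hsure)).mono ?_
  filter_upwards [eventually_ge_atTop 1] with n hn ω hω hM₁
  obtain ⟨⟨haffω, hnoiseω⟩, ⟨hξω, hlam1⟩, hXω, hYω, hlam0, hω⟩ := hω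
  obtain ⟨hR, hbasic⟩ := hω.basic_inequality (m₀ := m₀) (e := fun i : Fin n => ξ i ω) hlam0 hm₀ hR₀
    hθ₀ fun i => hYω i
  obtain ⟨m, p, ν, hm, hpm, hmm, hp, hν⟩ := hω.1.exists_extension hab hR
  have hclampmem : ∀ t, max a (min b t) ∈ Icc a b := fun t =>
    ⟨le_max_left _ _, max_le hab.le (min_le_left _ _)⟩
  have hclamp : ∀ t ∈ Icc a b, max a (min b t) = t := fun t ht => by
    rw [min_eq_right ht.2, max_eq_right ht.1]
  have hpc : ∀ t, p t = p (max a (min b t)) := by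
    intro t
    rw [hp t, hp (max a (min b t)), hclamp _ (hclampmem t)]
  have hθ := hω.2.1
  have hmeq : ∀ i : Fin n, mHat n ω (inner ℝ (θHat n ω) (X i ω)) = m (inner ℝ (θHat n ω) (X i ω)) :=
    fun i => (hmm _ (hD _ hθ _ (hXω i))).symm
  simp only [hmeq] at hbasic
  have hn0 : (0 : ℝ) < n := by exact_mod_cast hn
  set S := Real.sqrt (ν.real univ) with hS
  have hS2 : S ^ 2 = ν.real univ := Real.sq_sqrt measureReal_nonneg
  have hνR : (roughness (Icc a b) (mHat n ω)).toReal = S ^ 2 := by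
    rw [hS2, Measure.real, hν]
  set G := Real.sqrt ((∑ i : Fin n, (m (inner ℝ (θHat n ω) (X i ω))
    - m₀ (inner ℝ θ₀ (X i ω))) ^ 2) / n) with hG
  have hG2 : G ^ 2 = (∑ i : Fin n, (m (inner ℝ (θHat n ω) (X i ω))
    - m₀ (inner ℝ θ₀ (X i ω))) ^ 2) / n := Real.sq_sqrt (by positivity)
  have hG0 : 0 ≤ G := Real.sqrt_nonneg _
  have hS0 : 0 ≤ S := Real.sqrt_nonneg _
  -- the empirical norm of the estimated link itself
  have havg : (∑ i : Fin n, m (inner ℝ (θHat n ω) (X i ω)) ^ 2) / n ≤ (2 * (G + M₀)) ^ 2 := by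
    have h1 : ∑ i : Fin n, m (inner ℝ (θHat n ω) (X i ω)) ^ 2
        ≤ ∑ i : Fin n, (2 * (m (inner ℝ (θHat n ω) (X i ω)) - m₀ (inner ℝ θ₀ (X i ω))) ^ 2
          + 2 * M₀ ^ 2) := by
      refine Finset.sum_le_sum fun i _ => sq_le_two_mul_of_abs_sub_le ?_
      rw [sub_sub_cancel]
      exact hM₀ _ (hD _ hθ₀ _ (hXω i))
    rw [Finset.sum_add_distrib, ← Finset.mul_sum, Finset.sum_const, Finset.card_univ,
      Fintype.card_fin, nsmul_eq_mul] at h1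
    have h2 : (∑ i : Fin n, m (inner ℝ (θHat n ω) (X i ω)) ^ 2) / n ≤ 2 * G ^ 2 + 2 * M₀ ^ 2 := by
      rw [hG2, div_le_iff₀ hn0]
      refine h1.trans (le_of_eq ?_)
      field_simp
    have h3 := mul_nonneg hG0 hM₀0
    linarith [sq_nonneg G, sq_nonneg M₀, show (2 * (G + M₀)) ^ 2
      = 4 * G ^ 2 + 8 * (G * M₀) + 4 * M₀ ^ 2 by ring]
  obtain ⟨hma, hpB⟩ := hbd n (fun i => inner ℝ (θHat n ω) (X i ω)) hn
    (fun i => hD _ hθ _ (hXω i)) (fun u v => haffω u v _ hθ) m p ν S (2 * (G + M₀)) hm hS2.ge hS0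
    (by positivity) hpc havg
  have hP : C₁ * (2 * (G + M₀) + S) ≤ 2 * C₁ * (G + M₀ + S) := by
    have := mul_nonneg hC₁.le hS0
    linarith
  obtain ⟨η, hη, hθη⟩ := exists_mem_directionGrid hn hθ.1.le
  have hrates := hrate n hn (fun i => X i ω) (fun i => ξ i ω) (fun x => m₀ (inner ℝ θ₀ x)) m p ν
    (θHat n ω) η (lam n ω) _ G S hm hlam0 hM₁ (fun i => hχT _ (hXω i)) (by
      rw [hs2]; linarith [le_of_abs_le hξω]) hθη (hnoiseω η hη) hG0 hS0 hG2 hS2 hpB hP (by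
      rw [hG2, ← hνR]; exact hbasic)
  have hGle : G ≤ C₂ * lam n ω := hrates.1.trans (by gcongr; exact le_max_left _ _)
  have hSle : S ≤ C₂ := hrates.2.trans (le_max_left _ _)
  have hG1 : G ≤ C₂ := hGle.trans (mul_le_of_le_one_right hC₂0 hlam1)
  have hC₃le : C₁ * (2 * (G + M₀) + S) ≤ C₂ ^ 2 + C₃ := by
    have : 2 * C₁ * (G + M₀ + S) ≤ C₃ := by rw [hC₃]; gcongr
    linarith [sq_nonneg C₂]
  refine ⟨m, p, ν, hm, hpm, hpc, fun t ht => by rw [hp t, hclamp t ht], hθ, ?_, hma.trans hC₃le,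
    fun t => (hpB t).trans hC₃le, ?_⟩
  · rw [← hS2]
    have : S ^ 2 ≤ C₂ ^ 2 := by gcongr
    linarith
  · rw [← hG2]
    calc G ^ 2 ≤ (C₂ * lam n ω) ^ 2 := by gcongr
      _ = C₂ ^ 2 * lam n ω ^ 2 := by ring
      _ ≤ _ := by gcongr; linarith

end ConvexSIM

/-! ### The rate of the derivative -/

namespace ConvexSIM

variable {Ω : Type*} [MeasurableSpace Ω] {d : ℕ}

/-- Interpolation at the scale `√lam`: a link difference of `L²` size `lam` with bounded roughness
has a derivative of `L²` size `√lam`. -/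
theorem IsEnergyLink.integral_sq_deriv_le_of_integral_sq_le {h q : ℝ → ℝ} {ν : Measure ℝ}
    (hh : IsEnergyLink h q ν) {α l lam K V : ℝ} (hl : 0 < l) (hlam : 0 < lam) (hlaml : lam ≤ l ^ 2)
    (hV : ν.real univ ≤ V) (hK : ∫ t in α..(α + l), h t ^ 2 ≤ K * lam ^ 2) :
    ∫ t in α..(α + l), q t ^ 2 ≤ (864 * K + 2 * V) * lam := by
  set s := Real.sqrt lam with hs
  have hs0 : 0 < s := Real.sqrt_pos.2 hlam
  have hs2 : s ^ 2 = lam := Real.sq_sqrt hlam.le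
  have hsl : s ≤ l := by
    rw [← Real.sqrt_sq hl.le]; exact Real.sqrt_le_sqrt hlaml
  -- the interpolation scale is `l / N`, the largest below `√lam` that divides the interval
  set N := ⌈l / s⌉₊ with hN
  have hN1 : l / s ≤ N := Nat.le_ceil _
  have hN0 : (0 : ℝ) < N := lt_of_lt_of_le (by positivity) hN1
  have hN2 : (N : ℝ) ≤ 2 * (l / s) := by
    have h1 := (Nat.ceil_lt_add_one (by positivity : 0 ≤ l / s)).le
    have h2 : 1 ≤ l / s := by rw [le_div_iff₀ hs0]; linarith
    rw [← hN] at h1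
    linarith
  have hδ : 0 < l / N := by positivity
  have hδs : l / N ≤ s := by
    rw [div_le_iff₀ hN0]
    rw [div_le_iff₀ hs0] at hN1
    linarith
  have h1 := hh.integral_sq_deriv_le (a := α) hδ N
  rw [mul_div_cancel₀ _ hN0.ne'] at h1
  have hI0 : 0 ≤ ∫ t in α..(α + l), h t ^ 2 :=
    intervalIntegral.integral_nonneg (by linarith) fun _ _ => sq_nonneg _
  have h2 : 216 / (l / N) ^ 2 ≤ 864 / lam := by
    have : 216 / (l / N) ^ 2 = 216 * (N : ℝ) ^ 2 / l ^ 2 := by field_simp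
    rw [this]
    calc 216 * (N : ℝ) ^ 2 / l ^ 2 ≤ 216 * (2 * (l / s)) ^ 2 / l ^ 2 := by gcongr
      _ = 864 / s ^ 2 := by field_simp; norm_num
      _ = _ := by rw [hs2]
  calc _ ≤ 216 / (l / N) ^ 2 * (∫ t in α..(α + l), h t ^ 2) + 2 * (l / N) ^ 2 * ν.real univ := h1
    _ ≤ 864 / lam * (K * lam ^ 2) + 2 * s ^ 2 * V := by gcongr
    _ = _ := by rw [hs2]; field_simp

/-- A density bounded below compares Lebesgue measure on the range of the index with its law. -/
theorem intervalIntegral_sq_le_of_density {μ : Measure Ω} [IsProbabilityMeasure μ] {X : Ω → Vec d}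
    (hX : Measurable X) {χ : Set (Vec d)} (hχ : IsCompact χ) (hXχ : ∀ᵐ ω ∂μ, X ω ∈ χ) {θ₀ : Vec d}
    {α l cf : ℝ} (hl : 0 < l) (hcf : 0 < cf)
    (hlow : ENNReal.ofReal cf • volume.restrict (Icc α (α + l))
      ≤ μ.map fun ω => (inner ℝ θ₀ (X ω) : ℝ)) {h : ℝ → ℝ} (hh : Continuous h) :
    ∫ t in α..(α + l), h t ^ 2 ≤ 1 / cf * ∫ ω, h (inner ℝ θ₀ (X ω)) ^ 2 ∂μ := by
  have hm : AEMeasurable (fun ω => (inner ℝ θ₀ (X ω) : ℝ)) μ :=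
    (by fun_prop : Measurable _).aemeasurable
  have hint : Integrable (fun t => h t ^ 2) (μ.map fun ω => (inner ℝ θ₀ (X ω) : ℝ)) := by
    rw [integrable_map_measure (by fun_prop : Continuous _).aestronglyMeasurable hm]
    exact integrable_of_continuous_of_mem_compact hX hχ hXχ (f := fun x => h (inner ℝ θ₀ x) ^ 2)
      (by fun_prop)
  have h1 := integral_mono_measure hlow (ae_of_all _ fun t => sq_nonneg (h t)) hint
  rw [integral_smul_measure, integral_map hm (by fun_prop : Continuous _).aestronglyMeasurable,
    integral_Icc_eq_integral_Ioc, ← intervalIntegral.integral_of_le (by linarith),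
    ENNReal.toReal_ofReal hcf.le, smul_eq_mul] at h1
  rw [one_div, ← div_eq_inv_mul, le_div_iff₀ hcf, mul_comm]
  exact h1

/-- On the interval carrying the true index, the derivative of the estimated link converges at the
rate `√lam` in `L²`. -/
theorem exists_withHighProb_deriv_rate [NeZero d] {μ : Measure Ω} [IsProbabilityMeasure μ]
    {X : ℕ → Ω → Vec d} {ξ Y : ℕ → Ω → ℝ} {m₀ p₀ : ℝ → ℝ} {ν₀ : Measure ℝ} {θ₀ : Vec d}
    {lam : ℕ → Ω → ℝ} {mHat : ℕ → Ω → ℝ → ℝ} {θHat : ℕ → Ω → Vec d}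
    (hsample : IsSingleIndexSample μ X ξ Y m₀ θ₀) (herr : SubGaussianErrors μ (X 0) (ξ 0))
    (hdesign : MixedDesign μ (X 0) θ₀) (hnd : NondegenerateGivenIndex μ (X 0) θ₀)
    {χ : Set (Vec d)} (hχ : IsCompact χ) (hXχ : ∀ i, ∀ᵐ ω ∂μ, X i ω ∈ χ)
    (hcov : (covMatrix μ (X 0)).PosDef) {a b : ℝ} (hab : a < b)
    (hD : ∀ θ ∈ ParamSpace d, ∀ x ∈ χ, inner ℝ θ x ∈ Icc a b) (hθ₀ : θ₀ ∈ ParamSpace d)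
    (hθ₀_pos : 0 < θ₀ 0) {α l cf : ℝ} (hl : 0 < l) (hcf : 0 < cf)
    (hD₀ : ∀ x ∈ χ, inner ℝ θ₀ x ∈ Icc α (α + l))
    (hlow : ENNReal.ofReal cf • volume.restrict (Icc α (α + l))
      ≤ μ.map fun ω => (inner ℝ θ₀ (X 0 ω) : ℝ))
    (h₀ : IsEnergyLink m₀ p₀ ν₀) (hne : ¬ ∀ᵐ ω ∂μ, p₀ (inner ℝ θ₀ (X 0 ω)) = 0)
    (hm₀ : IsConvexLink (Icc a b) m₀)
    (hR₀ : roughness (Icc a b) m₀ < ∞) (hlam : TuningRate μ lam)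
    (hPLSE : ∀ n : ℕ, 1 ≤ n → ∀ᵐ ω ∂μ, IsPLSE (Icc a b) (fun i : Fin n => X i ω)
      (fun i : Fin n => Y i ω) (lam n ω) (mHat n ω) (θHat n ω)) (M₁ : ℝ) :
    ∃ M, WithHighProb μ fun n ω => (n : ℝ) ^ (-(2 / 5) : ℝ) ≤ M₁ * lam n ω →
      ∃ p : ℝ → ℝ, Continuous p ∧ (∀ t ∈ Icc a b, linkDeriv (Icc a b) (mHat n ω) t = p t) ∧
        ∫ t in α..(α + l), (p t - p₀ t) ^ 2 ≤ M * lam n ω := by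
  obtain ⟨A, hA0, hrate⟩ := exists_withHighProb_empirical_rate hsample herr hχ hXχ hcov hab hD hθ₀ h₀
    hm₀ hR₀ hlam hPLSE M₁
  have hX0 := hsample.measurable_X 0
  obtain ⟨T', hT'⟩ := hχ.isBounded.exists_norm_le
  set T := max T' 1 with hT
  have hT0 : 0 < T := lt_of_lt_of_le one_pos (le_max_right _ _)
  have hχT : ∀ x ∈ χ, ‖x‖ ≤ T := fun x hx => (hT' x hx).trans (le_max_left _ _)
  obtain ⟨L', hL'⟩ := isCompact_Icc.exists_bound_of_continuousOn
    (h₀.continuous_deriv.continuousOn (s := Icc α (α + l)))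
  set L := max L' 0 with hLd
  have hL0 : 0 ≤ L := le_max_right _ _
  have hL : ∀ t ∈ Icc α (α + l), |p₀ t| ≤ L := fun t ht => (hL' t ht).trans (le_max_left _ _)
  have hTae : ∀ᵐ ω ∂μ, ‖X 0 ω‖ ≤ T := (hXχ 0).mono fun ω hω => hχT _ hω
  have hLae : ∀ᵐ ω ∂μ, |p₀ (inner ℝ θ₀ (X 0 ω))| ≤ L := (hXχ 0).mono fun ω hω => hL _ (hD₀ _ hω)
  have hZae : ∀ᵐ ω ∂μ, inner ℝ θ₀ (X 0 ω) ∈ Icc α (α + l) := (hXχ 0).mono fun ω hω => hD₀ _ hω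
  obtain ⟨c, hc, hpop⟩ := exists_stepPlusLinear_bound hX0 hnd hTae h₀.continuous_deriv hLae hne hl hcf
    hlow
  obtain ⟨η, hη, Cl, hCl, hlocal⟩ := exists_integral_sq_sub_le_of_close (A := A) hX0 hθ₀.1 hl hT0 hL0
    hc h₀ hL hZae hpop
  obtain ⟨δ, hδ, hcons⟩ := exists_tendsto_measure_not_close hsample.isIIDDesign hχ hXχ hdesign hnd
    hθ₀.1 hθ₀_pos h₀.hasDerivAt h₀.continuous_deriv hne hl hcf hlow hab.le A A hη
  have hgram := tendsto_measure_not_stepPlusLinear_bound hsample.isIIDDesign hTae h₀.continuous_deriv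
    hLae hc hpop
  -- `lam` is small enough for the estimate to enter the neighborhood given by consistency
  set lam₀ := min (min 1 (l ^ 2)) (δ / (A + 1)) with hlam₀
  have hlam₀0 : 0 < lam₀ := by positivity
  refine ⟨864 * (1 / cf * (Cl * (A + M₁ ^ 2))) + 2 * (2 * A + 2 * ν₀.real univ), ?_⟩
  have hsure : WithHighProb μ fun n ω => (∀ i, X i ω ∈ χ) ∧ 0 < lam n ω := by
    refine WithHighProb.of_ae (Eventually.of_forall fun n => ?_)
    filter_upwards [ae_all_iff.2 hXχ, hlam.pos n] with ω h1 h2 using ⟨h1, h2⟩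
  refine ((hrate.and ((show WithHighProb μ _ from hcons).and (show WithHighProb μ _ from hgram))).and
    ((hlam.withHighProb_le hlam₀0).and hsure)).mono ?_
  filter_upwards [eventually_ge_atTop 1] with n hn ω hω hM₁
  obtain ⟨⟨hrateω, hconsω, hgramω⟩, hlamω, hXω, hlam0⟩ := hω
  obtain ⟨m, p, ν, hm, hpm, hpc, hp, hθ, hνA, hma, hpA, hG⟩ := hrateω hM₁
  have hlam1 : lam n ω ≤ 1 := hlamω.trans ((min_le_left _ _).trans (min_le_left _ _))
  have hlaml : lam n ω ≤ l ^ 2 := hlamω.trans ((min_le_left _ _).trans (min_le_right _ _))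
  have hlamδ : lam n ω ≤ δ / (A + 1) := hlamω.trans (min_le_right _ _)
  have hlamsq : lam n ω ^ 2 ≤ lam n ω := by
    rw [sq]; exact mul_le_of_le_one_left hlam0.le hlam1
  have hGδ : A * lam n ω ^ 2 ≤ δ := by
    rw [le_div_iff₀ (by positivity)] at hlamδ
    have := mul_le_mul_of_nonneg_left hlamsq hA0
    linarith
  obtain ⟨hθη, hpη⟩ := hconsω m p ν _ hθ hm hpm hpc hνA hma hpA (hG.trans hGδ)
  have h1 := hlocal n hn (fun i => X i ω) (fun i => hχT _ (hXω i)) (fun i => hD₀ _ (hXω i)) _ hgramω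
    m p ν _ hm hνA hθ.1 hθη hpη
  have hN : (1 / ((⌈(n : ℝ) ^ (2 / 5 : ℝ)⌉₊ : ℝ) + 1)) ^ 2 ≤ M₁ ^ 2 * lam n ω ^ 2 := by
    have hn0 : (0 : ℝ) < n := by exact_mod_cast hn
    have h2 : 1 / ((⌈(n : ℝ) ^ (2 / 5 : ℝ)⌉₊ : ℝ) + 1) ≤ (n : ℝ) ^ (-(2 / 5) : ℝ) := by
      rw [Real.rpow_neg hn0.le, one_div]
      exact inv_anti₀ (by positivity) ((Nat.le_ceil _).trans (by linarith))
    rw [← mul_pow]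
    exact pow_le_pow_left₀ (by positivity) (h2.trans hM₁) 2
  have h2 : ∫ ω', (m (inner ℝ θ₀ (X 0 ω')) - m₀ (inner ℝ θ₀ (X 0 ω'))) ^ 2 ∂μ
      ≤ Cl * (A + M₁ ^ 2) * lam n ω ^ 2 := by
    refine h1.trans ?_
    calc _ ≤ Cl * (A * lam n ω ^ 2 + M₁ ^ 2 * lam n ω ^ 2) := by gcongr
      _ = _ := by ring
  have hdiff := hm.sub h₀
  have h3 := intervalIntegral_sq_le_of_density hX0 hχ (hXχ 0) hl hcf hlow
    (h := fun t => m t - m₀ t) (hm.continuous.sub h₀.continuous)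
  refine ⟨p, hm.continuous_deriv, hp, hdiff.integral_sq_deriv_le_of_integral_sq_le hl hlam0 hlaml ?_
    (h3.trans ?_)⟩
  · rw [hm.sub_measureReal_univ h₀]; linarith
  · calc _ ≤ 1 / cf * (Cl * (A + M₁ ^ 2) * lam n ω ^ 2) := by gcongr
      _ = _ := by ring

end ConvexSIM

/-! ### Index sets, densities and the conclusion -/

namespace ConvexSIM

variable {Ω : Type*} [MeasurableSpace Ω] {d : ℕ}

theorem exists_eq_Icc_of_compact_convex {S : Set ℝ} (hS : IsCompact S) (hconv : Convex ℝ S)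
    (hne : S.Nonempty) : ∃ a b, S = Icc a b :=
  ⟨_, _, eq_Icc_of_connected_compact ⟨hne, hconv.isPreconnected⟩ hS⟩

theorem isCompact_indexSet {χ : Set (Vec d)} (hχ : IsCompact χ) (θ : Vec d) :
    IsCompact (indexSet χ θ) := by
  have h := hχ.image (f := fun x => (inner ℝ θ x : ℝ)) (by fun_prop)
  convert h using 1
  ext t
  simp [indexSet, eq_comm]

theorem isCompact_setOf_index {χ : Set (Vec d)} (hχ : IsCompact χ) {Θ : Set (Vec d)}
    (hΘ : IsCompact Θ) : IsCompact {t : ℝ | ∃ θ ∈ Θ, t ∈ indexSet χ θ} := by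
  have h := (hΘ.prod hχ).image (f := fun z : Vec d × Vec d => (inner ℝ z.1 z.2 : ℝ)) (by fun_prop)
  convert h using 1
  ext t
  constructor
  · rintro ⟨θ, hθ, x, hx, rfl⟩
    exact ⟨(θ, x), ⟨hθ, hx⟩, rfl⟩
  · rintro ⟨⟨θ, x⟩, ⟨hθ, hx⟩, rfl⟩
    exact ⟨θ, hθ, x, hx, rfl⟩

theorem isCompact_fullIndexSet [NeZero d] {χ : Set (Vec d)} (hχ : IsCompact χ) :
    IsCompact (fullIndexSet χ) :=
  isCompact_setOf_index hχ (isCompact_paramSpace d)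

theorem isCompact_localIndexSet [NeZero d] {χ : Set (Vec d)} (hχ : IsCompact χ) (θ₀ : Vec d)
    (r : ℝ) : IsCompact (localIndexSet χ θ₀ r) := by
  have h := isCompact_setOf_index hχ ((isCompact_paramSpace d).inter_right
    (isClosed_le (f := fun θ : Vec d => ‖θ - θ₀‖) (g := fun _ => r) (by fun_prop) continuous_const))
  convert h using 1
  ext t
  constructor
  · rintro ⟨θ, hθ, hr, ht⟩
    exact ⟨θ, ⟨hθ, hr⟩, ht⟩
  · rintro ⟨θ, ⟨hθ, hr⟩, ht⟩
    exact ⟨θ, hθ, hr, ht⟩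

theorem ae_mem_support {μ : Measure Ω} {X : Ω → Vec d} (hX : Measurable X) :
    ∀ᵐ ω ∂μ, X ω ∈ (μ.map X).support :=
  ae_of_ae_map hX.aemeasurable Measure.support_mem_ae

theorem smul_restrict_le_withDensity {f : ℝ → ℝ} {c : ℝ} {S : Set ℝ} (hS : MeasurableSet S)
    (hf : ∀ t ∈ S, c ≤ f t) :
    ENNReal.ofReal c • volume.restrict S ≤ volume.withDensity fun t => ENNReal.ofReal (f t) := by
  rw [← withDensity_const, ← withDensity_indicator hS]
  refine withDensity_mono (ae_of_all _ fun t => ?_)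
  by_cases ht : t ∈ S
  · rw [indicator_of_mem ht]; exact ENNReal.ofReal_le_ofReal (hf t ht)
  · rw [indicator_of_notMem ht]; exact zero_le

theorem le_smul_restrict_of_withDensity {P : Measure ℝ} {f : ℝ → ℝ} {C : ℝ} {S : Set ℝ}
    (hP : P = volume.withDensity fun t => ENNReal.ofReal (f t))
    (hPS : ∀ᵐ t ∂P, t ∈ S) (hf : ∀ t, f t ≤ C) : P ≤ ENNReal.ofReal C • volume.restrict S := by
  rw [← Measure.restrict_eq_self_of_ae_mem hPS, ← Measure.restrict_smul]
  refine Measure.restrict_mono subset_rfl ?_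
  rw [hP, ← withDensity_const]
  exact withDensity_mono (ae_of_all _ fun t => ENNReal.ofReal_le_ofReal (hf t))

/-- A density bounded above bounds the norm of a function of the index by its norm with respect to
Lebesgue measure. -/
theorem eLpNorm_comp_index_le {μ : Measure Ω} [IsProbabilityMeasure μ] {X : Ω → Vec d}
    (hX : Measurable X) {χ : Set (Vec d)} (hχ : IsCompact χ) (hXχ : ∀ᵐ ω ∂μ, X ω ∈ χ) {θ₀ : Vec d}
    {α l C : ℝ} (hl : 0 < l) (hC : 0 ≤ C)
    (hup : (μ.map fun ω => (inner ℝ θ₀ (X ω) : ℝ))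
      ≤ ENNReal.ofReal C • volume.restrict (Icc α (α + l)))
    {q : ℝ → ℝ} (hq : Continuous q) {g : Vec d → ℝ}
    (hg : ∀ᵐ x ∂(μ.map X), g x = q (inner ℝ θ₀ x)) :
    eLpNorm g 2 (μ.map X) ≤ ENNReal.ofReal (Real.sqrt (C * ∫ t in α..(α + l), q t ^ 2)) := by
  have hqc : Continuous fun x : Vec d => q (inner ℝ θ₀ x) := by fun_prop
  have hLp : MemLp (fun x : Vec d => q (inner ℝ θ₀ x)) 2 (μ.map X) := by
    rw [memLp_two_iff_integrable_sq hqc.aestronglyMeasurable,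
      integrable_map_measure (by fun_prop : Continuous _).aestronglyMeasurable hX.aemeasurable]
    exact integrable_of_continuous_of_mem_compact hX hχ hXχ (f := fun x => q (inner ℝ θ₀ x) ^ 2)
      (by fun_prop)
  rw [eLpNorm_congr_ae hg, hLp.eLpNorm_eq_integral_rpow_norm two_ne_zero ENNReal.ofNat_ne_top]
  apply ENNReal.ofReal_le_ofReal
  simp only [ENNReal.toReal_ofNat, Real.norm_eq_abs, Real.rpow_ofNat, sq_abs]
  rw [Real.sqrt_eq_rpow, ← one_div]
  refine Real.rpow_le_rpow (integral_nonneg fun _ => sq_nonneg _) ?_ (by norm_num)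
  have hint : Integrable (fun t => q t ^ 2) (ENNReal.ofReal C • volume.restrict (Icc α (α + l))) :=
    Integrable.smul_measure (by
      exact (by fun_prop : Continuous fun t => q t ^ 2).continuousOn.integrableOn_Icc)
      ENNReal.ofReal_ne_top
  have h1 := integral_mono_measure hup (ae_of_all _ fun t => sq_nonneg (q t)) hint
  rw [integral_smul_measure, integral_map (by fun_prop : Measurable _).aemeasurable
    (by fun_prop : Continuous _).aestronglyMeasurable,
    integral_Icc_eq_integral_Ioc, ← intervalIntegral.integral_of_le (by linarith),
    ENNReal.toReal_ofReal hC, smul_eq_mul] at h1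
  rwa [integral_map hX.aemeasurable (by fun_prop : Continuous _).aestronglyMeasurable]

/-- The order `lam⁻¹ = O_p(n^{2/5})` of the tuning parameter allows to assume `n^{-2/5} ≤ M₁ lam`,
where the constant `M₁` depends on the probability that is sacrificed. -/
theorem IsBigOp.of_withHighProb {μ : Measure Ω} [IsProbabilityMeasure μ] {lam : ℕ → Ω → ℝ}
    (hlam : TuningRate μ lam) {A B : ℕ → Ω → ℝ≥0∞}
    (h : ∀ M₁ : ℝ, ∃ M : ℝ≥0, WithHighProb μ fun n ω =>
      (n : ℝ) ^ (-(2 / 5) : ℝ) ≤ M₁ * lam n ω → A n ω ≤ M * B n ω) : IsBigOp μ A B := by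
  intro ε hε
  obtain ⟨M₁, hM₁⟩ := hlam.inv_rate (ε / 2) (ENNReal.half_pos hε.ne')
  obtain ⟨M, hM⟩ := h M₁
  have hpos : WithHighProb μ fun n ω => 0 < lam n ω :=
    WithHighProb.of_ae (Eventually.of_forall hlam.pos)
  refine ⟨M, ?_⟩
  filter_upwards [hM₁, (hM.and hpos).eventually_le_const (ENNReal.half_pos hε.ne'),
    eventually_ge_atTop 1] with n h1 h2 hn
  refine (measure_mono ?_).trans ((measure_union_le _ _).trans
    ((add_le_add h1 h2).trans (ENNReal.add_halves ε).le))
  intro ω hω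
  by_contra hcon
  simp only [mem_union, mem_ofPred_eq, not_or, not_lt, not_not] at hcon
  obtain ⟨h3, h4, h5⟩ := hcon
  refine absurd hω (not_lt.2 (h4 ?_))
  have hn0 : (0 : ℝ) < n := by exact_mod_cast hn
  rw [← ENNReal.ofReal_coe_nnreal, ← ENNReal.ofReal_mul M₁.coe_nonneg,
    ENNReal.ofReal_le_ofReal_iff (by positivity)] at h3
  rw [Real.rpow_neg hn0.le, inv_le_iff_one_le_mul₀ (by positivity)]
  rw [inv_le_iff_one_le_mul₀ h5] at h3
  linarith

end ConvexSIM

open ConvexSIM in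
theorem mainTheorem10 {Ω : Type*} [MeasurableSpace Ω] (μ : Measure Ω) [IsProbabilityMeasure μ]
    (d : ℕ) [NeZero d]
    (X : ℕ → Ω → Vec d) (ξ Y : ℕ → Ω → ℝ) (m₀ : ℝ → ℝ) (θ₀ : Vec d)
    (lam : ℕ → Ω → ℝ) (mHat : ℕ → Ω → ℝ → ℝ) (θHat : ℕ → Ω → Vec d) (r : ℝ)
    -- the model and its parameters
    (hθ₀ : θ₀ ∈ ParamSpace d) (hθ₀_pos : 0 < θ₀ 0)
    (hsample : IsSingleIndexSample μ X ξ Y m₀ θ₀)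
    -- assumptions on the design and on the errors
    (hdesign : MixedDesign μ (X 0) θ₀)
    (hcompact : IsCompact (μ.map (X 0)).support)
    (herr : SubGaussianErrors μ (X 0) (ξ 0))
    (hgram : (weightedGram μ (X 0) θ₀
      (linkDeriv (localIndexSet (μ.map (X 0)).support θ₀ r) m₀)).det ≠ 0)
    (hcov : (covMatrix μ (X 0)).PosDef)
    (hnondeg : NondegenerateGivenIndex μ (X 0) θ₀)
    (hr : 0 < r) (hdensity : RegularIndexDensity μ (X 0) θ₀ r)
    (hinterval : (indexSet (μ.map (X 0)).support θ₀).OrdConnected)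
    -- assumptions on the true link and on the tuning parameters
    (hlink : SmoothTrueLink (localIndexSet (μ.map (X 0)).support θ₀ r) m₀)
    (hlam : TuningRate μ lam)
    -- the penalized least squares estimators
    (hPLSE : ∀ n : ℕ, 1 ≤ n → ∀ᵐ ω ∂μ,
      IsPLSE (fullIndexSet (μ.map (X 0)).support) (fun i : Fin n => X i ω) (fun i : Fin n => Y i ω)
        (lam n ω) (mHat n ω) (θHat n ω)) :
    IsBigOp μ
      (fun n ω => eLpNorm (fun x : Vec d =>
        linkDeriv (fullIndexSet (μ.map (X 0)).support) (mHat n ω) (inner ℝ θ₀ x)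
          - linkDeriv (localIndexSet (μ.map (X 0)).support θ₀ r) m₀ (inner ℝ θ₀ x))
        2 (μ.map (X 0)))
      (fun n ω => ENNReal.ofReal (Real.sqrt (lam n ω))) := by
  have hX0 := hsample.measurable_X 0
  set χ := (μ.map (X 0)).support with hχ
  have hXχ : ∀ i, ∀ᵐ ω ∂μ, X i ω ∈ χ := fun i => by
    have h := ae_mem_support (μ := μ) (hsample.measurable_X i)
    rwa [(hsample.isIIDDesign.identDistrib i).map_eq] at h
  obtain ⟨x₀, hx₀⟩ : χ.Nonempty := by
    obtain ⟨ω, hω⟩ := (hXχ 0).exists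
    exact ⟨_, hω⟩
  have hθ₀r : ‖θ₀ - θ₀‖ ≤ r := by simpa using hr.le
  have hD₀loc : indexSet χ θ₀ ⊆ localIndexSet χ θ₀ r := fun t ht => ⟨θ₀, hθ₀, hθ₀r, ht⟩
  have hlocD : localIndexSet χ θ₀ r ⊆ fullIndexSet χ := by
    rintro t ⟨θ, hθ, -, ht⟩
    exact ⟨θ, hθ, ht⟩
  have hne₀ : (indexSet χ θ₀).Nonempty := ⟨_, x₀, hx₀, rfl⟩
  -- all index sets are compact intervals
  obtain ⟨α, β, hD₀⟩ := exists_eq_Icc_of_compact_convex (isCompact_indexSet hcompact θ₀)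
    (convex_iff_ordConnected.2 hinterval) hne₀
  obtain ⟨a₁, b₁, hloc⟩ := exists_eq_Icc_of_compact_convex (isCompact_localIndexSet hcompact θ₀ r)
    hlink.isConvexLink.convexOn.1 (hne₀.mono hD₀loc)
  obtain ⟨a, b, hD⟩ : ∃ a b, fullIndexSet χ = Icc a b := by
    obtain ⟨ω, hω⟩ := (hPLSE 1 le_rfl).exists
    exact exists_eq_Icc_of_compact_convex (isCompact_fullIndexSet hcompact) hω.1.convexOn.1
      (hne₀.mono (hD₀loc.trans hlocD))
  have hZae : ∀ᵐ ω ∂μ, inner ℝ θ₀ (X 0 ω) ∈ Icc α β := by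
    filter_upwards [hXχ 0] with ω hω
    rw [← hD₀]
    exact ⟨_, hω, rfl⟩
  have hZm : Measurable fun ω => (inner ℝ θ₀ (X 0 ω) : ℝ) := by fun_prop
  have hPae : ∀ᵐ t ∂(μ.map fun ω => (inner ℝ θ₀ (X 0 ω) : ℝ)), t ∈ Icc α β :=
    (ae_map_iff hZm.aemeasurable measurableSet_Icc).2 hZae
  obtain ⟨C, hC⟩ := hdensity.1
  obtain ⟨f, cf, hcf, -, hP, hfl, hfu⟩ := hC θ₀ hθ₀ hθ₀r
  -- the law of the index has a density, so that its range is not a point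
  have hαβ : α < β := by
    by_contra hcon
    have h1 : volume (Icc α β) = 0 := by
      rw [Real.volume_Icc, ENNReal.ofReal_eq_zero]; linarith
    have h2 : (μ.map fun ω => (inner ℝ θ₀ (X 0 ω) : ℝ)) (Icc α β) = 0 := by
      rw [hP]; exact withDensity_absolutelyContinuous _ _ h1
    have h3 : ∀ᵐ ω ∂μ, inner ℝ θ₀ (X 0 ω) ∉ Icc α β := by
      rw [Measure.map_apply hZm measurableSet_Icc] at h2
      exact measure_eq_zero_iff_ae_notMem.1 h2
    obtain ⟨ω, h4, h5⟩ := (hZae.and h3).exists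
    exact h5 h4
  obtain ⟨l, hl, rfl⟩ : ∃ l, 0 < l ∧ β = α + l := ⟨β - α, by linarith, by ring⟩
  rw [hD₀, hloc] at hD₀loc
  rw [hloc, hD] at hlocD
  have ha₁b₁ : a₁ < b₁ := by
    have h1 := hD₀loc (left_mem_Icc.2 hαβ.le)
    have h2 := hD₀loc (right_mem_Icc.2 hαβ.le)
    linarith [h1.1, h2.2]
  have hab : a < b := by
    have h1 := hlocD (left_mem_Icc.2 ha₁b₁.le)
    have h2 := hlocD (right_mem_Icc.2 ha₁b₁.le)
    linarith [h1.1, h2.2]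
  rw [hD₀] at hfl
  have hlow := smul_restrict_le_withDensity measurableSet_Icc hfl
  rw [← hP] at hlow
  have hup := le_smul_restrict_of_withDensity (C := max C 0) hP hPae
    fun t => (hfu t).trans (le_max_left _ _)
  rw [hloc] at hgram hlink ⊢
  rw [hD] at hPLSE ⊢
  -- the true link, extended linearly beyond its interval
  obtain ⟨m₁, p₀, ν₀, h₀, hp₀m, hm₁, hp₀, -⟩ := hlink.isConvexLink.exists_extension ha₁b₁
    hlink.roughness_lt_top
  obtain ⟨hadm, hrough⟩ := hlink.isConvexLink.extension_admissible ha₁b₁ hlocD h₀.hasDerivAt hp₀m hp₀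
  have hp₀eq : ∀ t ∈ Icc α (α + l), linkDeriv (Icc a₁ b₁) m₀ t = p₀ t := by
    intro t ht
    have h1 := hD₀loc ht
    rw [hp₀ t, min_eq_right h1.2, max_eq_right h1.1]
  have hmem₀ : ∀ x ∈ χ, inner ℝ θ₀ x ∈ Icc α (α + l) := fun x hx => by
    rw [← hD₀]; exact ⟨x, hx, rfl⟩
  have hmem : ∀ θ ∈ ParamSpace d, ∀ x ∈ χ, inner ℝ θ x ∈ Icc a b := fun θ hθ x hx => by
    rw [← hD]; exact ⟨θ, hθ, x, hx, rfl⟩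
  have hsample₁ : IsSingleIndexSample μ X ξ Y m₁ θ₀ :=
    { hsample with
      model := fun i => by
        filter_upwards [hsample.model i, hXχ i] with ω h1 h2
        rw [h1, hm₁ _ (hD₀loc (hmem₀ _ h2))] }
  -- a derivative that vanishes almost surely would make the weighted Gram matrix zero
  have hne : ¬ ∀ᵐ ω ∂μ, p₀ (inner ℝ θ₀ (X 0 ω)) = 0 := by
    intro h0
    apply hgram
    have : weightedGram μ (X 0) θ₀ (linkDeriv (Icc a₁ b₁) m₀) = 0 := by
      ext i j
      refine integral_eq_zero_of_ae ?_
      filter_upwards [h0, hXχ 0] with ω h1 h2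
      rw [hp₀eq _ (hmem₀ _ h2), h1]
      simp
    rw [this]
    exact Matrix.det_zero
  -- the density bound transfers the rate from Lebesgue measure to the law of the covariates
  refine IsBigOp.of_withHighProb hlam fun M₁ => ?_
  obtain ⟨M, hM⟩ := exists_withHighProb_deriv_rate hsample₁ herr hdesign hnondeg hcompact hXχ hcov hab
    hmem hθ₀ hθ₀_pos hl hcf hmem₀ hlow h₀ hne hadm (hrough.trans_lt hlink.roughness_lt_top) hlam hPLSE
    M₁
  refine ⟨(Real.sqrt (max C 0 * max M 0)).toNNReal, ?_⟩
  have hpos : WithHighProb μ fun n ω => 0 < lam n ω :=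
    WithHighProb.of_ae (Eventually.of_forall hlam.pos)
  refine (hM.and hpos).mono (Eventually.of_forall fun n ω hω hM₁ => ?_)
  obtain ⟨p, hpc, hp, hint⟩ := hω.1 hM₁
  have hg : ∀ᵐ x ∂(μ.map (X 0)), linkDeriv (Icc a b) (mHat n ω) (inner ℝ θ₀ x)
      - linkDeriv (Icc a₁ b₁) m₀ (inner ℝ θ₀ x) = p (inner ℝ θ₀ x) - p₀ (inner ℝ θ₀ x) := by
    filter_upwards [Measure.support_mem_ae (μ := μ.map (X 0))] with x hx
    rw [hp _ (hmem _ hθ₀ x hx), hp₀eq _ (hmem₀ x hx)]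
  refine (eLpNorm_comp_index_le hX0 hcompact (hXχ 0) hl (le_max_right C 0) hup
    (q := fun t => p t - p₀ t) (hpc.sub h₀.continuous_deriv) hg).trans ?_
  rw [ENNReal.ofNNReal_toNNReal, ← ENNReal.ofReal_mul (Real.sqrt_nonneg _),
    ← Real.sqrt_mul (by positivity)]
  apply ENNReal.ofReal_le_ofReal
  apply Real.sqrt_le_sqrt
  have hlam0 := hω.2
  rw [mul_assoc]
  exact mul_le_mul_of_nonneg_left (hint.trans (by gcongr; exact le_max_left _ _)) (le_max_right _ _)
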